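/- **Setting.** Consider the real LTI plant $$\dot x = Ax + B_u u + B_w w,\qquad z = C_z x + D_u u + D_w w,\qquad y = C_y x + D_{yw} w ,$$ with $x\in\mathbb R^{N_x}$, $u\in\mathbb R^{N_u}$, and a controller $J=(A_K,B_K,C_K,D_K)$ of order $N_K$: $\dot x_K = A_Kx_K+B_Ky$, $u = C_Kx_K + D_Ky$. Put $$A_{cl}=\begin{bmatrix}A+B_uD_KC_y & B_uC_K\\ B_KC_y & A_K\end{bmatrix},\quad B_{cl}=\begin{bmatrix}B_w+B_uD_KD_{yw}\\ B_KD_{yw}\end{bmatrix},\quad C_{cl}=\begin{bmatrix}C_z+D_uD_KC_y & D_uC_K\end{bmatrix},\quad D_{cl}=D_w+D_uD_KD_{yw},$$ $\tilde C=\begin{bmatrix}D_KC_y & C_K\end{bmatrix}$, $\mathcal G_{cl}(s)=C_{cl}(sI-A_{cl})^{-1}B_{cl}+D_{cl}$ and $\mathcal G_{u_i}(s)=\mathsf{row}_i(\tilde C)(sI-A_{cl})^{-1}B_{cl}+\mathsf{row}_i(D_KD_{yw})$. Let $\gamma_0>0$, let $\rho\in\mathbb R^{N_u}$ have positive entries,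 and for $\Gamma=(\gamma_1,\dots,\gamma_{N_u})$ put $\|\Gamma\|_{1,\rho}=\sum_i\rho_i|\gamma_i|$. Write $\mathrm{sym}(M)=M+M^\top$; $\ast$ denotes blocks determined by symmetry. *Design problem*: minimize $\|\Gamma\|_{1,\rho}$ over $(\Gamma,J)$ such that $A_{cl}$ is Hurwitz, $\|\mathcal G_{cl}\|_{\mathcal H_\infty}<\gamma_0$, and $\|\mathcal G_{u_i}\|_{\mathcal H_2}<\sqrt{\gamma_i}$ for all $i$. *Common Lyapunov matrix*: $X_{cl}=X_{cl}^\top>0$ is a common Lyapunov matrix for $(\Gamma,J)$ if $D_KD_{yw}=0$ and $$\text{(BR)}\ \begin{bmatrix}\mathrm{sym}(X_{cl}A_{cl}) & \ast&\ast\\ (X_{cl}B_{cl})^\top&-\gamma_0I&\ast\\ C_{cl}&D_{cl}&-\gamma_0I\end{bmatrix}<0,\quad \text{(L)}\ \begin{bmatrix}\mathrm{sym}(A_{cl}^\top X_{cl})&X_{cl}B_{cl}\\ \ast&-I\end{bmatrix}<0,\quad \text{(C}_i)\ \begin{bmatrix}\gamma_i&\mathsf{row}_i(\tilde C)\\ \ast&X_{cl}\end{bmatrix}>0\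 \ \forall i .$$ *Transformed variables*: with $X_{cl}=\begin{bmatrix}Y&N\\N^\top&\star\end{bmatrix}$, $X_{cl}^{-1}=\begin{bmatrix}X&M\\M^\top&\star\end{bmatrix}$, $$\hat A_K=NA_KM^\top+NB_KC_yX+YB_uC_KM^\top+Y(A+B_uD_KC_y)X,\quad \hat B_K=NB_K+YB_uD_K,\quad \hat C_K=C_KM^\top+D_KC_yX,\quad \hat D_K=D_K .$$ *Synthesis LMIs* in $(\Gamma,\hat A_K,\hat B_K,\hat C_K,\hat D_K,X,Y)$: $$\begin{bmatrix}\mathrm{sym}(AX+B_u\hat C_K)&\ast&\ast&\ast\\ \hat A_K+(A+B_u\hat D_KC_y)^\top&\mathrm{sym}(YA+\hat B_KC_y)&\ast&\ast\\ (B_w+B_u\hat D_KD_{yw})^\top&(YB_w+\hat B_KD_{yw})^\top&-\gamma_0I&\ast\\ C_zX+D_u\hat C_K&C_z+D_u\hat D_KC_y&D_w+D_u\hat D_KD_{yw}&-\gamma_0I\end{bmatrix}<0,$$ $$\begin{bmatrix}\mathrm{sym}(AX+B_u\hat C_K)&\ast&\ast\\ \hat A_K+(A+B_u\hat D_KC_y)^\top&\mathrm{sym}(YA+\hat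 B_KC_y)&\ast\\ (B_w+B_u\hat D_KD_{yw})^\top&(YB_w+\hat B_KD_{yw})^\top&-I\end{bmatrix}<0,\qquad \begin{bmatrix}\gamma_i&\mathsf{row}_i(\hat C_K)&\mathsf{row}_i(\hat D_KC_y)\\ \ast&X&I\\ \ast&\ast&Y\end{bmatrix}>0\ \ \forall i,\qquad \hat D_KD_{yw}=0 .$$ *LMI problem*: minimize $\|\Gamma\|_{1,\rho}$ over $\Gamma>0$ (entrywise), $J$ of full order $N_K=N_x$, and $X_{cl}=X_{cl}^\top>0$, subject to the synthesis LMIs in the transformed variables of $(J,X_{cl})$. *Free form*: minimize $\|\Gamma\|_{1,\rho}$ over $\Gamma>0$ and arbitrary $(\hat A_K,\hat B_K,\hat C_K,\hat D_K,X,Y)$ subject to $\begin{bmatrix}X&I\\I&Y\end{bmatrix}>0$ and the synthesis LMIs. **Theorem.** 1. For a controller of any order: $A_{cl}$ is Hurwitz and $\|\mathcal G_{cl}\|_{\mathcal H_\infty}<\gamma_0$ if and only if (BR) holds for some $X_{cl}>0$; and, for each $i$ and $\gamma_i\in\mathbb R$ (with $\sqrt{\gamma_i}:=0$ if $\gamma_i<0$),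 $A_{cl}$ is Hurwitz and $\|\mathcal G_{u_i}\|_{\mathcal H_2}<\sqrt{\gamma_i}$ if and only if $\mathsf{row}_i(D_KD_{yw})=0$ and (L), (C$_i$) hold for some $X_{cl}>0$. 2. Let $N_K=N_x$. A triple $(\Gamma,J,X_{cl})$ is feasible for the LMI problem if and only if $X_{cl}$ is a common Lyapunov matrix for $(\Gamma,J)$ and the block $M$ of $X_{cl}^{-1}$ is nonsingular. Consequently $(\Gamma,J)$ extends to a feasible point of the LMI problem if and only if it has a common Lyapunov matrix, and then $(\Gamma,J)$ is feasible for the design problem. 3. If $(\Gamma,\hat A_K,\hat B_K,\hat C_K,\hat D_K,X,Y)$ is feasible for the free form, then $I-XY$ is nonsingular, and for all square $M,N$ with $MN^\top=I-XY$ the controller $$D_K=\hat D_K,\quad C_K=(\hat C_K-D_KC_yX)M^{-\top},\quad B_K=N^{-1}(\hat B_K-YB_uD_K),$$ $$A_K=N^{-1}\big[\hat A_K-NB_KC_yX-YB_uC_KM^\top-Y(A+B_uD_KC_y)X\big]M^{-\top}$$ is feasible with $\Gamma$ for the design problem; moreover there is an $X_{cl}$, with these blocks $X,Y,M,N$, such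 that $(\Gamma,J,X_{cl})$ is feasible for the LMI problem and has the given transformed variables. Conversely, if $(\Gamma,J)$, with $J$ of any order, has a common Lyapunov matrix, then $\Gamma$ is feasible for the free form. 4. The infimum of $\|\Gamma\|_{1,\rho}$ is the same for the LMI problem, for its free form, and for the minimization over all $(\Gamma,J)$ with $N_K=N_x$ that have a common Lyapunov matrix; it is an upper bound for the infimum of the design problem over controllers of order $N_x$. -/

import Mathlib

open Matrix

noncomputable section

namespace SparseControl

/-! ## Linear time-invariant systems and their norms -/

/-- `sym M = M + Mᵀ`. -/
def sym {m : Type*} (M : Matrix m m ℝ) : Matrix m m ℝ := M + Mᵀ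

/-- The `i`-th row of `M`, as a matrix with one row. -/
def rowMat {p m : Type*} (M : Matrix p m ℝ) (i : p) : Matrix Unit m ℝ :=
  Matrix.of fun _ j => M i j

/-- `M < 0` for a real symmetric matrix `M` (symmetry is part of the condition). -/
def NegDef {m : Type*} [Fintype m] (M : Matrix m m ℝ) : Prop := (-M).PosDef

/-- Every (complex) eigenvalue of the real matrix `A` has negative real part. -/
def Hurwitz {m : Type*} [Fintype m] [DecidableEq m] (A : Matrix m m ℝ) : Prop :=
  ∀ s ∈ spectrum ℂ (A.map Complex.ofReal), s.re < 0

/-- The transfer function `G(s) = C (sI - A)⁻¹ B + D`. -/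
def transfer {m p q : Type*} [Fintype m] [DecidableEq m]
    (A : Matrix m m ℝ) (B : Matrix m q ℝ) (C : Matrix p m ℝ) (D : Matrix p q ℝ) (s : ℂ) :
    Matrix p q ℂ :=
  C.map Complex.ofReal * (s • (1 : Matrix m m ℂ) - A.map Complex.ofReal)⁻¹ * B.map Complex.ofReal
    + D.map Complex.ofReal

/-- The largest singular value of a complex matrix: its operator norm with respect to the
Euclidean norms. -/
def sigmaMax {p q : Type*} [Fintype p] [Fintype q] [DecidableEq q] (M : Matrix p q ℂ) : ℝ :=
  ‖LinearMap.toContinuousLinearMap (Matrix.toEuclideanLin M)‖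

/-- The `H∞` norm, `sup_{Re s > 0} σ_max (G s)`, with value `∞` when `G` is not in `H∞`. -/
def hinfNorm {p q : Type*} [Fintype p] [Fintype q] [DecidableEq q]
    (G : ℂ → Matrix p q ℂ) : ENNReal :=
  ⨆ (s : ℂ) (_ : 0 < s.re), ENNReal.ofReal (sigmaMax (G s))

/-- The `H₂` norm, `(sup_{a > 0} (2π)⁻¹ ∫ ‖G (a + iω)‖_F² dω)^(1/2)`, with value `∞` when `G` is
not in `H₂`. -/
def h2Norm {p q : Type*} [Fintype p] [Fintype q] (G : ℂ → Matrix p q ℂ) : ENNReal :=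
  (⨆ (a : ℝ) (_ : 0 < a), (ENNReal.ofReal (2 * Real.pi))⁻¹ *
    ∫⁻ ω : ℝ, ∑ i, ∑ j, ‖G ((a : ℂ) + (ω : ℂ) * Complex.I) i j‖ₑ ^ 2) ^ (1 / 2 : ℝ)

/-! ## Symmetric block matrices -/

/-- The symmetric `3 × 3` block matrix with the given lower triangular blocks. -/
def symBlock3 {a b c : Type*}
    (M₁₁ : Matrix a a ℝ)
    (M₂₁ : Matrix b a ℝ) (M₂₂ : Matrix b b ℝ)
    (M₃₁ : Matrix c a ℝ) (M₃₂ : Matrix c b ℝ) (M₃₃ : Matrix c c ℝ) :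
    Matrix ((a ⊕ b) ⊕ c) ((a ⊕ b) ⊕ c) ℝ :=
  fromBlocks (fromBlocks M₁₁ M₂₁ᵀ M₂₁ M₂₂) (fromRows M₃₁ᵀ M₃₂ᵀ) (fromCols M₃₁ M₃₂) M₃₃

/-- The symmetric `4 × 4` block matrix with the given lower triangular blocks. -/
def symBlock4 {a b c d : Type*}
    (M₁₁ : Matrix a a ℝ)
    (M₂₁ : Matrix b a ℝ) (M₂₂ : Matrix b b ℝ)
    (M₃₁ : Matrix c a ℝ) (M₃₂ : Matrix c b ℝ) (M₃₃ : Matrix c c ℝ)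
    (M₄₁ : Matrix d a ℝ) (M₄₂ : Matrix d b ℝ) (M₄₃ : Matrix d c ℝ) (M₄₄ : Matrix d d ℝ) :
    Matrix ((a ⊕ b) ⊕ (c ⊕ d)) ((a ⊕ b) ⊕ (c ⊕ d)) ℝ :=
  fromBlocks (fromBlocks M₁₁ M₂₁ᵀ M₂₁ M₂₂) (fromBlocks M₃₁ᵀ M₄₁ᵀ M₃₂ᵀ M₄₂ᵀ)
    (fromBlocks M₃₁ M₃₂ M₄₁ M₄₂) (fromBlocks M₃₃ M₄₃ᵀ M₄₃ M₄₄)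

/-! ## Plant, controller and closed loop -/

/-- The plant `x' = A x + Bu u + Bw w`, `z = Cz x + Du u + Dw w`, `y = Cy x + Dyw w`. -/
structure Plant (n nu nw nz ny : ℕ) where
  A : Matrix (Fin n) (Fin n) ℝ
  Bu : Matrix (Fin n) (Fin nu) ℝ
  Bw : Matrix (Fin n) (Fin nw) ℝ
  Cz : Matrix (Fin nz) (Fin n) ℝ
  Du : Matrix (Fin nz) (Fin nu) ℝ
  Dw : Matrix (Fin nz) (Fin nw) ℝ
  Cy : Matrix (Fin ny) (Fin n) ℝ
  Dyw : Matrix (Fin ny) (Fin nw) ℝ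

/-- The controller `xK' = AK xK + BK y`, `u = CK xK + DK y` of order `k`. -/
structure Controller (k nu ny : ℕ) where
  AK : Matrix (Fin k) (Fin k) ℝ
  BK : Matrix (Fin k) (Fin ny) ℝ
  CK : Matrix (Fin nu) (Fin k) ℝ
  DK : Matrix (Fin nu) (Fin ny) ℝ

section ClosedLoop

variable {n nu nw nz ny k : ℕ} (P : Plant n nu nw nz ny) (K : Controller k nu ny)

def Acl : Matrix (Fin n ⊕ Fin k) (Fin n ⊕ Fin k) ℝ :=
  fromBlocks (P.A + P.Bu * K.DK * P.Cy) (P.Bu * K.CK) (K.BK * P.Cy) K.AK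

def Bcl : Matrix (Fin n ⊕ Fin k) (Fin nw) ℝ :=
  fromRows (P.Bw + P.Bu * K.DK * P.Dyw) (K.BK * P.Dyw)

def Ccl : Matrix (Fin nz) (Fin n ⊕ Fin k) ℝ :=
  fromCols (P.Cz + P.Du * K.DK * P.Cy) (P.Du * K.CK)

def Dcl : Matrix (Fin nz) (Fin nw) ℝ := P.Dw + P.Du * K.DK * P.Dyw

/-- The output matrix of the closed loop from its state to the control signal `u`. -/
def Cu : Matrix (Fin nu) (Fin n ⊕ Fin k) ℝ := fromCols (K.DK * P.Cy) K.CK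

/-- The closed-loop transfer function from `w` to `z`. -/
def Gz : ℂ → Matrix (Fin nz) (Fin nw) ℂ :=
  transfer (Acl P K) (Bcl P K) (Ccl P K) (Dcl P K)

/-- The closed-loop transfer function from `w` to the `i`-th control channel. -/
def Gu (i : Fin nu) : ℂ → Matrix Unit (Fin nw) ℂ :=
  transfer (Acl P K) (Bcl P K) (rowMat (Cu P K) i) (rowMat (K.DK * P.Dyw) i)

/-- The constraints of the design problem: the controller stabilizes the closed loop,
`‖Gz‖_{H∞} < γ₀`, and `‖Gu i‖_{H₂} < √(Γ i)` for every control channel. -/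
def DesignFeasible (γ₀ : ℝ) (Γ : Fin nu → ℝ) : Prop :=
  Hurwitz (Acl P K) ∧
  hinfNorm (Gz P K) < ENNReal.ofReal γ₀ ∧
  ∀ i, h2Norm (Gu P K i) < ENNReal.ofReal (Real.sqrt (Γ i))

/-! ## Lyapunov certificates for the closed loop -/

/-- The bounded-real inequality for the closed loop, with Lyapunov matrix `Xcl`. -/
def BoundedRealLMI (γ₀ : ℝ) (Xcl : Matrix (Fin n ⊕ Fin k) (Fin n ⊕ Fin k) ℝ) : Prop :=
  NegDef (symBlock3
    (sym (Xcl * Acl P K))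
    (Xcl * Bcl P K)ᵀ (-(γ₀ • (1 : Matrix (Fin nw) (Fin nw) ℝ)))
    (Ccl P K) (Dcl P K) (-(γ₀ • (1 : Matrix (Fin nz) (Fin nz) ℝ))))

/-- The `H₂` Lyapunov inequality for the closed loop, with Lyapunov matrix `Xcl`. -/
def H2LyapunovLMI (Xcl : Matrix (Fin n ⊕ Fin k) (Fin n ⊕ Fin k) ℝ) : Prop :=
  NegDef (fromBlocks (sym ((Acl P K)ᵀ * Xcl)) (Xcl * Bcl P K)
    (Xcl * Bcl P K)ᵀ (-(1 : Matrix (Fin nw) (Fin nw) ℝ)))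

/-- The `H₂` output inequality for the `i`-th control channel, with Lyapunov matrix `Xcl`. -/
def H2ChannelLMI (g : ℝ) (i : Fin nu) (Xcl : Matrix (Fin n ⊕ Fin k) (Fin n ⊕ Fin k) ℝ) : Prop :=
  (fromBlocks (g • (1 : Matrix Unit Unit ℝ)) (rowMat (Cu P K) i)
    (rowMat (Cu P K) i)ᵀ Xcl).PosDef

/-- One and the same `Xcl > 0` satisfies all the performance inequalities. -/
def CommonLyapunov (γ₀ : ℝ) (Γ : Fin nu → ℝ)
    (Xcl : Matrix (Fin n ⊕ Fin k) (Fin n ⊕ Fin k) ℝ) : Prop :=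
  Xcl.PosDef ∧ BoundedRealLMI P K γ₀ Xcl ∧ H2LyapunovLMI P K Xcl ∧
  (∀ i, H2ChannelLMI P K (Γ i) i Xcl) ∧ K.DK * P.Dyw = 0

end ClosedLoop

/-! ## The transformed variables and the synthesis inequalities -/

/-- The transformed variables `ÂK, B̂K, ĈK, D̂K, X, Y`. -/
structure HatVars (n nu ny : ℕ) where
  A : Matrix (Fin n) (Fin n) ℝ
  B : Matrix (Fin n) (Fin ny) ℝ
  C : Matrix (Fin nu) (Fin n) ℝ
  D : Matrix (Fin nu) (Fin ny) ℝ
  X : Matrix (Fin n) (Fin n) ℝ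
  Y : Matrix (Fin n) (Fin n) ℝ

section Synthesis

variable {n nu nw nz ny k : ℕ} (P : Plant n nu nw nz ny)

/-- The block `Y` of `Xcl = [Y, N; Nᵀ, ⋆]`. -/
def blockY (Xcl : Matrix (Fin n ⊕ Fin k) (Fin n ⊕ Fin k) ℝ) : Matrix (Fin n) (Fin n) ℝ :=
  Xcl.toBlocks₁₁

/-- The block `N` of `Xcl = [Y, N; Nᵀ, ⋆]`. -/
def blockN (Xcl : Matrix (Fin n ⊕ Fin k) (Fin n ⊕ Fin k) ℝ) : Matrix (Fin n) (Fin k) ℝ :=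
  Xcl.toBlocks₁₂

/-- The block `X` of `Xcl⁻¹ = [X, M; Mᵀ, ⋆]`. -/
def blockX (Xcl : Matrix (Fin n ⊕ Fin k) (Fin n ⊕ Fin k) ℝ) : Matrix (Fin n) (Fin n) ℝ :=
  (Xcl⁻¹).toBlocks₁₁

/-- The block `M` of `Xcl⁻¹ = [X, M; Mᵀ, ⋆]`. -/
def blockM (Xcl : Matrix (Fin n ⊕ Fin k) (Fin n ⊕ Fin k) ℝ) : Matrix (Fin n) (Fin k) ℝ :=
  (Xcl⁻¹).toBlocks₁₂

/-- The change of variables `(J, Xcl) ↦ (ÂK, B̂K, ĈK, D̂K, X, Y)`. -/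
def hat (K : Controller k nu ny) (Xcl : Matrix (Fin n ⊕ Fin k) (Fin n ⊕ Fin k) ℝ) :
    HatVars n nu ny where
  A := blockN Xcl * K.AK * (blockM Xcl)ᵀ + blockN Xcl * K.BK * P.Cy * blockX Xcl
    + blockY Xcl * P.Bu * K.CK * (blockM Xcl)ᵀ
    + blockY Xcl * (P.A + P.Bu * K.DK * P.Cy) * blockX Xcl
  B := blockN Xcl * K.BK + blockY Xcl * P.Bu * K.DK
  C := K.CK * (blockM Xcl)ᵀ + K.DK * P.Cy * blockX Xcl
  D := K.DK
  X := blockX Xcl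
  Y := blockY Xcl

/-- The synthesis inequalities in the transformed variables. -/
def SynthesisLMIs (γ₀ : ℝ) (Γ : Fin nu → ℝ) (v : HatVars n nu ny) : Prop :=
  NegDef (symBlock4
    (sym (P.A * v.X + P.Bu * v.C))
    (v.A + (P.A + P.Bu * v.D * P.Cy)ᵀ) (sym (v.Y * P.A + v.B * P.Cy))
    (P.Bw + P.Bu * v.D * P.Dyw)ᵀ (v.Y * P.Bw + v.B * P.Dyw)ᵀ
      (-(γ₀ • (1 : Matrix (Fin nw) (Fin nw) ℝ)))
    (P.Cz * v.X + P.Du * v.C) (P.Cz + P.Du * v.D * P.Cy) (P.Dw + P.Du * v.D * P.Dyw)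
      (-(γ₀ • (1 : Matrix (Fin nz) (Fin nz) ℝ)))) ∧
  NegDef (symBlock3
    (sym (P.A * v.X + P.Bu * v.C))
    (v.A + (P.A + P.Bu * v.D * P.Cy)ᵀ) (sym (v.Y * P.A + v.B * P.Cy))
    (P.Bw + P.Bu * v.D * P.Dyw)ᵀ (v.Y * P.Bw + v.B * P.Dyw)ᵀ
      (-(1 : Matrix (Fin nw) (Fin nw) ℝ))) ∧
  (∀ i, (fromBlocks (Γ i • (1 : Matrix Unit Unit ℝ))
    (fromCols (rowMat v.C i) (rowMat (v.D * P.Cy) i))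
    (fromCols (rowMat v.C i) (rowMat (v.D * P.Cy) i))ᵀ
    (fromBlocks v.X 1 1 v.Y)).PosDef) ∧
  v.D * P.Dyw = 0

/-- The constraints of the optimization problem over `(Γ, J, Xcl)`: `Γ > 0`, `Xcl > 0` and the
synthesis inequalities, whose variables are obtained from `J` and `Xcl`. -/
def LMIFeasible (γ₀ : ℝ) (Γ : Fin nu → ℝ) (K : Controller k nu ny)
    (Xcl : Matrix (Fin n ⊕ Fin k) (Fin n ⊕ Fin k) ℝ) : Prop :=
  (∀ i, 0 < Γ i) ∧ Xcl.PosDef ∧ SynthesisLMIs P γ₀ Γ (hat P K Xcl)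

/-- The constraints of the optimization problem over `Γ` and freely chosen transformed variables;
here `Xcl > 0` takes the form `[X, I; I, Y] > 0`. -/
def HatFeasible (γ₀ : ℝ) (Γ : Fin nu → ℝ) (v : HatVars n nu ny) : Prop :=
  (∀ i, 0 < Γ i) ∧ (fromBlocks v.X 1 1 v.Y).PosDef ∧ SynthesisLMIs P γ₀ Γ v

/-- The controller constructed from transformed variables and a factorization
`M Nᵀ = I - X Y`. -/
def reconstruct (v : HatVars n nu ny) (M N : Matrix (Fin n) (Fin n) ℝ) : Controller n nu ny :=
  let DK := v.D
  let CK := (v.C - DK * P.Cy * v.X) * (Mᵀ)⁻¹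
  let BK := N⁻¹ * (v.B - v.Y * P.Bu * DK)
  { AK := N⁻¹ * (v.A - N * BK * P.Cy * v.X - v.Y * P.Bu * CK * Mᵀ
      - v.Y * (P.A + P.Bu * DK * P.Cy) * v.X) * (Mᵀ)⁻¹
    BK := BK
    CK := CK
    DK := DK }

end Synthesis

/-! ## Optimal values -/

/-- The weighted `ℓ₁` norm `∑ ρ i * |Γ i|`. -/
def weightedL1 {nu : ℕ} (ρ Γ : Fin nu → ℝ) : ℝ := ∑ i, ρ i * |Γ i|

/-- The infimum of the weighted `ℓ₁` norm over the `Γ` in a set (`⊤` if the set is empty). -/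
def optValue {nu : ℕ} (ρ : Fin nu → ℝ) (S : Set (Fin nu → ℝ)) : EReal :=
  ⨅ Γ ∈ S, ((weightedL1 ρ Γ : ℝ) : EReal)

end SparseControl

end

/-!
The proof has three parts: the `H₂` bound, the `H∞` bound, and the change of variables.

**Lyapunov theory and the `H₂` norm.** The analytic input is that for a Hurwitz matrix `A` the real
part of `(iωI - A)⁻¹` is integrable over `ω` with integral `πI` (`Hurwitz.integral_re_res`): up to
`1 / (s + 1)` the resolvent is `O(|s|⁻²)` and holomorphic in the closed right half plane, so
Cauchy's theorem applies. If `A P + P Aᵀ = -Q`, then `R Q R* = R P + P R*` for `R = (iωI - A)⁻¹`,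
and integration gives `∫ c R Q R* cᵀ dω = 2π c P cᵀ` (`Hurwitz.integral_hform_rowRes`). This yields
existence, uniqueness and positivity of solutions of Lyapunov equations, and it computes the `H₂`
norm. The norm is a supremum over the lines `Re s = a > 0`; there `A` is replaced by `A - aI`,
which only helps in the upper bound, and the lower bound passes to `a → 0` by Fatou's lemma. A
finite norm excludes direct feedthrough, because the transfer function tends to `D` at infinity.
Together with Schur complements this is `h2Norm_lt_iff_lmi`.

**The `H∞` norm.** That the inequality implies the bound follows by inserting `x = (sI - A)⁻¹ B w`
(`hinfNorm_lt_of_negDef`). Conversely, by Hahn–Banach an unsolvable inequality has a dual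
certificate, a nonzero positive semidefinite matrix `∑ vₖ vₖᵀ` (`exists_negDef_of_dual`). Writing
the `vₖ` as the columns of `F` (states) and `H` (inputs), duality says `F Gᵀ + G Fᵀ = 0` for
`G = A F + B H`. A skew-Hermitian `S` with `F S = G Q`, where `Q` projects onto the row space of `F`, is
unitarily diagonalizable with imaginary eigenvalues `iω`; in its eigenbasis the family splits into
harmonics `(iω - A) x = B w` and a part with zero state, on which the bounds for the transfer
function at `iω` and at `∞` contradict the certificate (`stationary_family`).

**The change of variables.** With `T = [X, I; Mᵀ, 0]` one has `X_cl T = [I, Y; 0, Nᵀ]`, and the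
synthesis inequalities are the closed loop inequalities after congruence by `T`
(`synthesisLMIs_hat_iff`). For a full order controller `T` is square; the Lyapunov inequality
forces it to be nonsingular, which means that `M` is nonsingular (`lmiFeasible_iff`). All
inequalities are strict, so a certificate may be perturbed to make `N`, hence `M`, nonsingular
(`CommonLyapunov.exists_lmiFeasible`). A controller of arbitrary order `k` is augmented by `n`
stable decoupled modes, and a perturbation coupling them to the plant state gives `N` full row
rank, which makes `T` injective (`CommonLyapunov.exists_hatFeasible`). In the other direction
`X_cl = T⁻ᵀ [X, I; I, Y] T⁻¹` and `M Nᵀ = I - X Y` recover a controller with the prescribed transformed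
variables (`HatFeasible.hat_reconstruct`).
-/

namespace SparseControl

/-! ### The resolvent of a Hurwitz matrix -/

section Resolvent

open Filter Topology MeasureTheory Bornology Asymptotics

variable {m : Type*} [Fintype m] [DecidableEq m]

/-- The resolvent `(sI - A)⁻¹` of a real matrix at a complex point. -/
noncomputable def res (A : Matrix m m ℝ) (s : ℂ) : Matrix m m ℂ :=
  (s • (1 : Matrix m m ℂ) - A.map Complex.ofReal)⁻¹

lemma res_eq_resolvent (A : Matrix m m ℝ) (s : ℂ) :
    res A s = resolvent (A.map Complex.ofReal) s := by
  rw [res, resolvent, nonsing_inv_eq_ringInverse, Algebra.algebraMap_eq_smul_one]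

lemma Hurwitz.mem_resolventSet {A : Matrix m m ℝ} (hA : Hurwitz A) {s : ℂ} (hs : 0 ≤ s.re) :
    s ∈ resolventSet ℂ (A.map Complex.ofReal) := by
  by_contra h
  exact absurd (hA s h) (not_lt.mpr hs)

lemma Hurwitz.isUnit_det {A : Matrix m m ℝ} (hA : Hurwitz A) {s : ℂ} (hs : 0 ≤ s.re) :
    IsUnit (s • (1 : Matrix m m ℂ) - A.map Complex.ofReal).det := by
  have := hA.mem_resolventSet hs
  rwa [spectrum.mem_resolventSet_iff, Algebra.algebraMap_eq_smul_one,
    Matrix.isUnit_iff_isUnit_det] at this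

lemma hurwitz_iff_isUnit_det {A : Matrix m m ℝ} :
    Hurwitz A ↔ ∀ s : ℂ, 0 ≤ s.re →
      IsUnit (s • (1 : Matrix m m ℂ) - A.map Complex.ofReal).det := by
  refine ⟨fun hA s hs => hA.isUnit_det hs, fun h s hs => ?_⟩
  by_contra hre
  refine hs ?_
  rw [spectrum.mem_resolventSet_iff, Algebra.algebraMap_eq_smul_one,
    Matrix.isUnit_iff_isUnit_det]
  exact h s (not_lt.mp hre)

lemma Hurwitz.transpose {A : Matrix m m ℝ} (hA : Hurwitz A) : Hurwitz Aᵀ := by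
  rw [hurwitz_iff_isUnit_det] at hA ⊢
  intro s hs
  have := hA s hs
  rw [← det_transpose] at this
  simpa [transpose_map] using this

lemma Hurwitz.sub_smul_one {A : Matrix m m ℝ} (hA : Hurwitz A) {a : ℝ} (ha : 0 ≤ a) :
    Hurwitz (A - a • (1 : Matrix m m ℝ)) := by
  rw [hurwitz_iff_isUnit_det] at hA ⊢
  intro s hs
  convert hA (s + a) (by simpa using add_nonneg hs ha) using 2
  ext i j
  by_cases hij : i = j
  · subst hij
    simp
    ring
  · simp [Matrix.one_apply_ne hij]

lemma res_sub_smul_one (A : Matrix m m ℝ) (a : ℝ) (s : ℂ) :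
    res (A - a • (1 : Matrix m m ℝ)) s = res A (a + s) := by
  unfold res
  congr 1
  ext i j
  by_cases hij : i = j
  · subst hij
    simp
    ring
  · simp [Matrix.one_apply_ne hij]

lemma Hurwitz.mul_res {A : Matrix m m ℝ} (hA : Hurwitz A) {s : ℂ} (hs : 0 ≤ s.re) :
    (s • (1 : Matrix m m ℂ) - A.map Complex.ofReal) * res A s = 1 :=
  Matrix.mul_nonsing_inv _ (hA.isUnit_det hs)

lemma Hurwitz.res_mul {A : Matrix m m ℝ} (hA : Hurwitz A) {s : ℂ} (hs : 0 ≤ s.re) :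
    res A s * (s • (1 : Matrix m m ℂ) - A.map Complex.ofReal) = 1 :=
  Matrix.nonsing_inv_mul _ (hA.isUnit_det hs)

open scoped Matrix.Norms.Operator in
lemma Hurwitz.differentiableAt_res {A : Matrix m m ℝ} (hA : Hurwitz A) {s : ℂ} (hs : 0 ≤ s.re)
    (i j : m) : DifferentiableAt ℂ (fun z => res A z i j) s := by
  have h := (spectrum.hasDerivAt_resolvent_const_left (hA.mem_resolventSet hs)).differentiableAt
  have h2 : DifferentiableAt ℂ (fun z => (Matrix.entryLinearMap ℂ ℂ i j).toContinuousLinearMap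
      (resolvent (A.map Complex.ofReal) z)) s :=
    (ContinuousLinearMap.differentiableAt _).comp s h
  simpa [res_eq_resolvent] using h2

lemma Hurwitz.continuousAt_res {A : Matrix m m ℝ} (hA : Hurwitz A) {s : ℂ} (hs : 0 ≤ s.re) :
    ContinuousAt (res A) s := by
  refine tendsto_pi_nhds.mpr fun i => tendsto_pi_nhds.mpr fun j => ?_
  exact (hA.differentiableAt_res hs i j).continuousAt

open scoped Matrix.Norms.Operator in
lemma res_isBigO (A : Matrix m m ℝ) (i j : m) :
    (fun z => res A z i j) =O[cobounded ℂ] (fun z => z⁻¹) := by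
  have h := spectrum.resolvent_isBigO_inv (𝕜 := ℂ) (A.map Complex.ofReal)
  have h2 := ((Matrix.entryLinearMap ℂ ℂ i j).toContinuousLinearMap.isBigO_comp
    (resolvent (A.map Complex.ofReal)) (cobounded ℂ)).trans h
  simp only [res_eq_resolvent]
  exact h2

lemma res_tendsto_zero (A : Matrix m m ℝ) : Tendsto (res A) (cobounded ℂ) (𝓝 0) := by
  refine tendsto_pi_nhds.mpr fun i => tendsto_pi_nhds.mpr fun j => ?_
  exact (res_isBigO A i j).trans_tendsto tendsto_inv₀_cobounded

/-- Cauchy's theorem for a function that is holomorphic on the closed right half plane and decays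
like `|s|⁻²` there: its integral along the imaginary axis converges and vanishes. -/
lemma integral_imaginary_axis_eq_zero {f : ℂ → ℂ}
    (hf : ∀ s : ℂ, 0 ≤ s.re → DifferentiableAt ℂ f s)
    (hO : f =O[cobounded ℂ] (fun z => (z ^ 2)⁻¹)) :
    Integrable (fun ω : ℝ => f (ω * Complex.I)) ∧ ∫ ω : ℝ, f (ω * Complex.I) = 0 := by
  obtain ⟨c, hc⟩ := hO.bound
  obtain ⟨r, -, hr⟩ := (hasBasis_cobounded_norm (E := ℂ)).eventually_iff.mp hc
  have hcont : Continuous (fun ω : ℝ => f (ω * Complex.I)) := by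
    refine continuous_iff_continuousAt.mpr fun ω => ?_
    exact ContinuousAt.comp (f := fun ω : ℝ => (ω : ℂ) * Complex.I)
      (hf (ω * Complex.I) (by simp)).continuousAt (by fun_prop)
  have hint : Integrable (fun ω : ℝ => f (ω * Complex.I)) := by
    refine hcont.locallyIntegrable.integrable_of_isBigO_cocompact (g := fun ω : ℝ => (1 + ω ^ 2)⁻¹)
      ?_ (integrable_inv_one_add_sq.integrableAtFilter _)
    refine IsBigO.of_bound (|c| * 2) ?_
    have : ∀ᶠ ω : ℝ in cocompact ℝ, max r 1 ≤ ‖ω‖ := by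
      rw [← Metric.cobounded_eq_cocompact]
      exact tendsto_norm_cobounded_atTop.eventually_ge_atTop _
    filter_upwards [this] with ω hω
    have h1 : (1 : ℝ) ≤ ω ^ 2 := by
      have : 1 ≤ |ω| := (le_max_right _ _).trans hω
      nlinarith [sq_abs ω]
    have := hr (x := ω * Complex.I) (by simpa using (le_max_left _ _).trans hω)
    refine this.trans ?_
    rw [norm_inv, norm_pow, norm_mul, Complex.norm_I, mul_one, Complex.norm_real, Real.norm_eq_abs,
      sq_abs, norm_inv, Real.norm_of_nonneg (by positivity), mul_assoc]
    gcongr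
    · exact le_abs_self c
    · rw [inv_le_iff_one_le_mul₀ (by positivity), mul_right_comm, ← div_eq_mul_inv,
        one_le_div (by positivity)]
      linarith
  refine ⟨hint, ?_⟩
  have hlim := intervalIntegral_tendsto_integral hint tendsto_neg_atTop_atBot tendsto_id
  refine tendsto_nhds_unique hlim ?_
  rw [tendsto_zero_iff_norm_tendsto_zero]
  -- the remaining three sides of `[0, T] × [-T, T]` have total length `4T`
  have key : ∀ᶠ T : ℝ in atTop, ‖∫ ω in (-T)..(id T), f (ω * Complex.I)‖ ≤ 4 * |c| * T⁻¹ := by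
    filter_upwards [eventually_ge_atTop (max r 1)] with T hT
    have hT1 : 1 ≤ T := (le_max_right _ _).trans hT
    have hTr : r ≤ T := (le_max_left _ _).trans hT
    have hT0 : 0 < T := by linarith
    have hC := Complex.integral_boundary_rect_eq_zero_of_differentiableOn f
      ⟨0, -T⟩ ⟨T, T⟩ (fun s hs => (hf s ?_).differentiableWithinAt)
    swap
    · have := hs.1
      simp only [Set.mem_preimage, Set.uIcc_of_le hT0.le] at this
      exact this.1
    have hb : ∀ s : ℂ, T ≤ ‖s‖ → ‖f s‖ ≤ |c| * (T ^ 2)⁻¹ := by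
      intro s hs
      refine (hr (hTr.trans hs)).trans ?_
      rw [norm_inv, norm_pow]
      gcongr
      exact le_abs_self c
    have e1 : ‖∫ x in (0 : ℝ)..T, f (x + (-T : ℝ) * Complex.I)‖ ≤ |c| * (T ^ 2)⁻¹ * |T - 0| := by
      refine intervalIntegral.norm_integral_le_of_norm_le_const fun x _ => hb _ ?_
      have := Complex.abs_im_le_norm (x + (-T : ℝ) * Complex.I)
      simp only [Complex.add_im, Complex.ofReal_im, Complex.mul_im, Complex.ofReal_re,
        Complex.I_im, mul_one, Complex.I_re, mul_zero, add_zero, zero_add, abs_neg] at this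
      rwa [abs_of_pos hT0] at this
    have e2 : ‖∫ x in (0 : ℝ)..T, f (x + (T : ℝ) * Complex.I)‖ ≤ |c| * (T ^ 2)⁻¹ * |T - 0| := by
      refine intervalIntegral.norm_integral_le_of_norm_le_const fun x _ => hb _ ?_
      have := Complex.abs_im_le_norm (x + (T : ℝ) * Complex.I)
      simp only [Complex.add_im, Complex.ofReal_im, Complex.mul_im, Complex.ofReal_re,
        Complex.I_im, mul_one, Complex.I_re, mul_zero, add_zero, zero_add] at this
      rwa [abs_of_pos hT0] at this
    have e3 : ‖∫ y in (-T)..T, f ((T : ℝ) + y * Complex.I)‖ ≤ |c| * (T ^ 2)⁻¹ * |T - (-T)| := by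
      refine intervalIntegral.norm_integral_le_of_norm_le_const fun x _ => hb _ ?_
      have := Complex.abs_re_le_norm ((T : ℝ) + x * Complex.I)
      simp only [Complex.add_re, Complex.ofReal_re, Complex.mul_re, Complex.I_re, mul_zero,
        Complex.ofReal_im, Complex.I_im, sub_self, add_zero, mul_one] at this
      rwa [abs_of_pos hT0] at this
    simp only [Complex.ofReal_zero, zero_add] at hC
    have h4 : ‖∫ ω in (-T)..T, f (ω * Complex.I)‖ =
        ‖((∫ x in (0 : ℝ)..T, f (x + (-T : ℝ) * Complex.I)) -
          (∫ x in (0 : ℝ)..T, f (x + (T : ℝ) * Complex.I))) +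
          Complex.I • ∫ y in (-T)..T, f ((T : ℝ) + y * Complex.I)‖ := by
      rw [sub_eq_zero.mp hC, norm_smul, Complex.norm_I, one_mul]
    rw [id, h4]
    refine (norm_add_le _ _).trans ((add_le_add (norm_sub_le _ _) le_rfl).trans ?_)
    rw [norm_smul, Complex.norm_I, one_mul]
    refine (add_le_add (add_le_add e1 e2) e3).trans (le_of_eq ?_)
    rw [sub_zero, sub_neg_eq_add, abs_of_pos hT0, abs_of_pos (show 0 < T + T by linarith)]
    field_simp
    ring
  refine squeeze_zero' (Eventually.of_forall fun _ => norm_nonneg _) key ?_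
  simpa using (tendsto_inv_atTop_zero (𝕜 := ℝ)).const_mul (4 * |c|)

/-- Along the imaginary axis the real part of the resolvent of a Hurwitz matrix integrates to
`πI`. The matrix `A` enters only through the `O(|s|⁻²)` difference `(sI - A)⁻¹ - (s + 1)⁻¹ I`, which
does not contribute by Cauchy's theorem. -/
lemma Hurwitz.integral_re_res {A : Matrix m m ℝ} (hA : Hurwitz A) (i j : m) :
    Integrable (fun ω : ℝ => (res A (ω * Complex.I) i j).re) ∧
      ∫ ω : ℝ, (res A (ω * Complex.I) i j).re = Real.pi * (1 : Matrix m m ℝ) i j := by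
  let f : ℂ → ℂ := fun s => res A s i j - (s + 1)⁻¹ * (1 : Matrix m m ℂ) i j
  have hne : ∀ s : ℂ, 0 ≤ s.re → s + 1 ≠ 0 := by
    intro s hs h
    have := congrArg Complex.re h
    simp at this
    linarith
  have hf : ∀ s : ℂ, 0 ≤ s.re → DifferentiableAt ℂ f s := by
    intro s hs
    exact (hA.differentiableAt_res hs i j).sub
      (((differentiableAt_id.add_const (1 : ℂ)).inv (hne s hs)).mul_const _)
  have hinv : (fun z : ℂ => (z + 1)⁻¹) =O[cobounded ℂ] (fun z => z⁻¹) := by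
    refine IsBigO.of_bound 2 ?_
    filter_upwards [tendsto_norm_cobounded_atTop.eventually_ge_atTop (2 : ℝ)] with z hz
    have h1 : ‖z‖ / 2 ≤ ‖z + 1‖ := by
      have := norm_sub_le (z + 1) 1
      simp at this
      linarith
    rw [norm_inv, norm_inv]
    calc ‖z + 1‖⁻¹ ≤ (‖z‖ / 2)⁻¹ := by gcongr
      _ = 2 * ‖z‖⁻¹ := by field_simp
  have hO : f =O[cobounded ℂ] (fun z => (z ^ 2)⁻¹) := by
    have h1 : (fun z => (z + 1)⁻¹ * ∑ k, res A z i k * (1 + A.map Complex.ofReal) k j)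
        =O[cobounded ℂ] (fun z : ℂ => (z ^ 2)⁻¹) := by
      have := hinv.mul (IsBigO.fun_sum (s := Finset.univ) fun k _ => show
        (fun z => res A z i k * (1 + A.map Complex.ofReal) k j) =O[cobounded ℂ] (fun z => z⁻¹) by
          simpa [mul_comm] using (res_isBigO A i k).const_mul_left ((1 + A.map Complex.ofReal) k j))
      refine this.congr (fun _ => rfl) (fun z => by rw [sq, mul_inv])
    refine (EventuallyEq.isBigO ?_).trans h1
    open scoped Matrix.Norms.Operator in
    filter_upwards [spectrum.eventually_isUnit_resolvent (𝕜 := ℂ) (A.map Complex.ofReal),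
      tendsto_norm_cobounded_atTop.eventually_gt_atTop (1 : ℝ)] with z hz hz1
    rw [← spectrum.isUnit_resolvent, spectrum.mem_resolventSet_iff,
      Algebra.algebraMap_eq_smul_one, Matrix.isUnit_iff_isUnit_det] at hz
    have hz2 : z + 1 ≠ 0 := by
      intro h
      rw [eq_neg_of_add_eq_zero_left h] at hz1
      simp at hz1
    have e : res A z * (1 + A.map Complex.ofReal) = (z + 1) • res A z - 1 := by
      have e1 : res A z * (z • (1 : Matrix m m ℂ) - A.map Complex.ofReal) = 1 :=
        Matrix.nonsing_inv_mul _ hz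
      rw [mul_sub, mul_smul_comm, mul_one] at e1
      rw [mul_add, mul_one, add_smul, one_smul, ← e1]
      abel
    have e2 := congrFun (congrFun e i) j
    rw [Matrix.mul_apply] at e2
    rw [e2]
    simp only [f, Matrix.sub_apply, Matrix.smul_apply, smul_eq_mul]
    field_simp
  obtain ⟨h1, h2⟩ := integral_imaginary_axis_eq_zero hf hO
  have hre : ∀ ω : ℝ, (res A (ω * Complex.I) i j).re =
      (f (ω * Complex.I)).re + (1 + ω ^ 2)⁻¹ * (1 : Matrix m m ℝ) i j := by
    intro ω
    have : ((ω * Complex.I + 1)⁻¹ : ℂ).re = (1 + ω ^ 2)⁻¹ := by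
      rw [Complex.inv_re]
      simp [Complex.normSq_apply]
      rw [← sq]
    simp only [f, Complex.sub_re]
    rcases eq_or_ne i j with rfl | hij
    · simp only [Matrix.one_apply_eq, mul_one, this]
      ring
    · simp [Matrix.one_apply_ne hij]
  simp only [hre]
  have hi1 : Integrable (fun ω : ℝ => (f (ω * Complex.I)).re) := h1.re
  have hi2 : Integrable (fun ω : ℝ => (1 + ω ^ 2)⁻¹ * (1 : Matrix m m ℝ) i j) :=
    integrable_inv_one_add_sq.mul_const _
  refine ⟨hi1.add hi2, ?_⟩
  rw [integral_add hi1 hi2, integral_mul_const, integral_univ_inv_one_add_sq]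
  have : ∫ ω : ℝ, (f (ω * Complex.I)).re = 0 := by
    have := integral_re h1
    simp only [RCLike.re_to_complex] at this
    rw [this, h2]
    simp
  rw [this, zero_add]

end Resolvent

/-! ### Quadratic forms of real matrices -/

section QuadraticForms

lemma transpose_sym {m : Type*} (M : Matrix m m ℝ) : (sym M)ᵀ = sym M := by
  rw [sym, transpose_add, transpose_transpose, add_comm]

variable {m q : Type*} [Fintype m] [Fintype q]

lemma posDef_iff_real {M : Matrix m m ℝ} :
    M.PosDef ↔ Mᵀ = M ∧ ∀ x : m → ℝ, x ≠ 0 → 0 < x ⬝ᵥ M *ᵥ x := by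
  rw [posDef_iff_dotProduct_mulVec]
  simp [Matrix.IsHermitian, conjTranspose_eq_transpose_of_trivial]

lemma posSemidef_iff_real {M : Matrix m m ℝ} :
    M.PosSemidef ↔ Mᵀ = M ∧ ∀ x : m → ℝ, 0 ≤ x ⬝ᵥ M *ᵥ x := by
  rw [posSemidef_iff_dotProduct_mulVec]
  simp [Matrix.IsHermitian, conjTranspose_eq_transpose_of_trivial]

lemma negDef_iff_real {M : Matrix m m ℝ} :
    NegDef M ↔ Mᵀ = M ∧ ∀ x : m → ℝ, x ≠ 0 → x ⬝ᵥ M *ᵥ x < 0 := by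
  rw [NegDef, posDef_iff_real]
  simp [neg_mulVec]

lemma dotProduct_mulVec_comm (M : Matrix m q ℝ) (x : m → ℝ) (y : q → ℝ) :
    x ⬝ᵥ M *ᵥ y = y ⬝ᵥ Mᵀ *ᵥ x := by
  rw [dotProduct_mulVec, ← mulVec_transpose, dotProduct_comm]

lemma dotProduct_sym_mulVec (M : Matrix m m ℝ) (x : m → ℝ) :
    x ⬝ᵥ sym M *ᵥ x = 2 * (x ⬝ᵥ M *ᵥ x) := by
  rw [sym, add_mulVec, dotProduct_add, ← dotProduct_mulVec_comm]
  ring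

lemma smul_one_mulVec [DecidableEq m] (a : ℝ) (x : m → ℝ) :
    (a • (1 : Matrix m m ℝ)) *ᵥ x = a • x := by
  rw [smul_mulVec, one_mulVec]

end QuadraticForms

/-! ### The Lyapunov equation -/

section Lyapunov

open MeasureTheory

variable {m q : Type*} [Fintype m] [Fintype q]

lemma map_ofReal_mul {l m q : Type*} [Fintype m] (M : Matrix l m ℝ) (N : Matrix m q ℝ) :
    (M * N).map Complex.ofReal = M.map Complex.ofReal * N.map Complex.ofReal := by
  ext i j
  simp [Matrix.mul_apply]

/-- The Hermitian form of a real matrix `M` at a complex vector `v`, `Re (v* M v)`. -/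
def hform (M : Matrix m m ℝ) (v : m → ℂ) : ℝ :=
  (fun i => (v i).re) ⬝ᵥ M *ᵥ (fun i => (v i).re) +
    (fun i => (v i).im) ⬝ᵥ M *ᵥ (fun i => (v i).im)

lemma posSemidef_mul_transpose (B : Matrix m q ℝ) : (B * Bᵀ).PosSemidef := by
  rw [← conjTranspose_eq_transpose_of_trivial]
  exact posSemidef_self_mul_conjTranspose B

lemma hform_nonneg {M : Matrix m m ℝ} (hM : M.PosSemidef) (v : m → ℂ) : 0 ≤ hform M v :=
  add_nonneg ((posSemidef_iff_real.mp hM).2 _) ((posSemidef_iff_real.mp hM).2 _)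

lemma hform_add (M N : Matrix m m ℝ) (v : m → ℂ) : hform (M + N) v = hform M v + hform N v := by
  simp only [hform, add_mulVec, dotProduct_add]
  ring

lemma hform_mul_transpose (B : Matrix m q ℝ) (v : m → ℂ) :
    hform (B * Bᵀ) v = ∑ j, ‖(v ᵥ* B.map Complex.ofReal) j‖ ^ 2 := by
  have e : ∀ x : m → ℝ, x ⬝ᵥ (B * Bᵀ) *ᵥ x = ∑ j, (∑ i, x i * B i j) ^ 2 := by
    intro x
    rw [← mulVec_mulVec, dotProduct_mulVec, mulVec_transpose]
    simp [dotProduct, vecMul, sq]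
  rw [hform, e, e, ← Finset.sum_add_distrib]
  refine Finset.sum_congr rfl fun j _ => ?_
  rw [← Complex.normSq_eq_norm_sq, Complex.normSq_apply]
  simp [vecMul, dotProduct, Complex.re_sum, Complex.im_sum, sq]

lemma lyapunov_form {A P Q : Matrix m m ℝ} (hP : Pᵀ = P) (h : A * P + P * Aᵀ = -Q) (x : m → ℝ) :
    x ⬝ᵥ Q *ᵥ x = -2 * ((Aᵀ *ᵥ x) ⬝ᵥ P *ᵥ x) := by
  have e1 : x ⬝ᵥ (P * Aᵀ) *ᵥ x = (Aᵀ *ᵥ x) ⬝ᵥ P *ᵥ x := by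
    rw [← mulVec_mulVec, dotProduct_mulVec_comm, hP]
  have e2 : x ⬝ᵥ (A * P) *ᵥ x = (Aᵀ *ᵥ x) ⬝ᵥ P *ᵥ x := by
    rw [dotProduct_mulVec_comm, transpose_mul, hP, e1]
  have : x ⬝ᵥ (-Q) *ᵥ x = 2 * ((Aᵀ *ᵥ x) ⬝ᵥ P *ᵥ x) := by
    rw [← h, add_mulVec, dotProduct_add, e1, e2]
    ring
  rw [neg_mulVec, dotProduct_neg] at this
  linarith

variable [DecidableEq m]

/-- The row vector `c (iωI - A)⁻¹`. -/
noncomputable def rowRes (A : Matrix m m ℝ) (c : m → ℝ) (ω : ℝ) : m → ℂ :=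
  (fun i => (c i : ℂ)) ᵥ* res A (ω * Complex.I)

lemma Hurwitz.rowRes_re_im {A : Matrix m m ℝ} (hA : Hurwitz A) (c : m → ℝ) (ω : ℝ) :
    (Aᵀ *ᵥ (fun i => (rowRes A c ω i).re) = -c - ω • fun i => (rowRes A c ω i).im) ∧
      (Aᵀ *ᵥ (fun i => (rowRes A c ω i).im) = ω • fun i => (rowRes A c ω i).re) := by
  have h : rowRes A c ω ᵥ* ((ω * Complex.I) • (1 : Matrix m m ℂ) - A.map Complex.ofReal) =
      fun i => (c i : ℂ) := by
    rw [rowRes, vecMul_vecMul, hA.res_mul (by simp), vecMul_one]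
  rw [vecMul_sub, vecMul_smul, vecMul_one] at h
  have key : ∀ j, (ω * Complex.I) * rowRes A c ω j - ∑ i, rowRes A c ω i * (A i j : ℂ) = c j := by
    intro j
    simpa [vecMul, dotProduct] using congrFun h j
  constructor
  · ext j
    have := congrArg Complex.re (key j)
    simp [Complex.re_sum] at this
    simp [mulVec, dotProduct, mul_comm (A _ j)]
    linarith
  · ext j
    have := congrArg Complex.im (key j)
    simp [Complex.im_sum] at this
    simp [mulVec, dotProduct, mul_comm (A _ j)]
    linarith

/-- A Hurwitz `A` and a solution `P` of `A P + P Aᵀ = -Q` give, with `v = c (iωI - A)⁻¹`, the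
pointwise identity `v Q v* = 2 Re (v P cᵀ)`. -/
lemma Hurwitz.hform_rowRes {A P Q : Matrix m m ℝ} (hA : Hurwitz A) (hP : Pᵀ = P)
    (h : A * P + P * Aᵀ = -Q) (c : m → ℝ) (ω : ℝ) :
    hform Q (rowRes A c ω) = 2 * ((fun i => (rowRes A c ω i).re) ⬝ᵥ P *ᵥ c) := by
  obtain ⟨h1, h2⟩ := hA.rowRes_re_im c ω
  unfold hform
  set a : m → ℝ := fun i => (rowRes A c ω i).re
  set b : m → ℝ := fun i => (rowRes A c ω i).im
  rw [lyapunov_form hP h, lyapunov_form hP h, h1, h2, sub_dotProduct, neg_dotProduct,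
    smul_dotProduct, smul_dotProduct, dotProduct_mulVec_comm P b a,
    dotProduct_mulVec_comm P c a, hP]
  simp only [smul_eq_mul]
  rw [dotProduct_mulVec_comm P a c, hP]
  ring

lemma Hurwitz.integral_re_rowRes {A : Matrix m m ℝ} (hA : Hurwitz A) (c : m → ℝ) (j : m) :
    Integrable (fun ω => (rowRes A c ω j).re) ∧ ∫ ω, (rowRes A c ω j).re = Real.pi * c j := by
  have e : ∀ ω, (rowRes A c ω j).re = ∑ i, c i * (res A (ω * Complex.I) i j).re := by
    intro ω
    simp [rowRes, vecMul, dotProduct, Complex.re_sum]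
  have hi : ∀ i ∈ Finset.univ, Integrable (fun ω : ℝ => c i * (res A (ω * Complex.I) i j).re) :=
    fun i _ => (hA.integral_re_res i j).1.const_mul _
  simp only [e]
  refine ⟨integrable_finsetSum _ hi, ?_⟩
  rw [integral_finsetSum _ hi]
  simp only [integral_const_mul, (hA.integral_re_res _ j).2, Matrix.one_apply]
  simp [mul_comm]

/-- Parseval's identity in algebraic form: the energy `∫ v Q v* dω`, `v = c (iωI - A)⁻¹`, is
`2π c P cᵀ` where `P` solves the Lyapunov equation `A P + P Aᵀ = -Q`. -/
lemma Hurwitz.integral_hform_rowRes {A P Q : Matrix m m ℝ} (hA : Hurwitz A) (hP : Pᵀ = P)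
    (h : A * P + P * Aᵀ = -Q) (c : m → ℝ) :
    Integrable (fun ω => hform Q (rowRes A c ω)) ∧
      ∫ ω, hform Q (rowRes A c ω) = 2 * Real.pi * (c ⬝ᵥ P *ᵥ c) := by
  simp only [hA.hform_rowRes hP h]
  have hi : ∀ j ∈ Finset.univ, Integrable (fun ω => (rowRes A c ω j).re * (P *ᵥ c) j) :=
    fun j _ => (hA.integral_re_rowRes c j).1.mul_const _
  refine ⟨(integrable_finsetSum _ hi).const_mul 2, ?_⟩
  rw [integral_const_mul]
  simp only [dotProduct]
  rw [integral_finsetSum _ hi, mul_assoc, Finset.mul_sum]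
  simp only [integral_mul_const, (hA.integral_re_rowRes c _).2, mul_assoc, Finset.mul_sum]

/-- Positivity of the solution of the Lyapunov equation of a Hurwitz matrix. -/
lemma Hurwitz.posDef_of_lyapunov {A P Q : Matrix m m ℝ} (hA : Hurwitz A) (hP : Pᵀ = P)
    (h : A * P + P * Aᵀ = -Q) (hQ : Q.PosDef) : P.PosDef := by
  have hps : P.PosSemidef := by
    refine posSemidef_iff_real.mpr ⟨hP, fun c => ?_⟩
    have := (hA.integral_hform_rowRes hP h c).2
    have h0 : 0 ≤ ∫ ω, hform Q (rowRes A c ω) :=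
      integral_nonneg fun ω => hform_nonneg hQ.posSemidef _
    rw [this] at h0
    exact nonneg_of_mul_nonneg_right h0 (by positivity)
  refine posDef_iff_real.mpr ⟨hP, fun x hx => lt_of_le_of_ne
    ((posSemidef_iff_real.mp hps).2 x) fun h0 => ?_⟩
  have hz : P *ᵥ x = 0 := (hps.dotProduct_mulVec_zero_iff x).mp (by simpa using h0.symm)
  have e1 : x ⬝ᵥ (-Q) *ᵥ x = 0 := by
    rw [← h, add_mulVec, dotProduct_add, ← mulVec_mulVec, ← mulVec_mulVec, hz, mulVec_zero,
      dotProduct_zero, dotProduct_mulVec_comm, hP, hz, dotProduct_zero, add_zero]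
  have := (posDef_iff_real.mp hQ).2 x hx
  rw [neg_mulVec, dotProduct_neg] at e1
  linarith

/-- Uniqueness: `A P + P Aᵀ = 0` gives `R(iω) P = -P R(iω)*` for the resolvent, and integrating the
real parts over `ω` turns this into `π P = -π P`. -/
lemma Hurwitz.eq_zero_of_lyapunov {A P : Matrix m m ℝ} (hA : Hurwitz A)
    (h : A * P + P * Aᵀ = 0) : P = 0 := by
  have key : ∀ ω : ℝ, res A (ω * Complex.I) * P.map Complex.ofReal =
      -(P.map Complex.ofReal * (res A (ω * Complex.I))ᴴ) := by
    intro ω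
    set s : ℂ := ω * Complex.I with hs
    set T : Matrix m m ℂ := s • (1 : Matrix m m ℂ) - A.map Complex.ofReal with hT
    have h1 : res A s * T = 1 := hA.res_mul (by simp [hs])
    have hTh : Tᴴ = -s • (1 : Matrix m m ℂ) - (Aᵀ).map Complex.ofReal := by
      ext i j
      rcases eq_or_ne i j with rfl | hij
      · simp [hT, hs]
      · simp [hT, Matrix.one_apply_ne hij, Matrix.one_apply_ne hij.symm]
    have h2 : Tᴴ * (res A s)ᴴ = 1 := by
      rw [← conjTranspose_mul, h1, conjTranspose_one]
    have h3 : T * P.map Complex.ofReal = -(P.map Complex.ofReal * Tᴴ) := by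
      have := congrArg (fun M : Matrix m m ℝ => M.map Complex.ofReal) h
      beta_reduce at this
      rw [Matrix.map_add _ (by simp), map_ofReal_mul, map_ofReal_mul, Matrix.map_zero _ (by simp)]
        at this
      rw [hTh, hT, sub_mul, mul_sub, eq_neg_of_add_eq_zero_left this]
      simp [add_comm]
    calc res A s * P.map Complex.ofReal
        = res A s * (P.map Complex.ofReal * (Tᴴ * (res A s)ᴴ)) := by rw [h2, mul_one]
      _ = -(res A s * (T * P.map Complex.ofReal)) * (res A s)ᴴ := by
          rw [h3]; simp only [mul_neg, neg_neg, mul_assoc]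
      _ = _ := by rw [← mul_assoc, h1, one_mul, neg_mul]
  ext i j
  have hij : ∀ ω : ℝ, ∑ k, (res A (ω * Complex.I) i k).re * P k j =
      -∑ k, (res A (ω * Complex.I) j k).re * P i k := by
    intro ω
    have := congrArg Complex.re (congrFun (congrFun (key ω) i) j)
    simpa [Matrix.mul_apply, Complex.re_sum, mul_comm] using this
  have hint : ∀ (i : m) (x : m → ℝ),
      ∫ ω : ℝ, ∑ k, (res A (ω * Complex.I) i k).re * x k = Real.pi * x i := by
    intro i x
    rw [integral_finsetSum _ fun k _ => (hA.integral_re_res i k).1.mul_const _]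
    simp only [integral_mul_const, (hA.integral_re_res i _).2, Matrix.one_apply]
    simp
  have h1 := hint i (fun k => P k j)
  simp only [hij, integral_neg, hint j (fun k => P i k)] at h1
  have := Real.pi_pos
  simp only [Matrix.zero_apply]
  nlinarith

lemma Hurwitz.exists_lyapunov {A : Matrix m m ℝ} (hA : Hurwitz A) {Q : Matrix m m ℝ}
    (hQ : Qᵀ = Q) : ∃ P : Matrix m m ℝ, Pᵀ = P ∧ A * P + P * Aᵀ = -Q := by
  let f : Matrix m m ℝ →ₗ[ℝ] Matrix m m ℝ :=
    LinearMap.mulLeft ℝ A + LinearMap.mulRight ℝ Aᵀ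
  have hf : ∀ P, f P = A * P + P * Aᵀ := fun P => rfl
  have hinj : Function.Injective f := by
    rw [← LinearMap.ker_eq_bot, LinearMap.ker_eq_bot']
    exact fun P hP => hA.eq_zero_of_lyapunov hP
  obtain ⟨P, hP⟩ := LinearMap.injective_iff_surjective.mp hinj (-Q)
  refine ⟨P, hinj ?_, hP⟩
  rw [hP, hf]
  have := congrArg Matrix.transpose hP
  rw [hf, transpose_add, transpose_mul, transpose_mul, transpose_transpose, transpose_neg, hQ]
    at this
  rw [← this, add_comm]

end Lyapunov

/-! ### Schur complements -/

section Schur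

variable {a b : Type*} [Fintype a] [Fintype b] [DecidableEq b]

lemma posDef_fromBlocks₂₂ {A : Matrix a a ℝ} {B : Matrix a b ℝ} {D : Matrix b b ℝ}
    (hD : D.PosDef) : (fromBlocks A B Bᵀ D).PosDef ↔ (A - B * D⁻¹ * Bᵀ).PosDef := by
  have hDs : Dᵀ = D := (posDef_iff_real.mp hD).1
  have : Invertible D := hD.isUnit.invertible
  have hform : ∀ (x : a → ℝ) (y : b → ℝ), (x ⊕ᵥ y) ⬝ᵥ (fromBlocks A B Bᵀ D) *ᵥ (x ⊕ᵥ y) =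
      ((D⁻¹ * Bᵀ) *ᵥ x + y) ⬝ᵥ D *ᵥ ((D⁻¹ * Bᵀ) *ᵥ x + y)
        + x ⬝ᵥ (A - B * D⁻¹ * Bᵀ) *ᵥ x := by
    intro x y
    have := schur_complement_eq₂₂ A B x y (D := D) (by simpa [IsHermitian] using hDs)
    simpa only [star_trivial, ← dotProduct_mulVec, conjTranspose_eq_transpose_of_trivial] using this
  have hs : (A - B * D⁻¹ * Bᵀ)ᵀ = Aᵀ - B * D⁻¹ * Bᵀ := by
    rw [transpose_sub, transpose_mul, transpose_mul, transpose_transpose, transpose_nonsing_inv,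
      hDs, Matrix.mul_assoc]
  constructor
  · intro h
    obtain ⟨h1, h2⟩ := posDef_iff_real.mp h
    rw [fromBlocks_transpose, fromBlocks_inj] at h1
    refine posDef_iff_real.mpr ⟨by rw [hs, h1.1], fun x hx => ?_⟩
    have := h2 (x ⊕ᵥ (-((D⁻¹ * Bᵀ) *ᵥ x))) fun h0 => hx (by
      ext i; simpa using congrFun h0 (Sum.inl i))
    rw [hform] at this
    simpa using this
  · intro h
    obtain ⟨h1, h2⟩ := posDef_iff_real.mp h
    refine posDef_iff_real.mpr ⟨?_, fun z hz => ?_⟩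
    · rw [fromBlocks_transpose, transpose_transpose, hDs]
      rw [hs] at h1
      rw [sub_left_injective h1]
    · obtain ⟨x, y, rfl⟩ : ∃ x y, z = x ⊕ᵥ y := ⟨z ∘ Sum.inl, z ∘ Sum.inr, by simp⟩
      rw [hform]
      have hD2 := (posDef_iff_real.mp hD).2
      by_cases hx : x = 0
      · subst hx
        have hy : y ≠ 0 := by
          rintro rfl
          exact hz (by ext i; cases i <;> rfl)
        simpa using hD2 y hy
      · refine add_pos_of_nonneg_of_pos ?_ (h2 x hx)
        exact (posSemidef_iff_real.mp hD.posSemidef).2 _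

end Schur

/-! ### The `H₂` norm -/

section H2

open MeasureTheory Filter Topology

variable {m q : Type*} [Fintype m] [DecidableEq m] [Fintype q]

/-- A Schur complement and the congruence by `X⁻¹` turn the inequality into the Lyapunov inequality
`A P + P Aᵀ + B Bᵀ < 0` for `P = X⁻¹`. -/
lemma negDef_h2_iff [DecidableEq q] {A X : Matrix m m ℝ} {B : Matrix m q ℝ} (hX : X.PosDef) :
    NegDef (fromBlocks (sym (Aᵀ * X)) (X * B) (X * B)ᵀ (-(1 : Matrix q q ℝ))) ↔
      (-(A * X⁻¹ + X⁻¹ * Aᵀ) - B * Bᵀ).PosDef := by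
  have hXs : Xᵀ = X := (posDef_iff_real.mp hX).1
  have hu : IsUnit X := hX.isUnit
  have hdet : IsUnit X.det := (isUnit_iff_isUnit_det X).mp hu
  have e : -(fromBlocks (sym (Aᵀ * X)) (X * B) (X * B)ᵀ (-(1 : Matrix q q ℝ))) =
      fromBlocks (-sym (Aᵀ * X)) (-(X * B)) (-(X * B))ᵀ 1 := by
    rw [fromBlocks_neg, transpose_neg, neg_neg]
  rw [NegDef, e, posDef_fromBlocks₂₂ PosDef.one,
    ← hu.posDef_star_left_conjugate_iff (x := -(A * X⁻¹ + X⁻¹ * Aᵀ) - B * Bᵀ)]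
  have : star X = X := by
    rw [star_eq_conjTranspose, conjTranspose_eq_transpose_of_trivial, hXs]
  have h1 : X * (-(A * X⁻¹ + X⁻¹ * Aᵀ) - B * Bᵀ) * X =
      -(X * A * (X⁻¹ * X) + X * X⁻¹ * (Aᵀ * X)) - X * B * (Bᵀ * X) := by
    simp only [Matrix.mul_sub, Matrix.sub_mul, mul_neg, neg_mul, mul_add, add_mul, Matrix.mul_assoc]
  rw [this, h1, nonsing_inv_mul _ hdet, mul_nonsing_inv _ hdet, sym, transpose_neg, transpose_mul,
    transpose_mul, hXs, inv_one, transpose_transpose, mul_one, one_mul, Matrix.mul_one,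
    Matrix.neg_mul, Matrix.mul_neg, neg_neg]
  rw [add_comm (Aᵀ * X)]

lemma posDef_channel_iff {g : ℝ} {c : Matrix Unit m ℝ} {X : Matrix m m ℝ} (hX : X.PosDef) :
    (fromBlocks (g • (1 : Matrix Unit Unit ℝ)) c cᵀ X).PosDef ↔
      c () ⬝ᵥ X⁻¹ *ᵥ c () < g := by
  rw [posDef_fromBlocks₂₂ hX]
  have e : (g • (1 : Matrix Unit Unit ℝ) - c * X⁻¹ * cᵀ) =
      diagonal fun _ => g - c () ⬝ᵥ X⁻¹ *ᵥ c () := by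
    ext i j
    rw [Matrix.mul_assoc]
    simp [Matrix.mul_apply, dotProduct, mulVec]
  rw [e, posDef_diagonal_iff]
  simp

/-- Lyapunov's criterion: for a left eigenvector `v` of `A` with eigenvalue `s`,
`-v Q v* = 2 Re s · v P v*`. -/
lemma hurwitz_of_lyapunov {A P Q : Matrix m m ℝ} (hP : P.PosDef) (hQ : Q.PosDef)
    (h : A * P + P * Aᵀ = -Q) : Hurwitz A := by
  rw [hurwitz_iff_isUnit_det]
  intro s hs
  rw [isUnit_iff_ne_zero]
  intro hdet
  obtain ⟨v, hv, hv0⟩ := exists_vecMul_eq_zero_iff.mpr hdet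
  obtain ⟨hPs, hP0⟩ := posDef_iff_real.mp hP
  have hQ0 := (posDef_iff_real.mp hQ).2
  rw [vecMul_sub, vecMul_smul, vecMul_one] at hv0
  have key : ∀ j, s * v j - ∑ i, v i * (A i j : ℂ) = 0 := by
    intro j
    simpa [vecMul, dotProduct] using congrFun hv0 j
  set a : m → ℝ := fun i => (v i).re with ha
  set b : m → ℝ := fun i => (v i).im with hb
  have h1 : Aᵀ *ᵥ a = s.re • a - s.im • b := by
    ext j
    have := congrArg Complex.re (key j)
    simp [Complex.re_sum] at this
    simp [ha, hb, mulVec, dotProduct, mul_comm (A _ j)]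
    linarith
  have h2 : Aᵀ *ᵥ b = s.re • b + s.im • a := by
    ext j
    have := congrArg Complex.im (key j)
    simp [Complex.im_sum] at this
    simp [ha, hb, mulVec, dotProduct, mul_comm (A _ j)]
    linarith
  have hsum : a ⬝ᵥ Q *ᵥ a + b ⬝ᵥ Q *ᵥ b = -2 * s.re * (a ⬝ᵥ P *ᵥ a + b ⬝ᵥ P *ᵥ b) := by
    rw [lyapunov_form hPs h, lyapunov_form hPs h, h1, h2, sub_dotProduct, add_dotProduct,
      smul_dotProduct, smul_dotProduct, smul_dotProduct, smul_dotProduct,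
      dotProduct_mulVec_comm P a b, hPs]
    simp only [smul_eq_mul]
    ring
  have hP1 : 0 ≤ a ⬝ᵥ P *ᵥ a + b ⬝ᵥ P *ᵥ b := hform_nonneg hP.posSemidef v
  have hQ1 : 0 < a ⬝ᵥ Q *ᵥ a + b ⬝ᵥ Q *ᵥ b := by
    have hQ2 := (posSemidef_iff_real.mp hQ.posSemidef).2
    by_cases h0 : a = 0
    · refine add_pos_of_nonneg_of_pos (hQ2 a) (hQ0 b fun hb0 => hv ?_)
      ext i
      exact Complex.ext (congrFun h0 i) (congrFun hb0 i)
    · exact add_pos_of_pos_of_nonneg (hQ0 a h0) (hQ2 b)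
  have : 0 ≤ s.re * (a ⬝ᵥ P *ᵥ a + b ⬝ᵥ P *ᵥ b) := mul_nonneg hs hP1
  linarith

/-- The integral in the definition of the `H₂` norm, on the line `Re s = a`. -/
noncomputable def lineEnergy {p q : Type*} [Fintype p] [Fintype q] (G : ℂ → Matrix p q ℂ)
    (a : ℝ) : ENNReal :=
  ∫⁻ ω : ℝ, ∑ i, ∑ j, ‖G ((a : ℂ) + (ω : ℂ) * Complex.I) i j‖ₑ ^ 2

lemma h2Norm_lt_iff {p q : Type*} [Fintype p] [Fintype q] {G : ℂ → Matrix p q ℂ} {g : ℝ} :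
    h2Norm G < ENNReal.ofReal (Real.sqrt g) ↔
      (⨆ (a : ℝ) (_ : 0 < a), (ENNReal.ofReal (2 * Real.pi))⁻¹ * lineEnergy G a)
        < ENNReal.ofReal g := by
  have e : ENNReal.ofReal (Real.sqrt g) = ENNReal.ofReal g ^ (1 / 2 : ℝ) := by
    rcases le_or_gt 0 g with hg | hg
    · rw [Real.sqrt_eq_rpow, ENNReal.ofReal_rpow_of_nonneg hg (by norm_num)]
    · rw [Real.sqrt_eq_zero_of_nonpos hg.le, ENNReal.ofReal_of_nonpos hg.le]
      simp
  rw [e, h2Norm, ENNReal.rpow_lt_rpow_iff (by norm_num)]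
  rfl

/-- Without direct feedthrough the power density of `c (sI - A)⁻¹ B` on the line `Re s = a` is a
Hermitian form of `B Bᵀ` at the row `c (iωI - (A - aI))⁻¹`. -/
lemma lineEnergy_transfer (A : Matrix m m ℝ) (B : Matrix m q ℝ) (c : Matrix Unit m ℝ) (a : ℝ) :
    lineEnergy (transfer A B c 0) a =
      ∫⁻ ω, ENNReal.ofReal (hform (B * Bᵀ) (rowRes (A - a • (1 : Matrix m m ℝ)) (c ()) ω)) := by
  refine lintegral_congr fun ω => ?_
  rw [hform_mul_transpose, ENNReal.ofReal_sum_of_nonneg fun _ _ => by positivity]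
  rw [Fintype.sum_unique]
  refine Finset.sum_congr rfl fun j _ => ?_
  rw [ENNReal.ofReal_pow (norm_nonneg _), ofReal_norm]
  congr 2
  rw [rowRes, res_sub_smul_one, vecMul_vecMul]
  simp only [transfer, res, Matrix.map_zero _ Complex.ofReal_zero, add_zero]
  rw [Matrix.mul_assoc]
  rfl

lemma Hurwitz.lintegral_hform_rowRes {A P Q : Matrix m m ℝ} (hA : Hurwitz A) (hP : Pᵀ = P)
    (h : A * P + P * Aᵀ = -Q) (hQ : Q.PosSemidef) (c : m → ℝ) :
    ∫⁻ ω, ENNReal.ofReal (hform Q (rowRes A c ω)) =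
      ENNReal.ofReal (2 * Real.pi * (c ⬝ᵥ P *ᵥ c)) := by
  rw [← (hA.integral_hform_rowRes hP h c).2, ofReal_integral_eq_lintegral_ofReal
    (hA.integral_hform_rowRes hP h c).1 (ae_of_all _ fun _ => hform_nonneg hQ _)]

/-- A strict Lyapunov inequality bounds the `H₂` norm: shifting to the line `Re s = a` only adds
`2aP ≥ 0` to the right hand side. -/
lemma h2Norm_lt_of_lyapunov {A P : Matrix m m ℝ} {B : Matrix m q ℝ} {c : Matrix Unit m ℝ} {g : ℝ}
    (hP : P.PosDef) (h : (-(A * P + P * Aᵀ) - B * Bᵀ).PosDef) (hg : c () ⬝ᵥ P *ᵥ c () < g) :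
    Hurwitz A ∧ h2Norm (transfer A B c 0) < ENNReal.ofReal (Real.sqrt g) := by
  have hPs : Pᵀ = P := (posDef_iff_real.mp hP).1
  set W := -(A * P + P * Aᵀ) with hW
  have hWpd : W.PosDef := by
    simpa using h.add_posSemidef (posSemidef_mul_transpose B)
  have hA : Hurwitz A := hurwitz_of_lyapunov hP hWpd (by rw [hW, neg_neg])
  refine ⟨hA, h2Norm_lt_iff.mpr ?_⟩
  have h0 : 0 ≤ c () ⬝ᵥ P *ᵥ c () := (posSemidef_iff_real.mp hP.posSemidef).2 _
  refine lt_of_le_of_lt ?_ (ENNReal.ofReal_lt_ofReal_iff'.mpr ⟨hg, h0.trans_lt hg⟩)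
  refine iSup₂_le fun a ha => ?_
  have hpi : (0 : ℝ) < 2 * Real.pi := by positivity
  rw [ENNReal.inv_mul_le_iff (by simpa using Real.pi_pos) ENNReal.ofReal_ne_top,
    ← ENNReal.ofReal_mul hpi.le, lineEnergy_transfer]
  have hpd : ((2 * a) • P).PosSemidef := hP.posSemidef.smul (by positivity)
  rw [← (hA.sub_smul_one ha.le).lintegral_hform_rowRes (Q := W + (2 * a) • P) hPs ?_
    (hWpd.posSemidef.add hpd)]
  · refine lintegral_mono fun ω => ENNReal.ofReal_le_ofReal ?_
    have : W + (2 * a) • P = B * Bᵀ + ((W - B * Bᵀ) + (2 * a) • P) := by abel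
    rw [this, hform_add (B * Bᵀ)]
    exact le_add_of_nonneg_right (hform_nonneg (h.posSemidef.add hpd) _)
  · rw [hW, transpose_sub, transpose_smul, transpose_one, sub_mul, mul_sub, smul_mul_assoc,
      one_mul, mul_smul_comm, mul_one, two_mul, add_smul]
    abel

lemma Hurwitz.tendsto_hform_rowRes_sub {A : Matrix m m ℝ} (hA : Hurwitz A) (M : Matrix m m ℝ)
    (c : m → ℝ) (ω : ℝ) {u : ℕ → ℝ} (hu : Tendsto u atTop (𝓝 0)) :
    Tendsto (fun n => hform M (rowRes (A - u n • (1 : Matrix m m ℝ)) c ω)) atTop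
      (𝓝 (hform M (rowRes A c ω))) := by
  have h1 : Tendsto (fun n => res A ((u n : ℂ) + ω * Complex.I)) atTop
      (𝓝 (res A (ω * Complex.I))) := by
    refine (hA.continuousAt_res (s := ω * Complex.I) (by simp)).tendsto.comp ?_
    have : Tendsto (fun n => ((u n : ℝ) : ℂ) + ω * Complex.I) atTop (𝓝 ((0 : ℝ) + ω * Complex.I)) :=
      ((Complex.continuous_ofReal.tendsto _).comp hu).add_const _
    simpa using this
  have h2 : Continuous (fun R : Matrix m m ℂ => hform M ((fun i => (c i : ℂ)) ᵥ* R)) := by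
    unfold hform
    fun_prop
  simp only [rowRes, res_sub_smul_one]
  exact (h2.tendsto _).comp h1

/-- The converse bound: by Fatou's lemma the energy on the imaginary axis is controlled by the
energies on the lines `Re s = a`, `a → 0`. -/
lemma Hurwitz.lyapunov_lt_of_h2Norm_lt {A P : Matrix m m ℝ} (hA : Hurwitz A) {B : Matrix m q ℝ}
    {c : Matrix Unit m ℝ} {g : ℝ} (hP : Pᵀ = P) (h : A * P + P * Aᵀ = -(B * Bᵀ))
    (hg : h2Norm (transfer A B c 0) < ENNReal.ofReal (Real.sqrt g)) :
    c () ⬝ᵥ P *ᵥ c () < g := by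
  rw [h2Norm_lt_iff] at hg
  set S := ⨆ (a : ℝ) (_ : 0 < a), (ENNReal.ofReal (2 * Real.pi))⁻¹ *
    lineEnergy (transfer A B c 0) a with hS
  have hpi : (0 : ℝ) < 2 * Real.pi := by positivity
  have hpi0 : ENNReal.ofReal (2 * Real.pi) ≠ 0 := by simpa using Real.pi_pos
  have hB := posSemidef_mul_transpose B
  have hBs : (B * Bᵀ)ᵀ = B * Bᵀ := (posSemidef_iff_real.mp hB).1
  have hle : ∀ a : ℝ, 0 < a → ∫⁻ ω, ENNReal.ofReal
      (hform (B * Bᵀ) (rowRes (A - a • (1 : Matrix m m ℝ)) (c ()) ω)) ≤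
        ENNReal.ofReal (2 * Real.pi) * S := by
    intro a ha
    rw [← lineEnergy_transfer, ← ENNReal.inv_mul_le_iff hpi0 ENNReal.ofReal_ne_top]
    exact le_iSup₂_of_le a ha le_rfl
  let u : ℕ → ℝ := fun n => 1 / ((n : ℝ) + 1)
  have hu0 : ∀ n, 0 < u n := fun n => by positivity
  have hu : Tendsto u atTop (𝓝 0) := tendsto_one_div_add_atTop_nhds_zero_nat
  have hmeas : ∀ n, AEMeasurable (fun ω => ENNReal.ofReal
      (hform (B * Bᵀ) (rowRes (A - u n • (1 : Matrix m m ℝ)) (c ()) ω))) := by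
    intro n
    have hAn := hA.sub_smul_one (hu0 n).le
    obtain ⟨Pn, hPn, hPn2⟩ := hAn.exists_lyapunov hBs
    exact (hAn.integral_hform_rowRes hPn hPn2 (c ())).1.aemeasurable.ennreal_ofReal
  have hfatou : ENNReal.ofReal (2 * Real.pi * (c () ⬝ᵥ P *ᵥ c ())) ≤
      ENNReal.ofReal (2 * Real.pi) * S := by
    rw [← hA.lintegral_hform_rowRes hP h hB]
    calc _ = ∫⁻ ω, liminf (fun n => ENNReal.ofReal
          (hform (B * Bᵀ) (rowRes (A - u n • (1 : Matrix m m ℝ)) (c ()) ω))) atTop := by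
          refine lintegral_congr fun ω => ?_
          exact ((ENNReal.tendsto_ofReal
            (hA.tendsto_hform_rowRes_sub _ (c ()) ω hu)).liminf_eq).symm
      _ ≤ liminf (fun n => ∫⁻ ω, ENNReal.ofReal
          (hform (B * Bᵀ) (rowRes (A - u n • (1 : Matrix m m ℝ)) (c ()) ω))) atTop :=
          lintegral_liminf_le' hmeas
      _ ≤ liminf (fun _ : ℕ => ENNReal.ofReal (2 * Real.pi) * S) atTop :=
          liminf_le_liminf (Eventually.of_forall fun n => hle _ (hu0 n))
      _ = _ := liminf_const _
  have hlt : ENNReal.ofReal (2 * Real.pi * (c () ⬝ᵥ P *ᵥ c ())) <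
      ENNReal.ofReal (2 * Real.pi * g) := by
    rw [ENNReal.ofReal_mul hpi.le (q := g)]
    exact hfatou.trans_lt (ENNReal.mul_lt_mul_right hpi0 ENNReal.ofReal_ne_top hg)
  exact lt_of_mul_lt_mul_left (ENNReal.ofReal_lt_ofReal_iff'.mp hlt).1 hpi.le

lemma transfer_tendsto {p q : Type*} (A : Matrix m m ℝ) (B : Matrix m q ℝ) (C : Matrix p m ℝ)
    (D : Matrix p q ℝ) :
    Tendsto (transfer A B C D) (Bornology.cobounded ℂ) (𝓝 (D.map Complex.ofReal)) := by
  have h2 : Continuous (fun R : Matrix m m ℂ =>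
      C.map Complex.ofReal * R * B.map Complex.ofReal + D.map Complex.ofReal) := by
    fun_prop
  have := (h2.tendsto 0).comp (res_tendsto_zero A)
  rw [Matrix.mul_zero, Matrix.zero_mul, zero_add] at this
  exact this

/-- A transfer function of finite `H₂` norm has no direct feedthrough, because `G(s) → D` as
`s → ∞`. -/
lemma eq_zero_of_h2Norm_lt {A : Matrix m m ℝ} {B : Matrix m q ℝ} {c : Matrix Unit m ℝ}
    {d : Matrix Unit q ℝ} {g : ℝ}
    (hg : h2Norm (transfer A B c d) < ENNReal.ofReal (Real.sqrt g)) : d = 0 := by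
  rw [h2Norm_lt_iff] at hg
  have h1 : (ENNReal.ofReal (2 * Real.pi))⁻¹ * lineEnergy (transfer A B c d) 1 < ⊤ :=
    (le_iSup₂_of_le 1 one_pos le_rfl).trans_lt (hg.trans ENNReal.ofReal_lt_top)
  have hfin : lineEnergy (transfer A B c d) 1 ≠ ⊤ := by
    intro htop
    rw [htop, ENNReal.mul_top (ENNReal.inv_ne_zero.mpr ENNReal.ofReal_ne_top)] at h1
    exact lt_irrefl _ h1
  ext i j
  by_contra hd
  refine hfin (top_le_iff.mp ?_)
  have hlim : Tendsto (fun ω : ℝ => ‖transfer A B c d ((1 : ℝ) + ω * Complex.I) i j‖ₑ ^ 2) atTop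
      (𝓝 (‖(d i j : ℂ)‖ₑ ^ 2)) := by
    have hline : Tendsto (fun ω : ℝ => ((1 : ℝ) : ℂ) + ω * Complex.I) atTop
        (Bornology.cobounded ℂ) := by
      rw [← tendsto_norm_atTop_iff_cobounded]
      refine tendsto_atTop_mono (fun ω => ?_) tendsto_abs_atTop_atTop
      have := Complex.abs_im_le_norm (((1 : ℝ) : ℂ) + ω * Complex.I)
      simpa using this
    have h3 := ((transfer_tendsto A B c d).comp hline)
    have h4 := tendsto_pi_nhds.mp (tendsto_pi_nhds.mp h3 i) j
    exact ENNReal.Tendsto.pow h4.enorm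
  have hpos : 0 < ‖(d i j : ℂ)‖ₑ ^ 2 := by
    have : (d i j : ℂ) ≠ 0 := by simpa using hd
    exact ENNReal.pow_pos (enorm_pos.mpr this) 2
  obtain ⟨r, hr0, hr⟩ := exists_between hpos
  obtain ⟨T, hT⟩ := eventually_atTop.mp (hlim.eventually_const_lt hr)
  calc ⊤ = ∫⁻ _ in Set.Ici T, r := by
        rw [setLIntegral_const, Real.volume_Ici, ENNReal.mul_top hr0.ne']
    _ ≤ ∫⁻ ω in Set.Ici T, ∑ i, ∑ j,
          ‖transfer A B c d (((1 : ℝ) : ℂ) + (ω : ℂ) * Complex.I) i j‖ₑ ^ 2 := by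
        refine setLIntegral_mono' measurableSet_Ici fun ω hω => (hT ω hω).le.trans ?_
        refine le_trans ?_ (Finset.single_le_sum (f := fun i => ∑ j,
          ‖transfer A B c d (((1 : ℝ) : ℂ) + (ω : ℂ) * Complex.I) i j‖ₑ ^ 2)
          (fun _ _ => zero_le) (Finset.mem_univ i))
        exact Finset.single_le_sum (f := fun j =>
          ‖transfer A B c d (((1 : ℝ) : ℂ) + (ω : ℂ) * Complex.I) i j‖ₑ ^ 2)
          (fun _ _ => zero_le) (Finset.mem_univ j)
    _ ≤ _ := setLIntegral_le_lintegral _ _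

/-- The `H₂` bound for a scalar output in terms of Lyapunov inequalities. The certificate is
`X = P⁻¹`, where `P` solves the Lyapunov equation with right hand side `-(B Bᵀ + εI)`. -/
theorem h2Norm_lt_iff_lmi [DecidableEq q] {A : Matrix m m ℝ} {B : Matrix m q ℝ}
    {c : Matrix Unit m ℝ} {d : Matrix Unit q ℝ} {g : ℝ} :
    (Hurwitz A ∧ h2Norm (transfer A B c d) < ENNReal.ofReal (Real.sqrt g)) ↔
      d = 0 ∧ ∃ X : Matrix m m ℝ, X.PosDef ∧
        NegDef (fromBlocks (sym (Aᵀ * X)) (X * B) (X * B)ᵀ (-(1 : Matrix q q ℝ))) ∧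
        (fromBlocks (g • (1 : Matrix Unit Unit ℝ)) c cᵀ X).PosDef := by
  constructor
  · rintro ⟨hA, hg⟩
    obtain rfl := eq_zero_of_h2Norm_lt hg
    refine ⟨rfl, ?_⟩
    have hB := posSemidef_mul_transpose B
    obtain ⟨P₀, hP₀, h₀⟩ := hA.exists_lyapunov (posSemidef_iff_real.mp hB).1
    obtain ⟨P₁, hP₁, h₁⟩ := hA.exists_lyapunov (Q := 1) transpose_one
    have hlt := hA.lyapunov_lt_of_h2Norm_lt hP₀ h₀ hg
    obtain ⟨ε, hε, hεlt⟩ : ∃ ε : ℝ, 0 < ε ∧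
        c () ⬝ᵥ P₀ *ᵥ c () + ε * (c () ⬝ᵥ P₁ *ᵥ c ()) < g := by
      have hcont : ContinuousAt (fun ε : ℝ => c () ⬝ᵥ P₀ *ᵥ c () + ε * (c () ⬝ᵥ P₁ *ᵥ c ())) 0 := by
        fun_prop
      have hev := hcont.eventually_lt (g := fun _ => g) continuousAt_const (by simpa using hlt)
      obtain ⟨ε, h1, h2⟩ := ((hev.filter_mono nhdsWithin_le_nhds).and
        (self_mem_nhdsWithin (s := Set.Ioi (0 : ℝ)))).exists
      exact ⟨ε, h2, h1⟩
    have hP : (P₀ + ε • P₁)ᵀ = P₀ + ε • P₁ := by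
      rw [transpose_add, transpose_smul, hP₀, hP₁]
    have heq : A * (P₀ + ε • P₁) + (P₀ + ε • P₁) * Aᵀ = -(B * Bᵀ + ε • 1) := by
      have : A * (P₀ + ε • P₁) + (P₀ + ε • P₁) * Aᵀ =
          (A * P₀ + P₀ * Aᵀ) + ε • (A * P₁ + P₁ * Aᵀ) := by
        rw [mul_add, add_mul, mul_smul_comm, smul_mul_assoc, smul_add]
        abel
      rw [this, h₀, h₁, smul_neg, neg_add]
    have hε1 : (ε • (1 : Matrix m m ℝ)).PosDef := PosDef.one.smul hε
    have hPpd := hA.posDef_of_lyapunov hP heq (hε1.posSemidef_add hB)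
    have hinv : ((P₀ + ε • P₁)⁻¹)⁻¹ = P₀ + ε • P₁ :=
      nonsing_inv_nonsing_inv _ ((isUnit_iff_isUnit_det _).mp hPpd.isUnit)
    refine ⟨(P₀ + ε • P₁)⁻¹, hPpd.inv, (negDef_h2_iff hPpd.inv).mpr ?_,
      (posDef_channel_iff hPpd.inv).mpr ?_⟩
    · rw [hinv, heq, neg_neg, add_sub_cancel_left]
      exact hε1
    · rw [hinv, add_mulVec, dotProduct_add, smul_mulVec, dotProduct_smul, smul_eq_mul]
      exact hεlt
  · rintro ⟨rfl, X, hX, h1, h2⟩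
    exact h2Norm_lt_of_lyapunov hX.inv ((negDef_h2_iff hX).mp h1) ((posDef_channel_iff hX).mp h2)

end H2

/-! ### Frobenius norms and generalized inverses -/

section Frobenius

variable {a b r : Type*} [Fintype a] [Fintype b] [Fintype r]

/-- The squared Euclidean norm of a complex vector. -/
noncomputable def nsq (v : a → ℂ) : ℝ := ∑ i, ‖v i‖ ^ 2

/-- The squared Frobenius norm of a complex matrix. -/
noncomputable def frobSq (M : Matrix a b ℂ) : ℝ := ∑ j, nsq (M.col j)

lemma nsq_nonneg (v : a → ℂ) : 0 ≤ nsq v := Finset.sum_nonneg fun _ _ => by positivity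

lemma nsq_eq_zero {v : a → ℂ} : nsq v = 0 ↔ v = 0 := by
  rw [nsq, Finset.sum_eq_zero_iff_of_nonneg fun _ _ => by positivity]
  simp [funext_iff]

lemma nsq_eq_norm_sq (v : a → ℂ) : nsq v = ‖WithLp.toLp 2 v‖ ^ 2 := by
  rw [EuclideanSpace.norm_sq_eq]
  rfl

lemma frobSq_eq_zero {M : Matrix a b ℂ} : frobSq M = 0 ↔ M = 0 := by
  rw [frobSq, Finset.sum_eq_zero_iff_of_nonneg fun _ _ => nsq_nonneg _]
  simp only [Finset.mem_univ, true_imp_iff, nsq_eq_zero]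
  constructor
  · intro h
    ext i j
    exact congrFun (h j) i
  · rintro rfl j
    rfl

lemma frobSq_eq_trace (M : Matrix a b ℂ) : (frobSq M : ℂ) = (M * Mᴴ).trace := by
  simp only [frobSq, nsq, trace, diag_apply, Matrix.mul_apply, conjTranspose_apply]
  rw [Finset.sum_comm]
  push_cast
  refine Finset.sum_congr rfl fun i _ => Finset.sum_congr rfl fun j _ => ?_
  rw [Matrix.col_apply]
  exact (Complex.mul_conj' _).symm

lemma frobSq_mul_unitary [DecidableEq b] (M : Matrix a b ℂ) {W : Matrix b b ℂ} (hW : W * Wᴴ = 1) :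
    frobSq (M * W) = frobSq M := by
  have : (frobSq (M * W) : ℂ) = frobSq M := by
    rw [frobSq_eq_trace, frobSq_eq_trace, conjTranspose_mul, Matrix.mul_assoc,
      ← Matrix.mul_assoc W, hW, Matrix.one_mul]
  exact_mod_cast this

/-- Pythagoras for an orthogonal projection acting from the right. -/
lemma frobSq_mul_proj_add [DecidableEq b] (M : Matrix a b ℂ) {Q : Matrix b b ℂ} (hQ : Qᴴ = Q)
    (hQQ : Q * Q = Q) : frobSq (M * Q) + frobSq (M * (1 - Q)) = frobSq M := by
  have : ((frobSq (M * Q) + frobSq (M * (1 - Q)) : ℝ) : ℂ) = frobSq M := by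
    push_cast
    have h1 : M * Q * (M * Q)ᴴ = M * Q * Mᴴ := by
      rw [conjTranspose_mul, hQ, Matrix.mul_assoc, ← Matrix.mul_assoc Q, hQQ, ← Matrix.mul_assoc]
    have h2 : M * (1 - Q) * (M * (1 - Q))ᴴ = M * (1 - Q) * Mᴴ := by
      have : (1 - Q) * (1 - Q) = 1 - Q := by
        rw [sub_mul, one_mul, mul_sub, mul_one, hQQ, sub_self, sub_zero]
      rw [conjTranspose_mul, conjTranspose_sub, conjTranspose_one, hQ, Matrix.mul_assoc,
        ← Matrix.mul_assoc (1 - Q), this, ← Matrix.mul_assoc]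
    rw [frobSq_eq_trace, frobSq_eq_trace, frobSq_eq_trace, h1, h2, ← trace_add,
      ← Matrix.add_mul, ← Matrix.mul_add, add_sub_cancel, Matrix.mul_one]
  exact_mod_cast this

lemma frobSq_mul_le {c : Type*} [Fintype c] {M : Matrix a b ℂ} {β : ℝ}
    (hM : ∀ w, nsq (M *ᵥ w) ≤ β ^ 2 * nsq w) (N : Matrix b c ℂ) :
    frobSq (M * N) ≤ β ^ 2 * frobSq N := by
  rw [frobSq, frobSq, Finset.mul_sum]
  exact Finset.sum_le_sum fun j _ => hM (N.col j)

lemma exists_unitary_diagonalization [DecidableEq a] {T : Matrix a a ℂ} (hT : Tᴴ = T) :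
    ∃ (W : Matrix a a ℂ) (d : a → ℝ), W * Wᴴ = 1 ∧ Wᴴ * W = 1 ∧
      T * W = W * diagonal fun i => (d i : ℂ) := by
  have hT' : T.IsHermitian := hT
  refine ⟨hT'.eigenvectorUnitary, hT'.eigenvalues, ?_, ?_, ?_⟩
  · exact Unitary.coe_mul_star_self _
  · exact Unitary.coe_star_mul_self _
  · have h := hT'.spectral_theorem
    rw [Unitary.conjStarAlgAut_apply] at h
    have h2 := congrArg (· * (hT'.eigenvectorUnitary : Matrix a a ℂ)) h
    beta_reduce at h2
    rw [Matrix.mul_assoc _ (star _), Unitary.coe_star_mul_self, Matrix.mul_one] at h2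
    exact h2

open scoped ComplexOrder in
/-- Every complex matrix `F` has a generalized inverse `L` for which `L F` is the orthogonal
projection onto the row space of `F`. -/
lemma exists_generalized_inverse [DecidableEq b] (F : Matrix a b ℂ) :
    ∃ L : Matrix b a ℂ, F * L * F = F ∧ (L * F)ᴴ = L * F := by
  have hP : (Fᴴ * F)ᴴ = Fᴴ * F := by rw [conjTranspose_mul, conjTranspose_conjTranspose]
  obtain ⟨W, d, h1, h2, h3⟩ := exists_unitary_diagonalization hP
  set E : Matrix b b ℂ := diagonal fun i => (d i : ℂ)
  set I : Matrix b b ℂ := diagonal fun i => ((d i)⁻¹ : ℂ)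
  have hF : Fᴴ * F = W * E * Wᴴ := by rw [← h3, Matrix.mul_assoc, h1, Matrix.mul_one]
  have hLF : W * I * Wᴴ * Fᴴ * F = W * (I * E) * Wᴴ := by
    rw [Matrix.mul_assoc _ Fᴴ, hF]
    simp only [Matrix.mul_assoc]
    rw [← Matrix.mul_assoc Wᴴ W, h2, Matrix.one_mul]
  -- `E I E = E` holds with the convention `0⁻¹ = 0`, so `I` is the pseudo-inverse of `E`
  have hEIE : E * (I * E) = E := by
    simp only [E, I, diagonal_mul_diagonal]
    congr 1
    ext i
    by_cases h : (d i : ℂ) = 0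
    · simp [h]
    · field_simp
  refine ⟨W * I * Wᴴ * Fᴴ, ?_, ?_⟩
  · have h0 : Fᴴ * F * (1 - W * I * Wᴴ * Fᴴ * F) = 0 := by
      rw [Matrix.mul_sub, Matrix.mul_one, hLF, hF, sub_eq_zero]
      have : W * E * Wᴴ * (W * (I * E) * Wᴴ) = W * (E * (Wᴴ * W) * (I * E)) * Wᴴ := by
        simp only [Matrix.mul_assoc]
      rw [this, h2, Matrix.mul_one, hEIE]
    have h4 : F * (1 - W * I * Wᴴ * Fᴴ * F) = 0 := by
      rw [← conjTranspose_mul_self_eq_zero, conjTranspose_mul, Matrix.mul_assoc,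
        ← Matrix.mul_assoc Fᴴ, h0, Matrix.mul_zero]
    rw [Matrix.mul_sub, Matrix.mul_one, sub_eq_zero] at h4
    rw [Matrix.mul_assoc]
    exact h4.symm
  · rw [hLF, conjTranspose_mul, conjTranspose_mul, conjTranspose_conjTranspose, Matrix.mul_assoc]
    congr 2
    simp only [E, I, diagonal_mul_diagonal, diagonal_conjTranspose]
    congr 1
    ext i
    simp

end Frobenius

/-! ### The frequency domain inequality -/

section Frequency

open Filter Topology

variable {m p q r : Type*} [Fintype m] [DecidableEq m] [Fintype p] [Fintype q] [Fintype r]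

lemma nsq_mulVec_le [DecidableEq q] (M : Matrix p q ℂ) (w : q → ℂ) :
    nsq (M *ᵥ w) ≤ sigmaMax M ^ 2 * nsq w := by
  rw [nsq_eq_norm_sq, nsq_eq_norm_sq, ← mul_pow]
  refine pow_le_pow_left₀ (norm_nonneg _) ?_ 2
  exact (LinearMap.toContinuousLinearMap (Matrix.toEuclideanLin M)).le_opNorm (WithLp.toLp 2 w)

lemma sigmaMax_le [DecidableEq q] {M : Matrix p q ℂ} {β : ℝ} (hβ : 0 ≤ β)
    (h : ∀ w, nsq (M *ᵥ w) ≤ β ^ 2 * nsq w) : sigmaMax M ≤ β := by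
  refine ContinuousLinearMap.opNorm_le_bound _ hβ fun x => ?_
  have := h (WithLp.ofLp x)
  rw [nsq_eq_norm_sq, nsq_eq_norm_sq, ← mul_pow] at this
  exact le_of_sq_le_sq this (by positivity)

/-- The frequency inequality for a family of trajectories: the columns of `F` and `H` are states
and inputs, the condition `F Gᴴ + G Fᴴ = 0` with `G = A F + B H` expresses that the family is
stationary. Such a family splits into harmonics `(iω - A) x = B w` and a part with `x = 0`. -/
lemma stationary_family {A : Matrix m m ℝ} (hA : Hurwitz A) {B : Matrix m q ℝ} {C : Matrix p m ℝ}
    {D : Matrix p q ℝ} {β : ℝ}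
    (hG : ∀ s : ℂ, 0 ≤ s.re → ∀ w, nsq (transfer A B C D s *ᵥ w) ≤ β ^ 2 * nsq w)
    (hD : ∀ w, nsq (D.map Complex.ofReal *ᵥ w) ≤ β ^ 2 * nsq w)
    {F G : Matrix m r ℂ} {H : Matrix q r ℂ}
    (hGd : G = A.map Complex.ofReal * F + B.map Complex.ofReal * H)
    (hst : F * Gᴴ + G * Fᴴ = 0) :
    frobSq (C.map Complex.ofReal * F + D.map Complex.ofReal * H) ≤ β ^ 2 * frobSq H ∧
      (H = 0 → F = 0) := by
  classical
  set Ac := A.map Complex.ofReal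
  set Bc := B.map Complex.ofReal
  set Cc := C.map Complex.ofReal
  set Dc := D.map Complex.ofReal
  obtain ⟨L, hL1, hL2⟩ := exists_generalized_inverse F
  set Q := L * F with hQ
  have hFQ : F * Q = F := by rw [hQ, ← Matrix.mul_assoc, hL1]
  have hQQ : Q * Q = Q := by
    nth_rewrite 1 [hQ]
    rw [Matrix.mul_assoc, hFQ]
  have hFG : F * Gᴴ = -(G * Fᴴ) := eq_neg_of_add_eq_zero_left hst
  -- `S` is skew-Hermitian and intertwines `F` with the part of `G` on the row space of `F`
  set S := L * G * Fᴴ * Lᴴ with hS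
  have hQH : Fᴴ * Lᴴ = Q := by rw [← conjTranspose_mul, hL2]
  have hFS : F * S = G * Q := by
    have : F * S = F * L * (G * Fᴴ) * Lᴴ := by simp only [hS, Matrix.mul_assoc]
    rw [this, ← neg_eq_iff_eq_neg.mpr hFG, Matrix.mul_neg, Matrix.neg_mul, ← Matrix.mul_assoc, hL1,
      hFG, Matrix.neg_mul, neg_neg, Matrix.mul_assoc, hQH]
  have hSk : Sᴴ = -S := by
    have h1 : Sᴴ = L * (F * Gᴴ) * Lᴴ := by
      simp only [hS, conjTranspose_mul, conjTranspose_conjTranspose, Matrix.mul_assoc]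
    rw [h1, hFG, hS]
    simp only [Matrix.mul_neg, Matrix.neg_mul, Matrix.mul_assoc]
  have hT : (-Complex.I • S)ᴴ = -Complex.I • S := by
    rw [conjTranspose_smul, hSk]
    simp
  obtain ⟨W, d, hW1, hW2, hTW⟩ := exists_unitary_diagonalization hT
  have hSW : S * W = W * diagonal fun k => (d k : ℂ) * Complex.I := by
    have : S * W = Complex.I • ((-Complex.I • S) * W) := by
      rw [smul_mul, smul_smul]
      simp
    rw [this, hTW, ← Matrix.mul_smul, ← diagonal_smul]
    congr 2
    ext k
    simp [mul_comm]
  -- each column of `F W` is the harmonic state response to the corresponding column of `H Q W`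
  have hcol : ∀ k, (((d k : ℂ) * Complex.I) • (1 : Matrix m m ℂ) - Ac) *ᵥ (F * W).col k =
      Bc *ᵥ (H * Q * W).col k := by
    intro k
    have h1 : Ac * (F * W) + Bc * (H * Q * W) =
        F * W * diagonal fun k => (d k : ℂ) * Complex.I := by
      rw [Matrix.mul_assoc F, ← hSW, ← Matrix.mul_assoc F, hFS, hGd, Matrix.add_mul, Matrix.add_mul,
        Matrix.mul_assoc Ac F Q, hFQ]
      simp only [Matrix.mul_assoc]
    have h2 : Ac *ᵥ (F * W).col k + Bc *ᵥ (H * Q * W).col k =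
        ((d k : ℂ) * Complex.I) • (F * W).col k := by
      ext i
      have := congrFun (congrFun h1 i) k
      rw [Matrix.mul_diagonal, mul_comm] at this
      exact this
    rw [sub_mulVec, smul_mulVec, one_mulVec, ← h2, add_sub_cancel_left]
  have hx : ∀ k, (F * W).col k = res A ((d k : ℂ) * Complex.I) *ᵥ (Bc *ᵥ (H * Q * W).col k) := by
    intro k
    rw [← hcol, mulVec_mulVec, hA.res_mul (by simp), one_mulVec]
  constructor
  · rw [← frobSq_mul_proj_add (Cc * F + Dc * H) hL2 hQQ, ← frobSq_mul_proj_add H hL2 hQQ, mul_add]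
    refine add_le_add ?_ ?_
    · rw [← frobSq_mul_unitary _ hW1, ← frobSq_mul_unitary (H * Q) hW1, frobSq, frobSq,
        Finset.mul_sum]
      refine Finset.sum_le_sum fun k _ => ?_
      have hGk := hG ((d k : ℂ) * Complex.I) (by simp) ((H * Q * W).col k)
      rw [transfer, add_mulVec, ← mulVec_mulVec, ← mulVec_mulVec] at hGk
      have e : ((Cc * F + Dc * H) * Q * W).col k =
          Cc *ᵥ (F * W).col k + Dc *ᵥ (H * Q * W).col k := by
        rw [Matrix.add_mul, Matrix.add_mul, Matrix.mul_assoc Cc F Q, hFQ]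
        ext i
        simp only [Matrix.mul_assoc]
        rfl
      rw [e, hx k]
      exact hGk
    · have e : (Cc * F + Dc * H) * (1 - Q) = Dc * (H * (1 - Q)) := by
        rw [Matrix.add_mul, Matrix.mul_assoc Cc, Matrix.mul_sub F, hFQ, Matrix.mul_one, sub_self,
          Matrix.mul_zero, zero_add, Matrix.mul_assoc]
      rw [e]
      exact frobSq_mul_le hD _
  · rintro rfl
    have h0 : F * W = 0 := by
      ext i k
      have := congrFun (hx k) i
      rw [Matrix.zero_mul, Matrix.zero_mul] at this
      have hz : (0 : Matrix q r ℂ).col k = 0 := rfl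
      rw [hz, mulVec_zero, mulVec_zero] at this
      exact this
    calc F = F * W * Wᴴ := by rw [Matrix.mul_assoc, hW1, Matrix.mul_one]
      _ = 0 := by rw [h0, Matrix.zero_mul]

end Frequency

/-! ### Separation of linear matrix inequalities -/

section Separation

open Filter Topology

variable {ι : Type*} [Fintype ι]

/-- Negativity of a quadratic form is an open condition on its matrix. -/
lemma eventually_quadratic_neg {T : Type*} [TopologicalSpace T] {f : T → Matrix ι ι ℝ} {t₀ : T}
    (hf : ContinuousAt f t₀) (h : ∀ x : ι → ℝ, x ≠ 0 → x ⬝ᵥ f t₀ *ᵥ x < 0) :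
    ∀ᶠ t in 𝓝 t₀, ∀ x : ι → ℝ, x ≠ 0 → x ⬝ᵥ f t *ᵥ x < 0 := by
  have hc : Continuous (fun z : Matrix ι ι ℝ × (ι → ℝ) => z.2 ⬝ᵥ z.1 *ᵥ z.2) := by fun_prop
  have hs : ∀ᶠ t in 𝓝 t₀, ∀ x ∈ Metric.sphere (0 : ι → ℝ) 1, x ⬝ᵥ f t *ᵥ x < 0 := by
    refine (isCompact_sphere (0 : ι → ℝ) 1).eventually_forall_of_forall_eventually fun x hx => ?_
    have hcx : ContinuousAt (fun z : T × (ι → ℝ) => z.2 ⬝ᵥ f z.1 *ᵥ z.2) (t₀, x) :=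
      ContinuousAt.comp (f := fun z : T × (ι → ℝ) => (f z.1, z.2)) hc.continuousAt
        ((hf.comp continuousAt_fst).prodMk continuousAt_snd)
    refine hcx.eventually_lt continuousAt_const (h x ?_)
    rintro rfl
    simp at hx
  filter_upwards [hs] with t ht x hx
  have hn : 0 < ‖x‖ := norm_pos_iff.mpr hx
  have := ht (‖x‖⁻¹ • x) (by simp [norm_smul, hn.ne'])
  rw [mulVec_smul, dotProduct_smul, smul_dotProduct, smul_eq_mul, smul_eq_mul] at this
  have h2 : 0 < ‖x‖⁻¹ := inv_pos.mpr hn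
  by_contra hneg
  exact absurd this (not_lt.mpr (mul_nonneg h2.le (mul_nonneg h2.le (not_lt.mp hneg))))

lemma eventually_posDef {T : Type*} [TopologicalSpace T] {f : T → Matrix ι ι ℝ} {t₀ : T}
    (hf : ContinuousAt f t₀) (hs : ∀ t, (f t)ᵀ = f t) (h : (f t₀).PosDef) :
    ∀ᶠ t in 𝓝 t₀, (f t).PosDef := by
  have := eventually_quadratic_neg (f := fun t => -f t) hf.neg (fun x hx => by
    simpa [neg_mulVec] using (posDef_iff_real.mp h).2 x hx)
  filter_upwards [this] with t ht
  exact posDef_iff_real.mpr ⟨hs t, fun x hx => by simpa [neg_mulVec] using ht x hx⟩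

/-- A theorem of alternatives: the inequality `Θ + ℓ X < 0` is solvable unless some nonzero positive
semidefinite `Z = ∑ vₖ vₖᵀ` annihilates the range of `ℓ` and has `tr (Z Θ) ≥ 0`. -/
lemma exists_negDef_of_dual [DecidableEq ι] {E : Type*} [AddCommGroup E] [Module ℝ E]
    (ℓ : E →ₗ[ℝ] Matrix ι ι ℝ) (Θ : Matrix ι ι ℝ) (hℓ : ∀ X, (ℓ X)ᵀ = ℓ X) (hΘ : Θᵀ = Θ)
    (h : ∀ (r : ℕ) (v : Fin r → ι → ℝ), (∀ X, ∑ k, v k ⬝ᵥ ℓ X *ᵥ v k = 0) →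
      0 ≤ ∑ k, v k ⬝ᵥ Θ *ᵥ v k → v = 0) :
    ∃ X, NegDef (Θ + ℓ X) := by
  by_contra hno
  let O : Set (Matrix ι ι ℝ) := {N | ∀ x : ι → ℝ, x ≠ 0 → x ⬝ᵥ N *ᵥ x < 0}
  have hO : IsOpen O := isOpen_iff_mem_nhds.mpr fun N hN =>
    eventually_quadratic_neg (f := id) continuousAt_id hN
  have hOconv : Convex ℝ O := by
    intro N hN N' hN' a b ha hb hab x hx
    rw [add_mulVec, smul_mulVec, smul_mulVec, dotProduct_add, dotProduct_smul, dotProduct_smul,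
      smul_eq_mul, smul_eq_mul]
    have h1 := hN x hx
    have h2 := hN' x hx
    rcases eq_or_lt_of_le ha with rfl | ha
    · rw [zero_add] at hab
      subst hab
      linarith
    · have := mul_neg_of_pos_of_neg ha h1
      have := mul_nonpos_of_nonneg_of_nonpos hb h2.le
      linarith
  have hLconv : Convex ℝ (Set.range fun X => Θ + ℓ X) := by
    rintro _ ⟨X, rfl⟩ _ ⟨X', rfl⟩ a b - - hab
    refine ⟨a • X + b • X', ?_⟩
    simp only [map_add, map_smul, smul_add]
    nth_rewrite 1 [← one_smul ℝ Θ]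
    rw [← hab, add_smul]
    abel
  have hdisj : Disjoint O (Set.range fun X => Θ + ℓ X) := by
    rw [Set.disjoint_left]
    rintro _ hN ⟨X, rfl⟩
    exact hno ⟨X, negDef_iff_real.mpr ⟨by rw [transpose_add, hΘ, hℓ], hN⟩⟩
  obtain ⟨f, u, hfO, hfL⟩ := geometric_hahn_banach_open hOconv hO hLconv hdisj
  have hscale : ∀ N ∈ O, ∀ t : ℝ, 0 < t → t • N ∈ O := by
    intro N hN t ht x hx
    rw [smul_mulVec, dotProduct_smul, smul_eq_mul]
    exact mul_neg_of_pos_of_neg ht (hN x hx)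
  have hfN : ∀ N ∈ O, f N ≤ 0 := by
    intro N hN
    by_contra hpos
    rw [not_le] at hpos
    have := hfO _ (hscale N hN ((|u| + 1) / f N) (by positivity))
    rw [map_smul, smul_eq_mul, div_mul_cancel₀ _ hpos.ne'] at this
    linarith [le_abs_self u]
  have hpos_self : ∀ x : ι → ℝ, x ≠ 0 → 0 < x ⬝ᵥ x := fun x hx => by
    simpa using (posDef_iff_real.mp (PosDef.one (n := ι) (R := ℝ))).2 x hx
  have hneg1 : -(1 : Matrix ι ι ℝ) ∈ O := fun x hx => by
    simpa [neg_mulVec] using hpos_self x hx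
  have hf1 : 0 ≤ f 1 := by
    have := hfN _ hneg1
    rw [map_neg] at this
    linarith
  have hu : 0 ≤ u := by
    by_contra hu
    rw [not_le] at hu
    have h1 := hfO _ hneg1
    rw [map_neg] at h1
    have hf1' : 0 < f 1 := by linarith
    have := hfO _ (hscale _ hneg1 (-u / f 1) (div_pos (by linarith) hf1'))
    rw [map_smul, map_neg, smul_eq_mul, mul_neg, div_mul_cancel₀ _ hf1'.ne'] at this
    linarith
  -- the separating functional is `tr (Z ·)` on symmetric matrices
  let Z : Matrix ι ι ℝ := fun i j => (f (single i j 1) + f (single j i 1)) / 2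
  have hfsum : ∀ N : Matrix ι ι ℝ, f N = ∑ i, ∑ j, N i j * f (single i j 1) := by
    intro N
    conv_lhs => rw [matrix_eq_sum_single N]
    simp only [map_sum]
    refine Finset.sum_congr rfl fun i _ => Finset.sum_congr rfl fun j _ => ?_
    rw [← smul_eq_mul, ← map_smul, smul_single, smul_eq_mul, mul_one]
  have hfZ : ∀ N : Matrix ι ι ℝ, Nᵀ = N → f N = ∑ i, ∑ j, N i j * Z i j := by
    intro N hN
    have h2 : f N = ∑ i, ∑ j, N i j * f (single j i 1) := by
      rw [hfsum, Finset.sum_comm]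
      refine Finset.sum_congr rfl fun i _ => Finset.sum_congr rfl fun j _ => ?_
      rw [← congrFun (congrFun hN i) j, transpose_apply]
    have h3 : f N = (f N + f N) / 2 := by ring
    rw [h3]
    nth_rewrite 1 [hfsum N]
    rw [h2, ← Finset.sum_add_distrib, Finset.sum_div]
    refine Finset.sum_congr rfl fun i _ => ?_
    rw [← Finset.sum_add_distrib, Finset.sum_div]
    refine Finset.sum_congr rfl fun j _ => ?_
    simp only [Z]
    ring
  have hZ : Z.PosSemidef := by
    refine posSemidef_iff_real.mpr ⟨?_, fun x => ?_⟩
    · ext i j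
      change Z j i = Z i j
      simp only [Z]
      ring
    · have e : x ⬝ᵥ Z *ᵥ x = f (vecMulVec x x) := by
        rw [hfZ _ (by ext i j; simp [vecMulVec_apply, mul_comm])]
        simp only [dotProduct, mulVec, vecMulVec_apply, Finset.mul_sum]
        refine Finset.sum_congr rfl fun i _ => Finset.sum_congr rfl fun j _ => ?_
        ring
      rw [e]
      by_contra hneg
      rw [not_le] at hneg
      set δ := -f (vecMulVec x x) / (f 1 + 1) with hδ
      have hδ0 : 0 < δ := div_pos (by linarith) (by linarith)
      have hmem : -(vecMulVec x x + δ • (1 : Matrix ι ι ℝ)) ∈ O := by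
        intro y hy
        rw [neg_mulVec, add_mulVec, smul_one_mulVec, dotProduct_neg, dotProduct_add,
          dotProduct_smul, vecMulVec_mulVec, smul_eq_mul]
        have h1 := mul_pos hδ0 (hpos_self y hy)
        have h2 : y ⬝ᵥ MulOpposite.op (x ⬝ᵥ y) • x = (x ⬝ᵥ y) ^ 2 := by
          rw [op_smul_eq_smul, dotProduct_smul, smul_eq_mul, dotProduct_comm y x, sq]
        rw [h2]
        linarith [sq_nonneg (x ⬝ᵥ y)]
      have h3 := hfN _ hmem
      rw [map_neg, map_add, map_smul, smul_eq_mul] at h3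
      have h4 : δ * (f 1 + 1) = -f (vecMulVec x x) := by
        rw [hδ, div_mul_cancel₀ _ (by linarith)]
      linarith
  obtain ⟨r, v, hv⟩ := posSemidef_iff_eq_sum_vecMulVec.mp hZ
  have hfv : ∀ N : Matrix ι ι ℝ, Nᵀ = N → f N = ∑ k, v k ⬝ᵥ N *ᵥ v k := by
    intro N hN
    rw [hfZ N hN, hv]
    simp only [dotProduct, mulVec, vecMulVec_apply, Matrix.sum_apply, Finset.mul_sum, star_trivial]
    rw [Finset.sum_comm (s := (Finset.univ : Finset (Fin r)))]
    refine Finset.sum_congr rfl fun i _ => ?_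
    rw [Finset.sum_comm (s := (Finset.univ : Finset (Fin r)))]
    refine Finset.sum_congr rfl fun j _ => Finset.sum_congr rfl fun k _ => ?_
    ring
  have hL : ∀ X, u ≤ f Θ + f (ℓ X) := fun X => by
    simpa using hfL _ ⟨X, rfl⟩
  have hℓ0 : ∀ X, f (ℓ X) = 0 := by
    intro X
    by_contra hne
    have := hL ((-(f Θ + 1) / f (ℓ X)) • X)
    rw [map_smul, map_smul, smul_eq_mul, div_mul_cancel₀ _ hne] at this
    linarith
  have hΘ0 : u ≤ f Θ := by simpa using hL 0
  have hv0 : v = 0 := h r v (fun X => by rw [← hfv _ (hℓ X), hℓ0]) (by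
    rw [← hfv _ hΘ]
    exact hu.trans hΘ0)
  have hz : ∀ N : Matrix ι ι ℝ, Nᵀ = N → f N = 0 := by
    intro N hN
    rw [hfv N hN, hv0]
    simp
  have h1 := hfO _ hneg1
  rw [hz _ (by simp)] at h1
  rw [hz _ hΘ] at hΘ0
  linarith

end Separation

/-! ### The bounded real lemma -/

section BoundedReal

open Filter Topology

/-- The supply rate `γ⁻¹ |C x + D w|² - γ |w|²` as a symmetric matrix. -/
noncomputable def supplyMatrix {m p q : Type*} [Fintype p] [DecidableEq q] (C : Matrix p m ℝ)
    (D : Matrix p q ℝ) (γ : ℝ) :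
    Matrix (m ⊕ q) (m ⊕ q) ℝ :=
  γ⁻¹ • ((fromCols C D)ᵀ * fromCols C D) - fromBlocks 0 0 0 (γ • 1)

/-- The derivative of the storage function `xᵀ X x` along `x' = A x + B w` as a matrix. -/
def storageMatrix {m q : Type*} [Fintype m] (A : Matrix m m ℝ)
    (B : Matrix m q ℝ) (X : Matrix m m ℝ) :
    Matrix (m ⊕ q) (m ⊕ q) ℝ :=
  fromBlocks (sym (X * A)) (X * B) (X * B)ᵀ 0

lemma transpose_supplyMatrix {m p q : Type*} [Fintype p] [DecidableEq q] (C : Matrix p m ℝ)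
    (D : Matrix p q ℝ) (γ : ℝ) :
    (supplyMatrix C D γ)ᵀ = supplyMatrix C D γ := by
  rw [supplyMatrix, transpose_sub, transpose_smul, transpose_mul, transpose_transpose,
    fromBlocks_transpose]
  simp

lemma transpose_storageMatrix {m q : Type*} [Fintype m] (A : Matrix m m ℝ)
    (B : Matrix m q ℝ) (X : Matrix m m ℝ) :
    (storageMatrix A B X)ᵀ = storageMatrix A B X := by
  rw [storageMatrix, fromBlocks_transpose, transpose_sym, transpose_transpose, transpose_zero]

variable {m p q : Type*} [Fintype m] [Fintype p] [Fintype q]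

lemma storageMatrix_form (A : Matrix m m ℝ) (B : Matrix m q ℝ) (X : Matrix m m ℝ)
    (x : m → ℝ) (w : q → ℝ) :
    (x ⊕ᵥ w) ⬝ᵥ storageMatrix A B X *ᵥ (x ⊕ᵥ w) = 2 * (x ⬝ᵥ X *ᵥ (A *ᵥ x + B *ᵥ w)) := by
  rw [storageMatrix, fromBlocks_mulVec]
  simp only [Sum.elim_comp_inl, Sum.elim_comp_inr, sumElim_dotProduct_sumElim, zero_mulVec,
    add_zero, dotProduct_add, dotProduct_sym_mulVec, mulVec_add]
  rw [← dotProduct_mulVec_comm (X * B) x w, ← mulVec_mulVec, ← mulVec_mulVec]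
  ring

variable [DecidableEq q]

lemma supplyMatrix_form (C : Matrix p m ℝ) (D : Matrix p q ℝ) (γ : ℝ) (x : m → ℝ) (w : q → ℝ) :
    (x ⊕ᵥ w) ⬝ᵥ supplyMatrix C D γ *ᵥ (x ⊕ᵥ w) =
      γ⁻¹ * ((C *ᵥ x + D *ᵥ w) ⬝ᵥ (C *ᵥ x + D *ᵥ w)) - γ * (w ⬝ᵥ w) := by
  have h1 : (x ⊕ᵥ w) ⬝ᵥ ((fromCols C D)ᵀ * fromCols C D) *ᵥ (x ⊕ᵥ w) =
      (C *ᵥ x + D *ᵥ w) ⬝ᵥ (C *ᵥ x + D *ᵥ w) := by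
    rw [← mulVec_mulVec, dotProduct_mulVec_comm, transpose_transpose, fromCols_mulVec]
    simp
  rw [supplyMatrix, sub_mulVec, dotProduct_sub, smul_mulVec, dotProduct_smul, h1,
    fromBlocks_mulVec]
  simp [smul_one_mulVec]

lemma negDef_br_iff [DecidableEq p] {A X : Matrix m m ℝ} {B : Matrix m q ℝ} {C : Matrix p m ℝ}
    {D : Matrix p q ℝ} {γ : ℝ} (hγ : 0 < γ) :
    NegDef (symBlock3 (sym (X * A)) (X * B)ᵀ (-(γ • (1 : Matrix q q ℝ))) C D
      (-(γ • (1 : Matrix p p ℝ)))) ↔ NegDef (supplyMatrix C D γ + storageMatrix A B X) := by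
  have hD : (γ • (1 : Matrix p p ℝ)).PosDef := PosDef.one.smul hγ
  have hinv : (γ • (1 : Matrix p p ℝ))⁻¹ = γ⁻¹ • 1 := by
    refine inv_eq_right_inv ?_
    rw [smul_mul_smul_comm, mul_inv_cancel₀ hγ.ne', one_mul, one_smul]
  have e : -(symBlock3 (sym (X * A)) (X * B)ᵀ (-(γ • (1 : Matrix q q ℝ))) C D
      (-(γ • (1 : Matrix p p ℝ)))) =
      fromBlocks (-(fromBlocks (sym (X * A)) (X * B) (X * B)ᵀ (-(γ • (1 : Matrix q q ℝ)))))
        (-(fromCols C D)ᵀ) (-(fromCols C D)ᵀ)ᵀ (γ • 1) := by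
    rw [symBlock3, fromBlocks_neg, neg_neg, transpose_neg, transpose_transpose, transpose_transpose,
      transpose_fromCols]
  rw [NegDef, e, posDef_fromBlocks₂₂ hD, hinv, NegDef]
  have e2 : fromBlocks (sym (X * A)) (X * B) (X * B)ᵀ (-(γ • (1 : Matrix q q ℝ))) =
      storageMatrix A B X - fromBlocks 0 0 0 (γ • 1) := by
    rw [storageMatrix, sub_eq_add_neg, fromBlocks_neg, fromBlocks_add]
    simp
  rw [e2, supplyMatrix, transpose_neg, transpose_transpose, Matrix.mul_smul, Matrix.mul_one,
    Matrix.smul_mul, Matrix.neg_mul, Matrix.mul_neg, neg_neg]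
  congr! 1
  abel

/-- The upper left block of the bounded real inequality is a Lyapunov inequality. -/
lemma posDef_of_negDef_br {A X : Matrix m m ℝ} {B : Matrix m q ℝ} {C : Matrix p m ℝ}
    {D : Matrix p q ℝ} {γ : ℝ} (hγ : 0 < γ)
    (h : NegDef (supplyMatrix C D γ + storageMatrix A B X)) :
    (-sym (X * A)).PosDef := by
  refine posDef_iff_real.mpr ⟨by rw [transpose_neg, transpose_sym], fun x hx => ?_⟩
  have := (negDef_iff_real.mp h).2 (x ⊕ᵥ 0) fun h0 => hx (by
    ext i; simpa using congrFun h0 (Sum.inl i))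
  rw [add_mulVec, dotProduct_add, supplyMatrix_form, storageMatrix_form A B X] at this
  simp only [mulVec_zero, add_zero, dotProduct_zero, mul_zero, sub_zero] at this
  rw [neg_mulVec, dotProduct_neg, dotProduct_sym_mulVec, ← mulVec_mulVec]
  have h1 : 0 ≤ γ⁻¹ * (C *ᵥ x ⬝ᵥ C *ᵥ x) :=
    mul_nonneg (inv_nonneg.mpr hγ.le) (Finset.sum_nonneg fun _ _ => mul_self_nonneg _)
  linarith

variable [DecidableEq m]

lemma nsq_eq_re_im {a : Type*} [Fintype a] (v : a → ℂ) :
    nsq v = (fun i => (v i).re) ⬝ᵥ (fun i => (v i).re) +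
      (fun i => (v i).im) ⬝ᵥ (fun i => (v i).im) := by
  simp only [nsq, dotProduct, ← Finset.sum_add_distrib]
  refine Finset.sum_congr rfl fun i _ => ?_
  rw [← Complex.normSq_eq_norm_sq, Complex.normSq_apply]

lemma re_map_mulVec {a b : Type*} [Fintype b] (M : Matrix a b ℝ) (v : b → ℂ) :
    (fun i => ((M.map Complex.ofReal *ᵥ v) i).re) = M *ᵥ fun i => (v i).re := by
  ext i
  simp [mulVec, dotProduct, Complex.re_sum]

lemma im_map_mulVec {a b : Type*} [Fintype b] (M : Matrix a b ℝ) (v : b → ℂ) :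
    (fun i => ((M.map Complex.ofReal *ᵥ v) i).im) = M *ᵥ fun i => (v i).im := by
  ext i
  simp [mulVec, dotProduct, Complex.im_sum]

/-- Dissipativity gives the `H∞` bound: evaluate the quadratic form at `x = (sI - A)⁻¹ B w`, where
the storage term is `2 Re s · x* X x ≥ 0`. -/
lemma hinfNorm_lt_of_negDef {A X : Matrix m m ℝ} {B : Matrix m q ℝ} {C : Matrix p m ℝ}
    {D : Matrix p q ℝ} {γ : ℝ} (hγ : 0 < γ) (hX : X.PosDef)
    (h : NegDef (supplyMatrix C D γ + storageMatrix A B X)) :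
    Hurwitz A ∧ hinfNorm (transfer A B C D) < ENNReal.ofReal γ := by
  have hXs : Xᵀ = X := (posDef_iff_real.mp hX).1
  have hA : Hurwitz A := by
    have hAt : Hurwitz Aᵀ := hurwitz_of_lyapunov hX (posDef_of_negDef_br hγ h) (by
      rw [neg_neg, sym, transpose_mul, hXs, transpose_transpose, add_comm])
    simpa using hAt.transpose
  refine ⟨hA, ?_⟩
  -- a small reserve in the input term turns the strict bound into a uniform one
  obtain ⟨ε, hε, hεγ, hneg⟩ : ∃ ε : ℝ, 0 < ε ∧ ε < γ ∧ ∀ z : m ⊕ q → ℝ, z ≠ 0 →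
      z ⬝ᵥ (supplyMatrix C D γ + storageMatrix A B X + ε • fromBlocks 0 0 0 1) *ᵥ z < 0 := by
    have hcont : ContinuousAt (fun ε : ℝ => supplyMatrix C D γ + storageMatrix A B X +
        ε • (fromBlocks 0 0 0 1 : Matrix (m ⊕ q) (m ⊕ q) ℝ)) 0 := by
      fun_prop
    have hev := eventually_quadratic_neg hcont (by simpa using (negDef_iff_real.mp h).2)
    obtain ⟨ε, ⟨h1, h2⟩, h3⟩ := (((hev.and (eventually_lt_nhds hγ)).filter_mono
      nhdsWithin_le_nhds).and (self_mem_nhdsWithin (s := Set.Ioi (0 : ℝ)))).exists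
    exact ⟨ε, h3, h2, h1⟩
  have hineq : ∀ (x : m → ℝ) (w : q → ℝ),
      γ⁻¹ * ((C *ᵥ x + D *ᵥ w) ⬝ᵥ (C *ᵥ x + D *ᵥ w)) - γ * (w ⬝ᵥ w) +
        2 * (x ⬝ᵥ X *ᵥ (A *ᵥ x + B *ᵥ w)) + ε * (w ⬝ᵥ w) ≤ 0 := by
    intro x w
    have e : (x ⊕ᵥ w) ⬝ᵥ (supplyMatrix C D γ + storageMatrix A B X +
        ε • (fromBlocks 0 0 0 1 : Matrix (m ⊕ q) (m ⊕ q) ℝ)) *ᵥ (x ⊕ᵥ w) =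
        γ⁻¹ * ((C *ᵥ x + D *ᵥ w) ⬝ᵥ (C *ᵥ x + D *ᵥ w)) - γ * (w ⬝ᵥ w) +
        2 * (x ⬝ᵥ X *ᵥ (A *ᵥ x + B *ᵥ w)) + ε * (w ⬝ᵥ w) := by
      rw [add_mulVec, add_mulVec, dotProduct_add, dotProduct_add, supplyMatrix_form,
        storageMatrix_form A B X, smul_mulVec, fromBlocks_mulVec]
      simp
    rw [← e]
    by_cases hz : (x ⊕ᵥ w) = 0
    · rw [hz]
      simp
    · exact (hneg _ hz).le
  have hβ0 : 0 ≤ γ * (γ - ε) := mul_nonneg hγ.le (by linarith)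
  have hlt : Real.sqrt (γ * (γ - ε)) < γ := by
    rw [Real.sqrt_lt' hγ]
    nlinarith
  refine lt_of_le_of_lt ?_ (ENNReal.ofReal_lt_ofReal_iff'.mpr ⟨hlt, hγ⟩)
  refine iSup₂_le fun s hs => ENNReal.ofReal_le_ofReal
    (sigmaMax_le (Real.sqrt_nonneg _) fun w => ?_)
  rw [Real.sq_sqrt hβ0]
  set v := res A s *ᵥ (B.map Complex.ofReal *ᵥ w) with hv
  have hy : transfer A B C D s *ᵥ w =
      C.map Complex.ofReal *ᵥ v + D.map Complex.ofReal *ᵥ w := by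
    rw [transfer, add_mulVec, ← mulVec_mulVec, ← mulVec_mulVec]
    rfl
  have hsv : A.map Complex.ofReal *ᵥ v + B.map Complex.ofReal *ᵥ w = s • v := by
    have : (s • (1 : Matrix m m ℂ) - A.map Complex.ofReal) *ᵥ v = B.map Complex.ofReal *ᵥ w := by
      rw [hv, mulVec_mulVec, hA.mul_res hs.le, one_mulVec]
    rw [← this, sub_mulVec, smul_mulVec, one_mulVec, add_sub_cancel]
  have hre := hineq (fun i => (v i).re) (fun i => (w i).re)
  have him := hineq (fun i => (v i).im) (fun i => (w i).im)
  have e1 : A *ᵥ (fun i => (v i).re) + B *ᵥ (fun i => (w i).re) =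
      s.re • (fun i => (v i).re) - s.im • fun i => (v i).im := by
    rw [← re_map_mulVec, ← re_map_mulVec]
    ext i
    simpa using congrArg Complex.re (congrFun hsv i)
  have e2 : A *ᵥ (fun i => (v i).im) + B *ᵥ (fun i => (w i).im) =
      s.re • (fun i => (v i).im) + s.im • fun i => (v i).re := by
    rw [← im_map_mulVec, ← im_map_mulVec]
    ext i
    simpa using congrArg Complex.im (congrFun hsv i)
  have e3 : C *ᵥ (fun i => (v i).re) + D *ᵥ (fun i => (w i).re) =
      fun i => ((transfer A B C D s *ᵥ w) i).re := by
    rw [← re_map_mulVec, ← re_map_mulVec, hy]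
    rfl
  have e4 : C *ᵥ (fun i => (v i).im) + D *ᵥ (fun i => (w i).im) =
      fun i => ((transfer A B C D s *ᵥ w) i).im := by
    rw [← im_map_mulVec, ← im_map_mulVec, hy]
    rfl
  rw [e1, e3, mulVec_sub, dotProduct_sub, mulVec_smul, mulVec_smul, dotProduct_smul,
    dotProduct_smul, smul_eq_mul, smul_eq_mul] at hre
  rw [e2, e4, mulVec_add, dotProduct_add, mulVec_smul, mulVec_smul, dotProduct_smul,
    dotProduct_smul, smul_eq_mul, smul_eq_mul, dotProduct_mulVec_comm X (fun i => (v i).im)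
    (fun i => (v i).re), hXs] at him
  rw [nsq_eq_re_im, nsq_eq_re_im]
  set a := (fun i => ((transfer A B C D s *ᵥ w) i).re) ⬝ᵥ
    (fun i => ((transfer A B C D s *ᵥ w) i).re) + (fun i => ((transfer A B C D s *ᵥ w) i).im) ⬝ᵥ
    (fun i => ((transfer A B C D s *ᵥ w) i).im) with ha
  have hst : 0 ≤ hform X v := hform_nonneg hX.posSemidef v
  rw [hform] at hst
  have hst2 := mul_nonneg hs.le hst
  have hfin : γ⁻¹ * a ≤ (γ - ε) * ((fun i => (w i).re) ⬝ᵥ (fun i => (w i).re) +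
      (fun i => (w i).im) ⬝ᵥ (fun i => (w i).im)) := by
    rw [ha]
    linarith
  rw [inv_mul_le_iff₀ hγ] at hfin
  rw [mul_assoc]
  exact hfin

/-- An `H∞` bound holds uniformly on the closed right half plane and at infinity. -/
lemma exists_uniform_bound {A : Matrix m m ℝ} (hA : Hurwitz A) {B : Matrix m q ℝ}
    {C : Matrix p m ℝ} {D : Matrix p q ℝ} {γ : ℝ}
    (h : hinfNorm (transfer A B C D) < ENNReal.ofReal γ) :
    ∃ β : ℝ, 0 ≤ β ∧ β < γ ∧
      (∀ s : ℂ, 0 ≤ s.re → ∀ w, nsq (transfer A B C D s *ᵥ w) ≤ β ^ 2 * nsq w) ∧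
      ∀ w, nsq (D.map Complex.ofReal *ᵥ w) ≤ β ^ 2 * nsq w := by
  have htop : hinfNorm (transfer A B C D) ≠ ⊤ := (h.trans ENNReal.ofReal_lt_top).ne
  have hγ : 0 ≤ γ := by
    by_contra hneg
    rw [ENNReal.ofReal_of_nonpos (not_le.mp hneg).le] at h
    exact not_lt_zero h
  have hopen : ∀ s : ℂ, 0 < s.re → ∀ w, nsq (transfer A B C D s *ᵥ w) ≤
      (hinfNorm (transfer A B C D)).toReal ^ 2 * nsq w := by
    intro s hs w
    refine (nsq_mulVec_le _ w).trans ?_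
    have : sigmaMax (transfer A B C D s) ≤ (hinfNorm (transfer A B C D)).toReal := by
      rw [← ENNReal.ofReal_le_iff_le_toReal htop]
      exact le_iSup₂_of_le s hs le_rfl
    have h0 : 0 ≤ sigmaMax (transfer A B C D s) := norm_nonneg _
    gcongr
    exact nsq_nonneg w
  have hcont : ∀ w : q → ℂ, Continuous (fun M : Matrix p q ℂ => nsq (M *ᵥ w)) := by
    intro w
    unfold nsq
    fun_prop
  refine ⟨(hinfNorm (transfer A B C D)).toReal, ENNReal.toReal_nonneg,
    (ENNReal.lt_ofReal_iff_toReal_lt htop).mp h, fun s hs w => ?_, fun w => ?_⟩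
  · have hcT : ContinuousAt (transfer A B C D) s := by
      have h2 : Continuous (fun R : Matrix m m ℂ =>
          C.map Complex.ofReal * R * B.map Complex.ofReal + D.map Complex.ofReal) := by
        fun_prop
      exact h2.continuousAt.comp (hA.continuousAt_res hs)
    have hu : Tendsto (fun n : ℕ => s + ((1 / ((n : ℝ) + 1) : ℝ) : ℂ)) atTop (𝓝 s) := by
      have := ((Complex.continuous_ofReal.tendsto _).comp
        (tendsto_one_div_add_atTop_nhds_zero_nat (𝕜 := ℝ))).const_add s
      simpa using this
    refine le_of_tendsto (((hcont w).tendsto _).comp (hcT.tendsto.comp hu))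
      (Eventually.of_forall fun n => hopen _ ?_ w)
    have : (0 : ℝ) < 1 / ((n : ℝ) + 1) := by positivity
    rw [Complex.add_re, Complex.ofReal_re]
    linarith
  · have hu : Tendsto (fun n : ℕ => ((n + 1 : ℝ) : ℂ)) atTop (Bornology.cobounded ℂ) := by
      rw [← tendsto_norm_atTop_iff_cobounded]
      refine tendsto_atTop_mono (fun n => ?_) (tendsto_natCast_atTop_atTop (R := ℝ))
      rw [Complex.norm_real, Real.norm_of_nonneg (by positivity)]
      linarith
    refine le_of_tendsto (((hcont w).tendsto _).comp ((transfer_tendsto A B C D).comp hu))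
      (Eventually.of_forall fun n => hopen _ ?_ w)
    rw [Complex.ofReal_re]
    positivity

lemma conjTranspose_map_ofReal {a b : Type*} (M : Matrix a b ℝ) :
    (M.map Complex.ofReal)ᴴ = (Mᵀ).map Complex.ofReal := by
  ext i j
  simp

lemma frobSq_map_ofReal {a b : Type*} [Fintype a] [Fintype b] (M : Matrix a b ℝ) :
    frobSq (M.map Complex.ofReal) = ∑ k, M.col k ⬝ᵥ M.col k := by
  refine Finset.sum_congr rfl fun k _ => ?_
  simp [nsq, dotProduct, sq]

/-- The hard direction of the bounded real lemma (Kalman–Yakubovich–Popov): by the theorem of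
alternatives, insolvability of the inequality would produce a stationary family of trajectories
that violates the frequency inequality. -/
lemma exists_negDef_of_hinfNorm_lt {A : Matrix m m ℝ} (hA : Hurwitz A) {B : Matrix m q ℝ}
    {C : Matrix p m ℝ} {D : Matrix p q ℝ} {γ : ℝ} (hγ : 0 < γ)
    (h : hinfNorm (transfer A B C D) < ENNReal.ofReal γ) :
    ∃ X : Matrix m m ℝ, X.PosDef ∧ NegDef (supplyMatrix C D γ + storageMatrix A B X) := by
  obtain ⟨β, hβ0, hβγ, hG, hD⟩ := exists_uniform_bound hA h
  let ℓ : Matrix m m ℝ →ₗ[ℝ] Matrix (m ⊕ q) (m ⊕ q) ℝ :=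
    { toFun := fun X => storageMatrix A B (sym X)
      map_add' := fun X X' => by
        simp only [storageMatrix, sym, fromBlocks_add, transpose_add, Matrix.add_mul, add_zero]
        congr 1 <;> abel
      map_smul' := fun t X => by
        simp only [storageMatrix, sym, fromBlocks_smul, transpose_add, transpose_smul,
          Matrix.add_mul, Matrix.smul_mul, smul_add, smul_zero, RingHom.id_apply] }
  obtain ⟨X₀, hX₀⟩ := exists_negDef_of_dual ℓ (supplyMatrix C D γ)
    (fun X => transpose_storageMatrix _ _ _) (transpose_supplyMatrix C D γ) (by
    intro r v hst hnn
    let F : Matrix m (Fin r) ℝ := fun i k => v k (Sum.inl i)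
    let H : Matrix q (Fin r) ℝ := fun i k => v k (Sum.inr i)
    have hvFH : ∀ k, v k = F.col k ⊕ᵥ H.col k := by
      intro k
      ext i
      cases i <;> rfl
    have hGcol : ∀ k, (A * F + B * H).col k = A *ᵥ F.col k + B *ᵥ H.col k := fun k => rfl
    have hZcol : ∀ k, (C * F + D * H).col k = C *ᵥ F.col k + D *ᵥ H.col k := fun k => rfl
    have hstat : F * (A * F + B * H)ᵀ + (A * F + B * H) * Fᵀ = 0 := by
      ext i j
      have := hst (single i j 1)
      simp only [ℓ, LinearMap.coe_mk, AddHom.coe_mk, hvFH,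
        storageMatrix_form, ← hGcol] at this
      rw [← Finset.mul_sum] at this
      have e : ∀ k, F.col k ⬝ᵥ sym (single i j (1 : ℝ)) *ᵥ (A * F + B * H).col k =
          F i k * (A * F + B * H) j k + (A * F + B * H) i k * F j k := by
        intro k
        rw [sym, add_mulVec, dotProduct_add, ← dotProduct_mulVec_comm (single i j (1 : ℝ))]
        rw [single_mulVec, single_mulVec]
        change F.col k ⬝ᵥ Pi.single i _ + _ ⬝ᵥ Pi.single i _ = _
        rw [dotProduct_single, dotProduct_single]
        simp [mul_comm]
      simp only [e] at this
      simp only [Matrix.add_apply, Matrix.mul_apply, transpose_apply, Matrix.zero_apply] at this ⊢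
      rw [← Finset.sum_add_distrib]
      linarith
    obtain ⟨h1, h2⟩ := stationary_family hA hG hD (F := F.map Complex.ofReal)
      (G := (A * F + B * H).map Complex.ofReal) (H := H.map Complex.ofReal)
      (by rw [Matrix.map_add _ (by simp), map_ofReal_mul, map_ofReal_mul]) (by
        rw [conjTranspose_map_ofReal, conjTranspose_map_ofReal, ← map_ofReal_mul, ← map_ofReal_mul,
          ← Matrix.map_add _ (by simp), hstat, Matrix.map_zero _ (by simp)])
    have e1 : (C.map Complex.ofReal * F.map Complex.ofReal + D.map Complex.ofReal *
        H.map Complex.ofReal) = (C * F + D * H).map Complex.ofReal := by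
      rw [Matrix.map_add _ (by simp), map_ofReal_mul, map_ofReal_mul]
    rw [e1, frobSq_map_ofReal] at h1
    have h3 : 0 ≤ γ⁻¹ * ∑ k, (C * F + D * H).col k ⬝ᵥ (C * F + D * H).col k -
        γ * frobSq (H.map Complex.ofReal) := by
      rw [frobSq_map_ofReal, Finset.mul_sum, Finset.mul_sum, ← Finset.sum_sub_distrib]
      simpa only [hvFH, supplyMatrix_form, ← hZcol] using hnn
    have hH0 : 0 ≤ frobSq (H.map Complex.ofReal) := Finset.sum_nonneg fun _ _ => nsq_nonneg _
    have h4 : frobSq (H.map Complex.ofReal) = 0 := by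
      have h5 := mul_nonneg hγ.le h3
      rw [mul_sub, mul_inv_cancel_left₀ hγ.ne'] at h5
      have h6 : 0 < γ ^ 2 - β ^ 2 := by nlinarith
      nlinarith
    have h5 := frobSq_eq_zero.mp h4
    have h6 := h2 h5
    ext k i
    rcases i with i | i
    · simpa using congrFun (congrFun h6 i) k
    · simpa using congrFun (congrFun h5 i) k)
  refine ⟨sym X₀, ?_, hX₀⟩
  have hs := transpose_sym X₀
  refine hA.transpose.posDef_of_lyapunov hs ?_ (posDef_of_negDef_br hγ hX₀)
  rw [neg_neg, transpose_transpose]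
  change _ = sym X₀ * A + (sym X₀ * A)ᵀ
  rw [transpose_mul, hs, add_comm]

/-- The strict bounded real lemma. -/
theorem hinfNorm_lt_iff_lmi [DecidableEq p] {A : Matrix m m ℝ} {B : Matrix m q ℝ} {C : Matrix p m ℝ}
    {D : Matrix p q ℝ} {γ : ℝ} (hγ : 0 < γ) :
    (Hurwitz A ∧ hinfNorm (transfer A B C D) < ENNReal.ofReal γ) ↔
      ∃ X : Matrix m m ℝ, X.PosDef ∧
        NegDef (symBlock3 (sym (X * A)) (X * B)ᵀ (-(γ • (1 : Matrix q q ℝ))) C D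
          (-(γ • (1 : Matrix p p ℝ)))) := by
  simp only [negDef_br_iff hγ]
  exact ⟨fun ⟨hA, h⟩ => exists_negDef_of_hinfNorm_lt hA hγ h,
    fun ⟨X, hX, h⟩ => hinfNorm_lt_of_negDef hγ hX h⟩

end BoundedReal

/-! ### Certificates and congruence transformations -/

section Certificate

lemma injective_mulVec_iff {a b : Type*} [Fintype b] {T : Matrix a b ℝ} :
    Function.Injective T.mulVec ↔ ∀ v, T *ᵥ v = 0 → v = 0 := by
  refine ⟨fun h v hv => h (by rw [hv, mulVec_zero]), fun h v v' hv => ?_⟩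
  exact sub_eq_zero.mp (h _ (by rw [mulVec_sub]; exact sub_eq_zero.mpr hv))

lemma sym_congr {a b : Type*} [Fintype a] (S : Matrix a a ℝ) (T : Matrix a b ℝ) :
    sym (Tᵀ * S * T) = Tᵀ * sym S * T := by
  simp only [sym, transpose_mul, transpose_transpose, Matrix.mul_add, Matrix.add_mul,
    Matrix.mul_assoc]

lemma injective_fromBlocks_one {a b c : Type*} [Fintype b] [Fintype c] [DecidableEq c]
    {T : Matrix a b ℝ} (hT : Function.Injective T.mulVec) :
    Function.Injective (fromBlocks T 0 0 (1 : Matrix c c ℝ)).mulVec := by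
  rw [injective_mulVec_iff] at hT ⊢
  intro v hv
  rw [fromBlocks_mulVec] at hv
  have h1 := hT (v ∘ Sum.inl) (by ext i; simpa using congrFun hv (Sum.inl i))
  ext i
  rcases i with i | i
  · exact congrFun h1 i
  · simpa using congrFun hv (Sum.inr i)

lemma injective_one_fromBlocks {a b c : Type*} [Fintype b] [Fintype c] [DecidableEq c]
    {T : Matrix a b ℝ} (hT : Function.Injective T.mulVec) :
    Function.Injective (fromBlocks (1 : Matrix c c ℝ) 0 0 T).mulVec := by
  rw [injective_mulVec_iff] at hT ⊢
  intro v hv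
  rw [fromBlocks_mulVec] at hv
  have h1 := hT (v ∘ Sum.inr) (by ext i; simpa using congrFun hv (Sum.inr i))
  ext i
  rcases i with i | i
  · simpa using congrFun hv (Sum.inl i)
  · exact congrFun h1 i

lemma fromBlocks_congr {a b c : Type*} [Fintype a] [Fintype c] [DecidableEq c] (S : Matrix a a ℝ)
    (B : Matrix a c ℝ) (C : Matrix c a ℝ) (D : Matrix c c ℝ) (T : Matrix a b ℝ) :
    (fromBlocks T 0 0 (1 : Matrix c c ℝ))ᵀ * fromBlocks S B C D *
        fromBlocks T 0 0 (1 : Matrix c c ℝ) =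
      fromBlocks (Tᵀ * S * T) (Tᵀ * B) (C * T) D := by
  simp [fromBlocks_transpose, fromBlocks_multiply]

variable {a b w z u : Type*} [Fintype a] [Fintype b] [Fintype w] [DecidableEq w] [Fintype z]
  [DecidableEq z]

/-- The performance inequalities written in terms of the products `S = X A` and `B = X B`; in this
form a change of the state coordinates acts by congruence. -/
def Certificate (γ : ℝ) (Γ : u → ℝ) (S : Matrix a a ℝ) (B : Matrix a w ℝ) (C : Matrix z a ℝ)
    (D : Matrix z w ℝ) (U : Matrix u a ℝ) (X : Matrix a a ℝ) : Prop :=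
  NegDef (symBlock3 (sym S) Bᵀ (-(γ • (1 : Matrix w w ℝ))) C D (-(γ • (1 : Matrix z z ℝ)))) ∧
  NegDef (fromBlocks (sym S) B Bᵀ (-(1 : Matrix w w ℝ))) ∧
  ∀ i, (fromBlocks (Γ i • (1 : Matrix Unit Unit ℝ)) (rowMat U i) (rowMat U i)ᵀ X).PosDef

lemma posDef_congr {M : Matrix a a ℝ} (hM : M.PosDef) {T : Matrix a b ℝ}
    (hT : Function.Injective T.mulVec) : (Tᵀ * M * T).PosDef := by
  rw [← conjTranspose_eq_transpose_of_trivial]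
  exact hM.conjTranspose_mul_mul_same hT

lemma negDef_congr {M : Matrix a a ℝ} (hM : NegDef M) {T : Matrix a b ℝ}
    (hT : Function.Injective T.mulVec) : NegDef (Tᵀ * M * T) := by
  have := posDef_congr (M := -M) hM hT
  rwa [Matrix.mul_neg, Matrix.neg_mul] at this

lemma Certificate.congr {γ : ℝ} {Γ : u → ℝ} {S : Matrix a a ℝ} {B : Matrix a w ℝ}
    {C : Matrix z a ℝ} {D : Matrix z w ℝ} {U : Matrix u a ℝ} {X : Matrix a a ℝ}
    (h : Certificate γ Γ S B C D U X) {T : Matrix a b ℝ} (hT : Function.Injective T.mulVec) :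
    Certificate γ Γ (Tᵀ * S * T) (Tᵀ * B) (C * T) D (U * T) (Tᵀ * X * T) := by
  obtain ⟨h1, h2, h3⟩ := h
  refine ⟨?_, ?_, fun i => ?_⟩
  · have := negDef_congr h1 (injective_fromBlocks_one (c := z)
      (injective_fromBlocks_one (c := w) hT))
    rw [symBlock3, fromBlocks_congr, fromBlocks_congr] at this
    convert this using 1
    rw [symBlock3, sym_congr]
    simp only [transpose_mul, transpose_transpose]
    congr 1
    · rw [fromBlocks_transpose, fromBlocks_mul_fromRows]
      simp
    · rw [fromCols_mul_fromBlocks]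
      simp
  · have := negDef_congr h2 (injective_fromBlocks_one (c := w) hT)
    rw [fromBlocks_congr] at this
    rw [sym_congr, transpose_mul, transpose_transpose]
    exact this
  · have := posDef_congr (h3 i) (injective_one_fromBlocks (c := Unit) hT)
    convert this using 1
    have e : rowMat (U * T) i = rowMat U i * T := rfl
    simp [fromBlocks_transpose, fromBlocks_multiply, e]

/-- A congruence by a nonsingular matrix can be undone. -/
lemma Certificate.of_congr [DecidableEq a] {γ : ℝ} {Γ : u → ℝ} {S : Matrix a a ℝ}
    {B : Matrix a w ℝ} {C : Matrix z a ℝ} {D : Matrix z w ℝ} {U : Matrix u a ℝ}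
    {X : Matrix a a ℝ} {T T' : Matrix a a ℝ} (hT : T * T' = 1)
    (h : Certificate γ Γ (Tᵀ * S * T) (Tᵀ * B) (C * T) D (U * T) (Tᵀ * X * T)) :
    Certificate γ Γ S B C D U X := by
  have hT2 : T' * T = 1 := mul_eq_one_comm.mp hT
  have hTt : T'ᵀ * Tᵀ = 1 := by rw [← transpose_mul, hT, transpose_one]
  have hinj : Function.Injective T'.mulVec := injective_mulVec_iff.mpr fun v hv => by
    rw [← one_mulVec v, ← hT, ← mulVec_mulVec, hv, mulVec_zero]
  have h2 := h.congr hinj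
  have e : ∀ M : Matrix a a ℝ, T'ᵀ * (Tᵀ * M * T) * T' = M := by
    intro M
    rw [Matrix.mul_assoc, Matrix.mul_assoc, hT, Matrix.mul_one, ← Matrix.mul_assoc, hTt,
      Matrix.one_mul]
  rwa [e, e, ← Matrix.mul_assoc, hTt, Matrix.one_mul, Matrix.mul_assoc, hT, Matrix.mul_one,
    Matrix.mul_assoc, hT, Matrix.mul_one] at h2

end Certificate

/-! ### The change of variables -/

section ChangeOfVariables

variable {n nu nw nz ny k : ℕ}

/-- The matrix `[X, I; Mᵀ, 0]` of the linearizing congruence. -/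
def congrMat (X : Matrix (Fin n) (Fin n) ℝ) (M : Matrix (Fin n) (Fin k) ℝ) :
    Matrix (Fin n ⊕ Fin k) (Fin n ⊕ Fin n) ℝ :=
  fromBlocks X 1 Mᵀ 0

/-- The product `[X, I; Mᵀ, 0]ᵀ X_cl A_cl [X, I; Mᵀ, 0]` in the transformed variables. -/
def hatA (P : Plant n nu nw nz ny) (v : HatVars n nu ny) :
    Matrix (Fin n ⊕ Fin n) (Fin n ⊕ Fin n) ℝ :=
  fromBlocks (P.A * v.X + P.Bu * v.C) (P.A + P.Bu * v.D * P.Cy) v.A (v.Y * P.A + v.B * P.Cy)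

/-- The product `[X, I; Mᵀ, 0]ᵀ X_cl B_cl` in the transformed variables. -/
def hatB (P : Plant n nu nw nz ny) (v : HatVars n nu ny) : Matrix (Fin n ⊕ Fin n) (Fin nw) ℝ :=
  fromRows (P.Bw + P.Bu * v.D * P.Dyw) (v.Y * P.Bw + v.B * P.Dyw)

/-- The product `C_cl [X, I; Mᵀ, 0]` in the transformed variables. -/
def hatC (P : Plant n nu nw nz ny) (v : HatVars n nu ny) : Matrix (Fin nz) (Fin n ⊕ Fin n) ℝ :=
  fromCols (P.Cz * v.X + P.Du * v.C) (P.Cz + P.Du * v.D * P.Cy)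

/-- The product of the control output matrix with `[X, I; Mᵀ, 0]` in the transformed variables. -/
def hatU (P : Plant n nu nw nz ny) (v : HatVars n nu ny) : Matrix (Fin nu) (Fin n ⊕ Fin n) ℝ :=
  fromCols v.C (v.D * P.Cy)

lemma negDef_symBlock4_iff {a b c d : Type*} [Fintype a] [Fintype b] [Fintype c] [Fintype d]
    {M₁₁ : Matrix a a ℝ}
    {M₂₁ : Matrix b a ℝ} {M₂₂ : Matrix b b ℝ}
    {M₃₁ : Matrix c a ℝ} {M₃₂ : Matrix c b ℝ} {M₃₃ : Matrix c c ℝ}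
    {M₄₁ : Matrix d a ℝ} {M₄₂ : Matrix d b ℝ} {M₄₃ : Matrix d c ℝ} {M₄₄ : Matrix d d ℝ} :
    NegDef (symBlock4 M₁₁ M₂₁ M₂₂ M₃₁ M₃₂ M₃₃ M₄₁ M₄₂ M₄₃ M₄₄) ↔
      NegDef (symBlock3 (fromBlocks M₁₁ M₂₁ᵀ M₂₁ M₂₂) (fromCols M₃₁ M₃₂) M₃₃
        (fromCols M₄₁ M₄₂) M₄₃ M₄₄) := by
  have e : symBlock4 M₁₁ M₂₁ M₂₂ M₃₁ M₃₂ M₃₃ M₄₁ M₄₂ M₄₃ M₄₄ =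
      (symBlock3 (fromBlocks M₁₁ M₂₁ᵀ M₂₁ M₂₂) (fromCols M₃₁ M₃₂) M₃₃
        (fromCols M₄₁ M₄₂) M₄₃ M₄₄).submatrix (Equiv.sumAssoc (a ⊕ b) c d).symm
          (Equiv.sumAssoc (a ⊕ b) c d).symm := by
    ext i j
    rcases i with (i | i) | (i | i) <;> rcases j with (j | j) | (j | j) <;> rfl
  rw [e, NegDef, NegDef]
  constructor
  · intro h
    have := h.submatrix (Equiv.sumAssoc (a ⊕ b) c d).injective
    convert this using 1
    ext i j
    simp
  · intro h
    exact h.submatrix (Equiv.sumAssoc (a ⊕ b) c d).symm.injective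

lemma synthesisLMIs_iff (P : Plant n nu nw nz ny) (γ₀ : ℝ) (Γ : Fin nu → ℝ)
    (v : HatVars n nu ny) :
    SynthesisLMIs P γ₀ Γ v ↔
      Certificate γ₀ Γ (hatA P v) (hatB P v) (hatC P v) (P.Dw + P.Du * v.D * P.Dyw) (hatU P v)
        (fromBlocks v.X 1 1 v.Y) ∧ v.D * P.Dyw = 0 := by
  have e1 : fromBlocks (sym (P.A * v.X + P.Bu * v.C)) (v.A + (P.A + P.Bu * v.D * P.Cy)ᵀ)ᵀ
      (v.A + (P.A + P.Bu * v.D * P.Cy)ᵀ) (sym (v.Y * P.A + v.B * P.Cy)) = sym (hatA P v) := by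
    simp only [sym, hatA, fromBlocks_transpose, fromBlocks_add, transpose_add, transpose_transpose]
    congr 1
    abel
  have e2 : fromCols (P.Bw + P.Bu * v.D * P.Dyw)ᵀ (v.Y * P.Bw + v.B * P.Dyw)ᵀ = (hatB P v)ᵀ := by
    rw [hatB, transpose_fromRows]
  have e3 : fromRows (P.Bw + P.Bu * v.D * P.Dyw)ᵀᵀ (v.Y * P.Bw + v.B * P.Dyw)ᵀᵀ = hatB P v := rfl
  have e4 : ∀ i, fromCols (rowMat v.C i) (rowMat (v.D * P.Cy) i) = rowMat (hatU P v) i := by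
    intro i
    ext _ j
    cases j <;> rfl
  rw [SynthesisLMIs, Certificate, negDef_symBlock4_iff, e1, e2, and_assoc, and_assoc]
  simp only [symBlock3, e1, e2, e3, e4, hatC]

lemma commonLyapunov_iff (P : Plant n nu nw nz ny) (K : Controller k nu ny) (γ₀ : ℝ)
    (Γ : Fin nu → ℝ) (Xcl : Matrix (Fin n ⊕ Fin k) (Fin n ⊕ Fin k) ℝ) :
    CommonLyapunov P K γ₀ Γ Xcl ↔ Xcl.PosDef ∧
      Certificate γ₀ Γ (Xcl * Acl P K) (Xcl * Bcl P K) (Ccl P K) (Dcl P K) (Cu P K) Xcl ∧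
        K.DK * P.Dyw = 0 := by
  rw [CommonLyapunov, Certificate, and_assoc, and_assoc]
  refine and_congr_right fun hX => and_congr_right fun _ => and_congr_left fun _ => ?_
  have : sym ((Acl P K)ᵀ * Xcl) = sym (Xcl * Acl P K) := by
    rw [sym, sym, transpose_mul, transpose_mul, transpose_transpose, (posDef_iff_real.mp hX).1,
      add_comm]
  rw [H2LyapunovLMI, this]

/-- The closed loop Lyapunov matrix maps `[X, I; Mᵀ, 0]` to `[I, Y; 0, Nᵀ]`. -/
lemma mul_congrMat {Xcl : Matrix (Fin n ⊕ Fin k) (Fin n ⊕ Fin k) ℝ} (hX : Xcl.PosDef) :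
    Xcl * congrMat (blockX Xcl) (blockM Xcl) = fromBlocks 1 (blockY Xcl) 0 (blockN Xcl)ᵀ := by
  have hs := (posDef_iff_real.mp hX).1
  have hsi := (posDef_iff_real.mp hX.inv).1
  have e1 : Xcl = fromBlocks (blockY Xcl) (blockN Xcl) (blockN Xcl)ᵀ Xcl.toBlocks₂₂ := by
    nth_rewrite 1 [← fromBlocks_toBlocks Xcl]
    rw [blockY, blockN]
    congr 1
    nth_rewrite 1 [← hs]
    rfl
  have e2 : Xcl⁻¹ = fromBlocks (blockX Xcl) (blockM Xcl) (blockM Xcl)ᵀ Xcl⁻¹.toBlocks₂₂ := by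
    nth_rewrite 1 [← fromBlocks_toBlocks Xcl⁻¹]
    rw [blockX, blockM]
    congr 1
    nth_rewrite 1 [← hsi]
    rfl
  have h1 := mul_nonsing_inv Xcl ((isUnit_iff_isUnit_det _).mp hX.isUnit)
  rw [e2] at h1
  nth_rewrite 1 [e1] at h1
  rw [fromBlocks_multiply, ← fromBlocks_one, fromBlocks_inj] at h1
  nth_rewrite 1 [e1]
  rw [congrMat, fromBlocks_multiply, h1.1, h1.2.2.1]
  simp

lemma blockY_transpose {Xcl : Matrix (Fin n ⊕ Fin k) (Fin n ⊕ Fin k) ℝ} (hX : Xcl.PosDef) :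
    (blockY Xcl)ᵀ = blockY Xcl := by
  have hs := (posDef_iff_real.mp hX).1
  nth_rewrite 2 [← hs]
  rfl

lemma congrMat_transpose_mul {Xcl : Matrix (Fin n ⊕ Fin k) (Fin n ⊕ Fin k) ℝ} (hX : Xcl.PosDef) :
    (congrMat (blockX Xcl) (blockM Xcl))ᵀ * Xcl = fromBlocks 1 0 (blockY Xcl) (blockN Xcl) := by
  have h := congrArg Matrix.transpose (mul_congrMat hX)
  rw [transpose_mul, (posDef_iff_real.mp hX).1, fromBlocks_transpose, blockY_transpose hX] at h
  simpa using h

variable (P : Plant n nu nw nz ny) (K : Controller k nu ny)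

lemma hatA_hat {Xcl : Matrix (Fin n ⊕ Fin k) (Fin n ⊕ Fin k) ℝ} (hX : Xcl.PosDef) :
    hatA P (hat P K Xcl) = (congrMat (blockX Xcl) (blockM Xcl))ᵀ * (Xcl * Acl P K) *
      congrMat (blockX Xcl) (blockM Xcl) := by
  rw [← Matrix.mul_assoc, congrMat_transpose_mul hX, Acl, congrMat, fromBlocks_multiply,
    fromBlocks_multiply, hatA, hat]
  dsimp only
  congr 1 <;> simp only [Matrix.mul_add, Matrix.add_mul, Matrix.mul_assoc, Matrix.mul_one,
    Matrix.one_mul, Matrix.zero_mul, Matrix.mul_zero, add_zero] <;> abel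

lemma hatB_hat {Xcl : Matrix (Fin n ⊕ Fin k) (Fin n ⊕ Fin k) ℝ} (hX : Xcl.PosDef) :
    hatB P (hat P K Xcl) = (congrMat (blockX Xcl) (blockM Xcl))ᵀ * (Xcl * Bcl P K) := by
  rw [← Matrix.mul_assoc, congrMat_transpose_mul hX, Bcl, fromBlocks_mul_fromRows, hatB, hat]
  dsimp only
  simp only [Matrix.mul_add, Matrix.add_mul, Matrix.mul_assoc, Matrix.one_mul, Matrix.zero_mul,
    add_zero]
  congr 1
  abel

lemma hatC_hat (Xcl : Matrix (Fin n ⊕ Fin k) (Fin n ⊕ Fin k) ℝ) :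
    hatC P (hat P K Xcl) = Ccl P K * congrMat (blockX Xcl) (blockM Xcl) := by
  rw [Ccl, congrMat, fromCols_mul_fromBlocks, hatC, hat]
  dsimp only
  congr 1 <;> simp only [Matrix.mul_add, Matrix.add_mul, Matrix.mul_assoc, Matrix.mul_one,
    Matrix.mul_zero, add_zero]
  abel

lemma hatU_hat (Xcl : Matrix (Fin n ⊕ Fin k) (Fin n ⊕ Fin k) ℝ) :
    hatU P (hat P K Xcl) = Cu P K * congrMat (blockX Xcl) (blockM Xcl) := by
  rw [Cu, congrMat, fromCols_mul_fromBlocks, hatU, hat]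
  dsimp only
  rw [Matrix.mul_one, Matrix.mul_zero, add_zero, add_comm]

lemma congrMat_form {Xcl : Matrix (Fin n ⊕ Fin k) (Fin n ⊕ Fin k) ℝ} (hX : Xcl.PosDef) :
    fromBlocks (blockX Xcl) 1 1 (blockY Xcl) = (congrMat (blockX Xcl) (blockM Xcl))ᵀ * Xcl *
      congrMat (blockX Xcl) (blockM Xcl) := by
  have h1 : (congrMat (blockX Xcl) (blockM Xcl))ᵀ * Xcl * congrMat (blockX Xcl) (blockM Xcl) =
      fromBlocks (blockX Xcl) 1 (blockY Xcl * blockX Xcl + blockN Xcl * (blockM Xcl)ᵀ)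
        (blockY Xcl) := by
    rw [congrMat_transpose_mul hX, congrMat, fromBlocks_multiply]
    simp
  have h2 : (congrMat (blockX Xcl) (blockM Xcl))ᵀ * Xcl * congrMat (blockX Xcl) (blockM Xcl) =
      fromBlocks (blockX Xcl)ᵀ ((blockX Xcl)ᵀ * blockY Xcl + blockM Xcl * (blockN Xcl)ᵀ) 1
        (blockY Xcl) := by
    rw [Matrix.mul_assoc, mul_congrMat hX, congrMat, fromBlocks_transpose, fromBlocks_multiply]
    simp
  have h3 := h1.symm.trans h2
  rw [fromBlocks_inj] at h3
  rw [h1, h3.2.2.1]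

/-- In the transformed variables the synthesis inequalities are a congruence transformation of the
closed loop inequalities. -/
lemma synthesisLMIs_hat_iff {Xcl : Matrix (Fin n ⊕ Fin k) (Fin n ⊕ Fin k) ℝ} (hX : Xcl.PosDef)
    (γ₀ : ℝ) (Γ : Fin nu → ℝ) :
    SynthesisLMIs P γ₀ Γ (hat P K Xcl) ↔
      Certificate γ₀ Γ
        ((congrMat (blockX Xcl) (blockM Xcl))ᵀ * (Xcl * Acl P K) *
          congrMat (blockX Xcl) (blockM Xcl))
        ((congrMat (blockX Xcl) (blockM Xcl))ᵀ * (Xcl * Bcl P K))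
        (Ccl P K * congrMat (blockX Xcl) (blockM Xcl)) (Dcl P K)
        (Cu P K * congrMat (blockX Xcl) (blockM Xcl))
        ((congrMat (blockX Xcl) (blockM Xcl))ᵀ * Xcl * congrMat (blockX Xcl) (blockM Xcl)) ∧
      K.DK * P.Dyw = 0 := by
  rw [synthesisLMIs_iff, hatA_hat P K hX, hatB_hat P K hX, hatC_hat, hatU_hat, ← congrMat_form hX]
  rfl

end ChangeOfVariables

/-! ### Feasible points of the synthesis problem -/

section Feasibility

variable {n nu nw nz ny k : ℕ} {P : Plant n nu nw nz ny} {γ₀ : ℝ} {Γ : Fin nu → ℝ}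

lemma boundedReal_iff (hγ₀ : 0 < γ₀) (K : Controller k nu ny) :
    (Hurwitz (Acl P K) ∧ hinfNorm (Gz P K) < ENNReal.ofReal γ₀) ↔
      ∃ Xcl, Xcl.PosDef ∧ BoundedRealLMI P K γ₀ Xcl :=
  hinfNorm_lt_iff_lmi hγ₀

lemma h2Channel_iff (K : Controller k nu ny) (i : Fin nu) (g : ℝ) :
    (Hurwitz (Acl P K) ∧ h2Norm (Gu P K i) < ENNReal.ofReal (Real.sqrt g)) ↔
      rowMat (K.DK * P.Dyw) i = 0 ∧
        ∃ Xcl, Xcl.PosDef ∧ H2LyapunovLMI P K Xcl ∧ H2ChannelLMI P K g i Xcl :=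
  h2Norm_lt_iff_lmi

lemma CommonLyapunov.designFeasible (hγ₀ : 0 < γ₀) {K : Controller k nu ny}
    {Xcl : Matrix (Fin n ⊕ Fin k) (Fin n ⊕ Fin k) ℝ} (h : CommonLyapunov P K γ₀ Γ Xcl) :
    DesignFeasible P K γ₀ Γ := by
  obtain ⟨hX, hBR, hL, hC, hD⟩ := h
  obtain ⟨hA, hinf⟩ := (boundedReal_iff hγ₀ K).mpr ⟨Xcl, hX, hBR⟩
  refine ⟨hA, hinf, fun i => ((h2Channel_iff K i (Γ i)).mpr ⟨?_, Xcl, hX, hL, hC i⟩).2⟩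
  rw [hD]
  rfl

lemma CommonLyapunov.pos {K : Controller k nu ny}
    {Xcl : Matrix (Fin n ⊕ Fin k) (Fin n ⊕ Fin k) ℝ} (h : CommonLyapunov P K γ₀ Γ Xcl)
    (i : Fin nu) : 0 < Γ i := by
  have := (h.2.2.2.1 i).diag_pos (i := Sum.inl ())
  simpa using this

/-- As `X_cl [X, I; Mᵀ, 0] = [I, Y; 0, Nᵀ]`, the congruence is injective when `N` has full row
rank; for a controller of low order this fails. -/
lemma injective_congrMat_of_blockN {Xcl : Matrix (Fin n ⊕ Fin k) (Fin n ⊕ Fin k) ℝ}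
    (hX : Xcl.PosDef) (hN : Function.Injective (blockN Xcl)ᵀ.mulVec) :
    Function.Injective (congrMat (blockX Xcl) (blockM Xcl)).mulVec := by
  rw [injective_mulVec_iff] at hN ⊢
  intro z hz
  have h : fromBlocks 1 (blockY Xcl) 0 (blockN Xcl)ᵀ *ᵥ z = 0 := by
    rw [← mul_congrMat hX, ← mulVec_mulVec, hz, mulVec_zero]
  rw [fromBlocks_mulVec] at h
  have h2 : z ∘ Sum.inr = 0 := hN _ (by ext i; simpa using congrFun h (Sum.inr i))
  ext i
  rcases i with i | i
  · simpa [h2] using congrFun h (Sum.inl i)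
  · exact congrFun h2 i

lemma isUnit_det_iff_injective {m : Type*} [Fintype m] [DecidableEq m] {T : Matrix m m ℝ} :
    IsUnit T.det ↔ Function.Injective T.mulVec := by
  rw [mulVec_injective_iff_isUnit, isUnit_iff_isUnit_det]

lemma injective_congrMat_iff {X M : Matrix (Fin n) (Fin n) ℝ} :
    Function.Injective (congrMat X M).mulVec ↔ IsUnit M.det := by
  rw [← det_transpose, isUnit_det_iff_injective, injective_mulVec_iff, injective_mulVec_iff]
  constructor
  · intro h v hv
    have := h (v ⊕ᵥ -(X *ᵥ v)) (by
      rw [congrMat, fromBlocks_mulVec]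
      simp [hv])
    ext i
    exact congrFun this (Sum.inl i)
  · intro h z hz
    rw [congrMat, fromBlocks_mulVec] at hz
    have h1 : z ∘ Sum.inl = 0 := h _ (by ext i; simpa using congrFun hz (Sum.inr i))
    ext i
    rcases i with i | i
    · exact congrFun h1 i
    · simpa [h1] using congrFun hz (Sum.inl i)

/-- The Lyapunov inequality of the synthesis problem forces the congruence to be injective. -/
lemma injective_of_negDef_sym_congr {a b c : Type*} [Fintype a] [Fintype b] [Fintype c]
    {S : Matrix a a ℝ} {T : Matrix a b ℝ} {B : Matrix b c ℝ} {C : Matrix c b ℝ} {D : Matrix c c ℝ}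
    (h : NegDef (fromBlocks (sym (Tᵀ * S * T)) B C D)) : Function.Injective T.mulVec := by
  rw [injective_mulVec_iff]
  intro v hv
  by_contra hne
  have := (negDef_iff_real.mp h).2 (v ⊕ᵥ 0) fun h0 => hne (by
    ext i; simpa using congrFun h0 (Sum.inl i))
  rw [fromBlocks_mulVec] at this
  simp only [Sum.elim_comp_inl, Sum.elim_comp_inr, mulVec_zero, add_zero,
    sumElim_dotProduct_sumElim, zero_dotProduct, dotProduct_sym_mulVec, ← mulVec_mulVec, hv,
    dotProduct_zero, mul_zero, lt_irrefl] at this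

/-- For a full order controller the congruence `[X, I; Mᵀ, 0]` is square. The synthesis inequalities
force it to be nonsingular, so that it can be undone. -/
lemma lmiFeasible_iff (K : Controller n nu ny)
    (Xcl : Matrix (Fin n ⊕ Fin n) (Fin n ⊕ Fin n) ℝ) :
    LMIFeasible P γ₀ Γ K Xcl ↔ CommonLyapunov P K γ₀ Γ Xcl ∧ IsUnit (blockM Xcl).det := by
  constructor
  · rintro ⟨-, hX, hS⟩
    obtain ⟨hc, hD⟩ := (synthesisLMIs_hat_iff P K hX γ₀ Γ).mp hS
    have hinj := injective_of_negDef_sym_congr hc.2.1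
    refine ⟨(commonLyapunov_iff P K γ₀ Γ Xcl).mpr ⟨hX, ?_, hD⟩, injective_congrMat_iff.mp hinj⟩
    exact Certificate.of_congr (mul_nonsing_inv _ (isUnit_det_iff_injective.mpr hinj)) hc
  · rintro ⟨h, hM⟩
    obtain ⟨hX, hc, hD⟩ := (commonLyapunov_iff P K γ₀ Γ Xcl).mp h
    exact ⟨h.pos, hX, (synthesisLMIs_hat_iff P K hX γ₀ Γ).mpr
      ⟨hc.congr (injective_congrMat_iff.mpr hM), hD⟩⟩

lemma CommonLyapunov.hatFeasible {K : Controller k nu ny}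
    {Xcl : Matrix (Fin n ⊕ Fin k) (Fin n ⊕ Fin k) ℝ} (h : CommonLyapunov P K γ₀ Γ Xcl)
    (hN : Function.Injective (blockN Xcl)ᵀ.mulVec) : HatFeasible P γ₀ Γ (hat P K Xcl) := by
  obtain ⟨hX, hc, hD⟩ := (commonLyapunov_iff P K γ₀ Γ Xcl).mp h
  have hinj := injective_congrMat_of_blockN hX hN
  refine ⟨h.pos, ?_, (synthesisLMIs_hat_iff P K hX γ₀ Γ).mpr ⟨hc.congr hinj, hD⟩⟩
  change (fromBlocks (blockX Xcl) 1 1 (blockY Xcl)).PosDef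
  rw [congrMat_form hX]
  exact posDef_congr hX hinj

lemma transpose_symBlock3 {a b c : Type*} {M₁₁ : Matrix a a ℝ}
    {M₂₁ : Matrix b a ℝ} {M₂₂ : Matrix b b ℝ}
    {M₃₁ : Matrix c a ℝ} {M₃₂ : Matrix c b ℝ} {M₃₃ : Matrix c c ℝ}
    (h₁ : M₁₁ᵀ = M₁₁) (h₂ : M₂₂ᵀ = M₂₂) (h₃ : M₃₃ᵀ = M₃₃) :
    (symBlock3 M₁₁ M₂₁ M₂₂ M₃₁ M₃₂ M₃₃)ᵀ = symBlock3 M₁₁ M₂₁ M₂₂ M₃₁ M₃₂ M₃₃ := by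
  simp only [symBlock3, fromBlocks_transpose, transpose_transpose, transpose_fromRows,
    transpose_fromCols, h₁, h₂, h₃]

open Filter Topology in
/-- Common certificates are stable under small symmetric perturbations. -/
lemma CommonLyapunov.eventually {K : Controller k nu ny}
    {f : ℝ → Matrix (Fin n ⊕ Fin k) (Fin n ⊕ Fin k) ℝ} (hf : Continuous f)
    (hs : ∀ ε, (f ε)ᵀ = f ε) (h : CommonLyapunov P K γ₀ Γ (f 0)) :
    ∀ᶠ ε in 𝓝 0, CommonLyapunov P K γ₀ Γ (f ε) := by
  obtain ⟨hX, hBR, hL, hC, hD⟩ := h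
  have h1 : ∀ᶠ ε in 𝓝 0, (f ε).PosDef := eventually_posDef hf.continuousAt hs hX
  have h2 : ∀ᶠ ε in 𝓝 0, BoundedRealLMI P K γ₀ (f ε) := by
    refine eventually_posDef (f := fun ε => -symBlock3 (sym (f ε * Acl P K)) (f ε * Bcl P K)ᵀ
      (-(γ₀ • 1)) (Ccl P K) (Dcl P K) (-(γ₀ • 1))) ?_ (fun ε => ?_) hBR
    · unfold symBlock3 sym
      fun_prop
    · rw [transpose_neg, transpose_symBlock3 (transpose_sym _) (by simp) (by simp)]
  have h3 : ∀ᶠ ε in 𝓝 0, H2LyapunovLMI P K (f ε) := by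
    refine eventually_posDef (f := fun ε => -fromBlocks (sym ((Acl P K)ᵀ * f ε)) (f ε * Bcl P K)
      (f ε * Bcl P K)ᵀ (-(1 : Matrix (Fin nw) (Fin nw) ℝ))) ?_ (fun ε => ?_) hL
    · unfold sym
      fun_prop
    · rw [transpose_neg, fromBlocks_transpose, transpose_sym, transpose_transpose, transpose_neg,
        transpose_one]
  have h4 : ∀ᶠ ε in 𝓝 0, ∀ i, H2ChannelLMI P K (Γ i) i (f ε) := by
    refine eventually_all.mpr fun i => ?_
    refine eventually_posDef (f := fun ε => fromBlocks (Γ i • (1 : Matrix Unit Unit ℝ))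
      (rowMat (Cu P K) i) (rowMat (Cu P K) i)ᵀ (f ε)) ?_ (fun ε => ?_) (hC i)
    · fun_prop
    · rw [fromBlocks_transpose, transpose_smul, transpose_one, transpose_transpose, hs]
  filter_upwards [h1, h2, h3, h4] with ε h1 h2 h3 h4
  exact ⟨h1, h2, h3, h4, hD⟩

open Filter Topology in
lemma eventually_isUnit_det_add_smul {m : Type*} [Fintype m] [DecidableEq m] (N : Matrix m m ℝ) :
    ∀ᶠ ε : ℝ in 𝓝[≠] 0, IsUnit (N + ε • (1 : Matrix m m ℝ)).det := by
  have hfin : {ε : ℝ | (-N).charpoly.IsRoot ε}.Finite :=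
    Polynomial.finite_setOfPred_isRoot (charpoly_monic (-N)).ne_zero
  have hcl := (hfin.subset (Set.sdiff_subset (t := {0}))).isClosed.isOpen_compl.mem_nhds
    (x := (0 : ℝ)) (by simp)
  -- avoid the finitely many nonzero roots of the characteristic polynomial of `-N`
  filter_upwards [nhdsWithin_le_nhds hcl, self_mem_nhdsWithin] with ε h1 h2
  rw [isUnit_iff_ne_zero]
  intro h0
  refine h1 ⟨?_, h2⟩
  change (-N).charpoly.eval ε = 0
  rw [eval_charpoly, ← h0, sub_neg_eq_add, add_comm, scalar_apply,
    smul_one_eq_diagonal]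

/-- A common certificate of a full order controller can be perturbed so that its block `M` becomes
nonsingular, without changing the controller. -/
lemma CommonLyapunov.exists_lmiFeasible {K : Controller n nu ny}
    {Xcl : Matrix (Fin n ⊕ Fin n) (Fin n ⊕ Fin n) ℝ} (h : CommonLyapunov P K γ₀ Γ Xcl) :
    ∃ Xcl, LMIFeasible P γ₀ Γ K Xcl := by
  let f : ℝ → Matrix (Fin n ⊕ Fin n) (Fin n ⊕ Fin n) ℝ := fun ε => Xcl + ε • fromBlocks 0 1 1 0
  have hXs := (posDef_iff_real.mp h.1).1
  have hev := CommonLyapunov.eventually (P := P) (K := K) (γ₀ := γ₀) (Γ := Γ) (f := f)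
    (by fun_prop) (fun ε => by simp [f, hXs, fromBlocks_transpose]) (by simpa [f] using h)
  obtain ⟨ε, h1, h2⟩ := ((hev.filter_mono nhdsWithin_le_nhds).and
    (eventually_isUnit_det_add_smul (blockN Xcl))).exists
  refine ⟨f ε, (lmiFeasible_iff K _).mpr ⟨h1, ?_⟩⟩
  rw [← injective_congrMat_iff (X := blockX (f ε))]
  refine injective_congrMat_of_blockN h1.1 ?_
  have hN : blockN (f ε) = blockN Xcl + ε • 1 := by
    ext i j
    simp [f, blockN, toBlocks₁₂]
  rw [← isUnit_det_iff_injective, det_transpose, hN]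
  exact h2

/-! ### Controllers with additional modes -/

/-- The controller with `n` additional modes `x' = -x` that are decoupled from the rest. -/
def augment (n : ℕ) (K : Controller k nu ny) : Controller (k + n) nu ny where
  AK := (fromBlocks K.AK 0 0 (-1)).submatrix finSumFinEquiv.symm finSumFinEquiv.symm
  BK := (fromRows K.BK 0).submatrix (finSumFinEquiv (m := k) (n := n)).symm id
  CK := (fromCols K.CK 0).submatrix id (finSumFinEquiv (m := k) (n := n)).symm
  DK := K.DK

/-- The closed loop state of the augmented controller, with the additional modes split off. -/
def augmentEquiv (n k : ℕ) : Fin n ⊕ Fin (k + n) ≃ (Fin n ⊕ Fin k) ⊕ Fin n :=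
  (Equiv.sumCongr (Equiv.refl _) finSumFinEquiv.symm).trans (Equiv.sumAssoc _ _ _).symm

lemma Acl_augment (K : Controller k nu ny) : Acl P (augment n K) =
    (fromBlocks (Acl P K) 0 0 (-1)).submatrix (augmentEquiv n k) (augmentEquiv n k) := by
  ext i j
  rcases i with i | i <;> rcases j with j | j
  · simp [Acl, augment, augmentEquiv]
  · obtain ⟨j, rfl⟩ := finSumFinEquiv.surjective j
    rcases j with j | j <;> simp [Acl, augment, augmentEquiv, Matrix.mul_apply]
  · obtain ⟨i, rfl⟩ := finSumFinEquiv.surjective i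
    rcases i with i | i <;> simp [Acl, augment, augmentEquiv, Matrix.mul_apply]
  · obtain ⟨i, rfl⟩ := finSumFinEquiv.surjective i
    obtain ⟨j, rfl⟩ := finSumFinEquiv.surjective j
    rcases i with i | i <;> rcases j with j | j <;> simp [Acl, augment, augmentEquiv]

lemma Bcl_augment (K : Controller k nu ny) : Bcl P (augment n K) =
    (fromRows (Bcl P K) 0).submatrix (augmentEquiv n k) id := by
  ext i j
  rcases i with i | i
  · simp [Bcl, augment, augmentEquiv]
  · obtain ⟨i, rfl⟩ := finSumFinEquiv.surjective i
    rcases i with i | i <;> simp [Bcl, augment, augmentEquiv, Matrix.mul_apply]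

lemma Ccl_augment (K : Controller k nu ny) : Ccl P (augment n K) =
    (fromCols (Ccl P K) 0).submatrix id (augmentEquiv n k) := by
  ext i j
  rcases j with j | j
  · simp [Ccl, augment, augmentEquiv]
  · obtain ⟨j, rfl⟩ := finSumFinEquiv.surjective j
    rcases j with j | j <;> simp [Ccl, augment, augmentEquiv, Matrix.mul_apply]

lemma Cu_augment (K : Controller k nu ny) : Cu P (augment n K) =
    (fromCols (Cu P K) 0).submatrix id (augmentEquiv n k) := by
  ext i j
  rcases j with j | j
  · simp [Cu, augment, augmentEquiv]
  · obtain ⟨j, rfl⟩ := finSumFinEquiv.surjective j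
    rcases j with j | j <;> simp [Cu, augment, augmentEquiv]

end Feasibility

/-! ### Certificates under augmentation -/

section Reindexing

lemma Certificate.submatrix {a b w z u : Type*} [Fintype a] [DecidableEq a] [Fintype b] [Fintype w]
    [DecidableEq w] [Fintype z] [DecidableEq z] {γ : ℝ} {Γ : u → ℝ} {S : Matrix a a ℝ}
    {B : Matrix a w ℝ} {C : Matrix z a ℝ} {D : Matrix z w ℝ} {U : Matrix u a ℝ}
    {X : Matrix a a ℝ} (h : Certificate γ Γ S B C D U X) (e : b ≃ a) :
    Certificate γ Γ (S.submatrix e e) (B.submatrix e id) (C.submatrix id e) D (U.submatrix id e)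
      (X.submatrix e e) := by
  classical
  have hT : Function.Injective ((1 : Matrix a a ℝ).submatrix id e).mulVec := by
    refine injective_mulVec_iff.mpr fun v hv => ?_
    ext i
    have := congrFun hv (e i)
    simpa [mulVec, dotProduct, Matrix.one_apply] using this
  convert h.congr hT using 1 <;> ext i j <;>
    simp [Matrix.mul_apply, Matrix.one_apply]

lemma posDef_fromBlocks_diag {a b : Type*} [Fintype a] [Fintype b] [DecidableEq b]
    {A : Matrix a a ℝ} {D : Matrix b b ℝ} (hA : A.PosDef) (hD : D.PosDef) :
    (fromBlocks A 0 0 D).PosDef := by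
  have := (posDef_fromBlocks₂₂ (A := A) (B := 0) hD).mpr (by simpa using hA)
  simpa using this

lemma negDef_fromBlocks_diag {a b : Type*} [Fintype a] [Fintype b] [DecidableEq b]
    {A : Matrix a a ℝ} (hA : NegDef A) :
    NegDef (fromBlocks A 0 0 (sym (-(1 : Matrix b b ℝ)))) := by
  have h1 : (-(sym (-(1 : Matrix b b ℝ)))).PosDef := by
    have : -(sym (-(1 : Matrix b b ℝ))) = 1 + 1 := by simp [sym]
    rw [this]
    exact PosDef.one.add PosDef.one
  have := posDef_fromBlocks_diag hA h1
  rw [NegDef, fromBlocks_neg]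
  simpa using this

/-- Adjoining stable decoupled states preserves a certificate. -/
lemma Certificate.augment {a c w z u : Type*} [Fintype a] [Fintype c] [DecidableEq c] [Fintype w]
    [DecidableEq w] [Fintype z] [DecidableEq z] {γ : ℝ} {Γ : u → ℝ} {S : Matrix a a ℝ}
    {B : Matrix a w ℝ} {C : Matrix z a ℝ} {D : Matrix z w ℝ} {U : Matrix u a ℝ}
    {X : Matrix a a ℝ} (h : Certificate γ Γ S B C D U X) :
    Certificate γ Γ (fromBlocks S 0 0 (-(1 : Matrix c c ℝ))) (fromRows B 0) (fromCols C 0) D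
      (fromCols U 0) (fromBlocks X 0 0 1) := by
  have hsym : sym (fromBlocks S 0 0 (-(1 : Matrix c c ℝ))) = fromBlocks (sym S) 0 0 (sym (-1)) := by
    simp [sym, fromBlocks_transpose, fromBlocks_add]
  obtain ⟨h1, h2, h3⟩ := h
  refine ⟨?_, ?_, fun i => ?_⟩
  · let e : ((a ⊕ c) ⊕ w) ⊕ z → ((a ⊕ w) ⊕ z) ⊕ c := fun
      | .inl (.inl (.inl x)) => .inl (.inl (.inl x))
      | .inl (.inl (.inr y)) => .inr y
      | .inl (.inr i) => .inl (.inl (.inr i))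
      | .inr j => .inl (.inr j)
    have he : Function.Injective e := by
      rintro (((x | x) | x) | x) (((y | y) | y) | y) <;> simp [e]
    have := (negDef_fromBlocks_diag (b := c) h1).submatrix he
    rw [NegDef, hsym]
    convert this using 1
    ext i j
    rcases i with ((x | x) | x) | x <;> rcases j with ((y | y) | y) | y <;> simp [e, symBlock3]
  · let e : (a ⊕ c) ⊕ w → (a ⊕ w) ⊕ c := fun
      | .inl (.inl x) => .inl (.inl x)
      | .inl (.inr y) => .inr y
      | .inr i => .inl (.inr i)
    have he : Function.Injective e := by
      rintro ((x | x) | x) ((y | y) | y) <;> simp [e]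
    have := (negDef_fromBlocks_diag (b := c) h2).submatrix he
    rw [NegDef, hsym]
    convert this using 1
    ext i j
    rcases i with (x | x) | x <;> rcases j with (y | y) | y <;> simp [e]
  · have := (posDef_fromBlocks_diag (h3 i) (PosDef.one (n := c) (R := ℝ))).submatrix
      (Equiv.sumAssoc Unit a c).symm.injective
    convert this using 1
    ext i j
    rcases i with x | (x | x) <;> rcases j with y | (y | y) <;> simp [rowMat]

end Reindexing

/-! ### Perturbation of the augmented certificate -/

section Augmentation

variable {n nu nw nz ny k : ℕ} {P : Plant n nu nw nz ny} {γ₀ : ℝ} {Γ : Fin nu → ℝ}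

/-- The Lyapunov matrices of the augmented closed loop: the block `N` becomes `[N, εI]`, which has
full row rank for `ε ≠ 0`. -/
def augmentLyap (Xcl : Matrix (Fin n ⊕ Fin k) (Fin n ⊕ Fin k) ℝ) (ε : ℝ) :
    Matrix (Fin n ⊕ Fin (k + n)) (Fin n ⊕ Fin (k + n)) ℝ :=
  (fromBlocks Xcl (ε • fromRows 1 0) (ε • fromCols 1 0) 1).submatrix (augmentEquiv n k)
    (augmentEquiv n k)

lemma CommonLyapunov.augment {K : Controller k nu ny}
    {Xcl : Matrix (Fin n ⊕ Fin k) (Fin n ⊕ Fin k) ℝ} (h : CommonLyapunov P K γ₀ Γ Xcl) :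
    CommonLyapunov P (augment n K) γ₀ Γ (augmentLyap Xcl 0) := by
  obtain ⟨hX, hc, hD⟩ := (commonLyapunov_iff P K γ₀ Γ Xcl).mp h
  have e1 : fromBlocks Xcl 0 0 (1 : Matrix (Fin n) (Fin n) ℝ) * fromBlocks (Acl P K) 0 0 (-1) =
      fromBlocks (Xcl * Acl P K) 0 0 (-1) := by
    simp [fromBlocks_multiply]
  have e2 : fromBlocks Xcl 0 0 (1 : Matrix (Fin n) (Fin n) ℝ) *
      fromRows (Bcl P K) (0 : Matrix (Fin n) (Fin nw) ℝ) = fromRows (Xcl * Bcl P K) 0 := by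
    rw [fromBlocks_mul_fromRows]
    simp
  rw [commonLyapunov_iff, augmentLyap, Acl_augment, Bcl_augment, Ccl_augment, Cu_augment]
  simp only [zero_smul, submatrix_mul_equiv, e1, e2]
  refine ⟨(posDef_fromBlocks_diag hX PosDef.one).submatrix (augmentEquiv n k).injective, ?_, hD⟩
  exact (hc.augment (c := Fin n)).submatrix (augmentEquiv n k)

/-- A certificate for a controller of any order gives transformed variables: those of the augmented
controller with a slightly perturbed Lyapunov matrix. -/
lemma CommonLyapunov.exists_hatFeasible {K : Controller k nu ny}
    {Xcl : Matrix (Fin n ⊕ Fin k) (Fin n ⊕ Fin k) ℝ} (h : CommonLyapunov P K γ₀ Γ Xcl) :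
    ∃ v, HatFeasible P γ₀ Γ v := by
  have hXs := (posDef_iff_real.mp h.1).1
  have hcont : Continuous (augmentLyap Xcl) := by
    unfold augmentLyap
    fun_prop
  have hev := CommonLyapunov.eventually hcont (fun ε => by
    simp [augmentLyap, transpose_submatrix, fromBlocks_transpose, hXs, transpose_fromRows,
      transpose_fromCols]) h.augment
  obtain ⟨ε, h1, h2⟩ := ((hev.filter_mono nhdsWithin_le_nhds).and
    (self_mem_nhdsWithin (s := {(0 : ℝ)}ᶜ))).exists
  refine ⟨_, h1.hatFeasible (injective_mulVec_iff.mpr fun v hv => ?_)⟩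
  ext j
  have := congrFun hv (finSumFinEquiv (Sum.inr j))
  simp [mulVec, dotProduct, blockN, toBlocks₁₂, augmentLyap, augmentEquiv, Matrix.one_apply] at this
  exact this.resolve_left h2

end Augmentation

/-! ### Reconstruction of a controller -/

section Reconstruction

variable {n nu nw nz ny : ℕ} {P : Plant n nu nw nz ny} {γ₀ : ℝ} {Γ : Fin nu → ℝ}
  {v : HatVars n nu ny} {M N : Matrix (Fin n) (Fin n) ℝ}

lemma HatFeasible.transpose_X (h : HatFeasible P γ₀ Γ v) : v.Xᵀ = v.X := by
  have := (posDef_iff_real.mp h.2.1).1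
  rw [fromBlocks_transpose, fromBlocks_inj] at this
  exact this.1

lemma HatFeasible.transpose_Y (h : HatFeasible P γ₀ Γ v) : v.Yᵀ = v.Y := by
  have := (posDef_iff_real.mp h.2.1).1
  rw [fromBlocks_transpose, fromBlocks_inj] at this
  exact this.2.2.2

lemma HatFeasible.isUnit_det (h : HatFeasible P γ₀ Γ v) : IsUnit (1 - v.X * v.Y).det := by
  rw [isUnit_det_iff_injective, injective_mulVec_iff]
  intro b hb
  -- `[X, I; I, Y]` maps `(-Y b, b)` to `((I - X Y) b, 0)`.
  have hinj := injective_mulVec_iff.mp (mulVec_injective_iff_isUnit.mpr h.2.1.isUnit)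
    (-(v.Y *ᵥ b) ⊕ᵥ b) (by
      have hb' : -((v.X * v.Y) *ᵥ b) + b = 0 := by
        rwa [sub_mulVec, one_mulVec, sub_eq_neg_add] at hb
      rw [fromBlocks_mulVec]
      simp [mulVec_neg, hb'])
  ext i
  exact congrFun hinj (Sum.inr i)

/-- The Lyapunov matrix that the linearizing congruence `T = [X, I; Mᵀ, 0]` takes to
`[X, I; I, Y]`. -/
noncomputable def reconstructLyap (v : HatVars n nu ny) (M : Matrix (Fin n) (Fin n) ℝ) :
    Matrix (Fin n ⊕ Fin n) (Fin n ⊕ Fin n) ℝ :=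
  ((congrMat v.X M)⁻¹)ᵀ * fromBlocks v.X 1 1 v.Y * (congrMat v.X M)⁻¹

lemma HatFeasible.isUnit_det_factors (h : HatFeasible P γ₀ Γ v)
    (hMN : M * Nᵀ = 1 - v.X * v.Y) : IsUnit M.det ∧ IsUnit N.det := by
  have := h.isUnit_det
  rw [← hMN, det_mul, det_transpose] at this
  exact IsUnit.mul_iff.mp this

lemma HatFeasible.isUnit_det_congrMat (h : HatFeasible P γ₀ Γ v)
    (hMN : M * Nᵀ = 1 - v.X * v.Y) : IsUnit (congrMat v.X M).det :=
  isUnit_det_iff_injective.mpr (injective_congrMat_iff.mpr (h.isUnit_det_factors hMN).1)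

lemma HatFeasible.posDef_reconstructLyap (h : HatFeasible P γ₀ Γ v)
    (hMN : M * Nᵀ = 1 - v.X * v.Y) : (reconstructLyap v M).PosDef := by
  refine posDef_congr h.2.1 (isUnit_det_iff_injective.mp ?_)
  exact isUnit_nonsing_inv_det _ (h.isUnit_det_congrMat hMN)

lemma HatFeasible.reconstructLyap_mul (h : HatFeasible P γ₀ Γ v)
    (hMN : M * Nᵀ = 1 - v.X * v.Y) :
    reconstructLyap v M * congrMat v.X M = fromBlocks 1 v.Y 0 Nᵀ := by
  have hT := h.isUnit_det_congrMat hMN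
  have e : fromBlocks v.X 1 1 v.Y = (congrMat v.X M)ᵀ * fromBlocks 1 v.Y 0 Nᵀ := by
    rw [congrMat, fromBlocks_transpose, fromBlocks_multiply, h.transpose_X]
    simp [hMN]
  rw [reconstructLyap, e, Matrix.mul_assoc, nonsing_inv_mul _ hT, Matrix.mul_one,
    ← Matrix.mul_assoc, ← transpose_mul, mul_nonsing_inv _ hT, transpose_one, Matrix.one_mul]

/-- The blocks are read off from `X_cl [X, I; Mᵀ, 0] = [I, Y; 0, Nᵀ]` and its inverse form
`X_cl⁻¹ [I, Y; 0, Nᵀ] = [X, I; Mᵀ, 0]`. -/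
lemma HatFeasible.blocks_reconstructLyap (h : HatFeasible P γ₀ Γ v)
    (hMN : M * Nᵀ = 1 - v.X * v.Y) :
    blockY (reconstructLyap v M) = v.Y ∧ blockN (reconstructLyap v M) = N ∧
      blockX (reconstructLyap v M) = v.X ∧ blockM (reconstructLyap v M) = M := by
  have hX := h.posDef_reconstructLyap hMN
  have hmul := h.reconstructLyap_mul hMN
  have hs := (posDef_iff_real.mp hX).1
  have hsi := (posDef_iff_real.mp hX.inv).1
  have h1 := congrArg Matrix.transpose hmul
  rw [transpose_mul, hs] at h1
  have h2 : (reconstructLyap v M)⁻¹ * fromBlocks 1 v.Y 0 Nᵀ = congrMat v.X M := by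
    rw [← hmul, ← Matrix.mul_assoc, nonsing_inv_mul _ ((isUnit_iff_isUnit_det _).mp hX.isUnit),
      Matrix.one_mul]
  have h3 := congrArg Matrix.transpose h2
  rw [transpose_mul, hsi] at h3
  generalize reconstructLyap v M = Z at *
  rw [← fromBlocks_toBlocks Z, congrMat, fromBlocks_transpose, fromBlocks_transpose,
    fromBlocks_multiply, fromBlocks_inj] at h1
  rw [← fromBlocks_toBlocks Z⁻¹, congrMat, fromBlocks_transpose, fromBlocks_transpose,
    fromBlocks_multiply, fromBlocks_inj] at h3
  obtain ⟨-, -, a1, a2⟩ := h1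
  obtain ⟨b1, b2, -, -⟩ := h3
  simp only [transpose_one, transpose_zero, transpose_transpose, Matrix.one_mul, Matrix.zero_mul,
    add_zero, h.transpose_X, h.transpose_Y] at a1 a2 b1 b2
  exact ⟨a1, a2, b1, b2⟩

lemma HatFeasible.hat_reconstruct (h : HatFeasible P γ₀ Γ v)
    (hMN : M * Nᵀ = 1 - v.X * v.Y) :
    hat P (reconstruct P v M N) (reconstructLyap v M) = v := by
  obtain ⟨hY, hN, hX, hM⟩ := h.blocks_reconstructLyap hMN
  obtain ⟨uM, uN⟩ := h.isUnit_det_factors hMN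
  have uMt : IsUnit Mᵀ.det := by rwa [det_transpose]
  have c1 : ∀ {l : ℕ} (R : Matrix (Fin l) (Fin n) ℝ), R * (Mᵀ)⁻¹ * Mᵀ = R := fun R => by
    rw [Matrix.mul_assoc, nonsing_inv_mul _ uMt, Matrix.mul_one]
  have c2 : ∀ {l : ℕ} (R : Matrix (Fin n) (Fin l) ℝ), N * (N⁻¹ * R) = R := fun R => by
    rw [← Matrix.mul_assoc, mul_nonsing_inv _ uN, Matrix.one_mul]
  obtain ⟨A, B, C, D, X, Y⟩ := v
  simp only [hat, hY, hN, hX, hM, HatVars.mk.injEq, reconstruct, and_true]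
  refine ⟨?_, ?_, ?_⟩
  · rw [Matrix.mul_assoc N⁻¹, c2, c1]
    abel
  · rw [c2, sub_add_cancel]
  · rw [c1, sub_add_cancel]

lemma HatFeasible.lmiFeasible_reconstruct (h : HatFeasible P γ₀ Γ v)
    (hMN : M * Nᵀ = 1 - v.X * v.Y) :
    LMIFeasible P γ₀ Γ (reconstruct P v M N) (reconstructLyap v M) := by
  refine ⟨h.1, h.posDef_reconstructLyap hMN, ?_⟩
  rw [h.hat_reconstruct hMN]
  exact h.2.2

end Reconstruction

end SparseControl

/-! ### The equivalence of the problems -/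

open SparseControl in
theorem theorem3 {n nu nw nz ny : ℕ} (P : Plant n nu nw nz ny)
    (γ₀ : ℝ) (hγ₀ : 0 < γ₀) (ρ : Fin nu → ℝ) (hρ : ∀ i, 0 < ρ i) :
    -- each performance requirement, taken alone, is equivalent to a Lyapunov certificate
    (∀ (k : ℕ) (K : Controller k nu ny),
      ((Hurwitz (Acl P K) ∧ hinfNorm (Gz P K) < ENNReal.ofReal γ₀) ↔
        ∃ Xcl, Xcl.PosDef ∧ BoundedRealLMI P K γ₀ Xcl) ∧
      (∀ (i : Fin nu) (g : ℝ),
        (Hurwitz (Acl P K) ∧ h2Norm (Gu P K i) < ENNReal.ofReal (Real.sqrt g)) ↔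
        rowMat (K.DK * P.Dyw) i = 0 ∧
          ∃ Xcl, Xcl.PosDef ∧ H2LyapunovLMI P K Xcl ∧ H2ChannelLMI P K g i Xcl)) ∧
    -- for full-order controllers the synthesis inequalities say that `Xcl` is a common certificate
    (∀ (Γ : Fin nu → ℝ) (K : Controller n nu ny) (Xcl : Matrix (Fin n ⊕ Fin n) (Fin n ⊕ Fin n) ℝ),
      LMIFeasible P γ₀ Γ K Xcl ↔ CommonLyapunov P K γ₀ Γ Xcl ∧ IsUnit (blockM Xcl).det) ∧
    -- so the two problems have the same feasible pairs `(Γ, J)`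
    (∀ (Γ : Fin nu → ℝ) (K : Controller n nu ny),
      (∃ Xcl, LMIFeasible P γ₀ Γ K Xcl) ↔ ∃ Xcl, CommonLyapunov P K γ₀ Γ Xcl) ∧
    -- and every feasible point solves the design constraints
    (∀ (Γ : Fin nu → ℝ) (K : Controller n nu ny) (Xcl : Matrix (Fin n ⊕ Fin n) (Fin n ⊕ Fin n) ℝ),
      LMIFeasible P γ₀ Γ K Xcl → DesignFeasible P K γ₀ Γ) ∧
    -- controller construction from freely chosen transformed variables
    (∀ (Γ : Fin nu → ℝ) (v : HatVars n nu ny), HatFeasible P γ₀ Γ v →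
      IsUnit (1 - v.X * v.Y).det ∧
      ∀ M N : Matrix (Fin n) (Fin n) ℝ, M * Nᵀ = 1 - v.X * v.Y →
        DesignFeasible P (reconstruct P v M N) γ₀ Γ ∧
        ∃ Xcl, LMIFeasible P γ₀ Γ (reconstruct P v M N) Xcl ∧
          hat P (reconstruct P v M N) Xcl = v ∧ blockM Xcl = M ∧ blockN Xcl = N) ∧
    -- conversely, a common certificate for a controller of any order yields transformed variables
    (∀ (k : ℕ) (Γ : Fin nu → ℝ) (K : Controller k nu ny),
      (∃ Xcl, CommonLyapunov P K γ₀ Γ Xcl) → ∃ v : HatVars n nu ny, HatFeasible P γ₀ Γ v) ∧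
    -- optimal values
    (optValue ρ {Γ | ∃ (K : Controller n nu ny) (Xcl : _), LMIFeasible P γ₀ Γ K Xcl} =
      optValue ρ {Γ | ∃ (K : Controller n nu ny) (Xcl : _), CommonLyapunov P K γ₀ Γ Xcl}) ∧
    (optValue ρ {Γ | ∃ v : HatVars n nu ny, HatFeasible P γ₀ Γ v} =
      optValue ρ {Γ | ∃ (K : Controller n nu ny) (Xcl : _), LMIFeasible P γ₀ Γ K Xcl}) ∧
    (optValue ρ {Γ | ∃ K : Controller n nu ny, DesignFeasible P K γ₀ Γ} ≤
      optValue ρ {Γ | ∃ v : HatVars n nu ny, HatFeasible P γ₀ Γ v}) := by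
  have hpairs : ∀ (Γ : Fin nu → ℝ) (K : Controller n nu ny),
      (∃ Xcl, LMIFeasible P γ₀ Γ K Xcl) ↔ ∃ Xcl, CommonLyapunov P K γ₀ Γ Xcl := fun Γ K =>
    ⟨fun ⟨Xcl, h⟩ => ⟨Xcl, ((lmiFeasible_iff K Xcl).mp h).1⟩, fun ⟨_, h⟩ => h.exists_lmiFeasible⟩
  have hdesign : ∀ (Γ : Fin nu → ℝ) (K : Controller n nu ny)
      (Xcl : Matrix (Fin n ⊕ Fin n) (Fin n ⊕ Fin n) ℝ),
      LMIFeasible P γ₀ Γ K Xcl → DesignFeasible P K γ₀ Γ := fun Γ K Xcl h =>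
    ((lmiFeasible_iff K Xcl).mp h).1.designFeasible hγ₀
  -- For the free form the factorization `(1 - X Y) * 1ᵀ` provides a controller.
  have hfree : ∀ Γ : Fin nu → ℝ, (∃ v : HatVars n nu ny, HatFeasible P γ₀ Γ v) ↔
      ∃ (K : Controller n nu ny) (Xcl : _), LMIFeasible P γ₀ Γ K Xcl := fun Γ =>
    ⟨fun ⟨v, h⟩ => ⟨_, _, h.lmiFeasible_reconstruct (M := 1 - v.X * v.Y) (N := 1) (by simp)⟩,
      fun ⟨K, Xcl, h⟩ => ((lmiFeasible_iff K Xcl).mp h).1.exists_hatFeasible⟩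
  refine ⟨fun k K => ⟨boundedReal_iff hγ₀ K, h2Channel_iff K⟩, fun Γ => lmiFeasible_iff, hpairs,
    hdesign, fun Γ v h => ⟨h.isUnit_det, fun M N hMN => ?_⟩,
    fun k Γ K ⟨_, h⟩ => h.exists_hatFeasible, ?_, ?_, ?_⟩
  · obtain ⟨-, hN, -, hM⟩ := h.blocks_reconstructLyap hMN
    have hL := h.lmiFeasible_reconstruct hMN
    exact ⟨hdesign _ _ _ hL, _, hL, h.hat_reconstruct hMN, hM, hN⟩
  · simp only [hpairs]
  · simp only [hfree]
  · refine biInf_mono fun Γ hΓ => ?_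
    obtain ⟨K, Xcl, h⟩ := (hfree Γ).mp hΓ
    exact ⟨K, hdesign Γ K Xcl h⟩
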